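/- Let $\mathbb{K}$ be a field, let $G$ be a simple graph on the vertex set $[n]=\{1,\dots,n\}$, let $S=\mathbb{K}[x_1,\dots,x_n,y_1,\dots,y_n]$ with the standard grading, and let $$J_G=\bigl(x_iy_j-x_jy_i \;:\; i<j,\ \{i,j\}\in E(G)\bigr)\subset S$$ be the binomial edge ideal of $G$. For a finitely generated graded $S$-module $M\neq 0$, let $$\operatorname{reg}(M)=\max\{\,j-i \;:\; \operatorname{Tor}_i^S(M,\mathbb{K})_j\neq 0\,\}$$ denote its Castelnuovo–Mumford regularity. Suppose that $G$ is unicyclic, that is, $G$ is connected and contains exactly one cycle as a subgraph, that the girth of $G$ (the length of a shortest cycle) is at least $4$, and that $J_G$ is an almost complete intersection, that is, the minimal number of generators of $J_G$ equals $\operatorname{ht}(J_G)+1$. Then for all integers $s\ge 1$, $$2s+n-5\;\le\;\operatorname{reg}(S/J_G^s)\;\le\;2s+n-4 .$$ -/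

import Mathlib

noncomputable section

/-- A subgraph of `G` that is a cycle: connected, and every vertex has degree two in it. -/
def SimpleGraph.Subgraph.IsCycleSubgraph {V : Type*} {G : SimpleGraph V} (H : G.Subgraph) : Prop :=
  H.Connected ∧ ∀ v ∈ H.verts, (H.neighborSet v).ncard = 2

/-- A unicyclic graph: a connected graph containing exactly one cycle as a subgraph. -/
def SimpleGraph.IsUnicyclic {V : Type*} (G : SimpleGraph V) : Prop :=
  G.Connected ∧ ∃! H : G.Subgraph, H.IsCycleSubgraph

/-- The `2n` variables: `Sum.inlₗ i` indexes `x_i` and `Sum.inrₗ i` indexes `y_i`.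
The order `x_1 < ⋯ < x_n < y_1 < ⋯ < y_n` is used only for the signs in the Koszul complex. -/
abbrev EdgeVar (n : ℕ) : Type := Fin n ⊕ₗ Fin n

/-- The binomial edge ideal `J_G` in `S = K[x_1, …, x_n, y_1, …, y_n]`, generated by
`x_i y_j - x_j y_i` for the edges `{i, j}` of `G` with `i < j`. -/
def binomialEdgeIdeal (K : Type*) [Field K] {n : ℕ} (G : SimpleGraph (Fin n)) :
    Ideal (MvPolynomial (EdgeVar n) K) :=
  Ideal.span {f | ∃ i j : Fin n, i < j ∧ G.Adj i j ∧
    f = MvPolynomial.X (Sum.inlₗ i) * MvPolynomial.X (Sum.inrₗ j)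
      - MvPolynomial.X (Sum.inlₗ j) * MvPolynomial.X (Sum.inrₗ i)}

/-- Almost complete intersection: the minimal number of generators exceeds the height by one.
(Some authors also ask that `I` be a complete intersection locally at its minimal primes; this is
automatic for radical ideals of a polynomial ring, hence for binomial edge ideals.) -/
def Ideal.IsAlmostCompleteIntersection {R : Type*} [CommRing R] (I : Ideal R) : Prop :=
  (Submodule.spanFinrank I : ℕ∞) = I.height + 1

section Koszul

variable (K : Type*) [Field K] {σ : Type*} [Fintype σ] [LinearOrder σ]
  (M : Type*) [AddCommGroup M] [Module K M] [Module (MvPolynomial σ K) M]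
  [IsScalarTower K (MvPolynomial σ K) M]

/-- The differential of the Koszul complex `K(x; M) = ⨁_A M e_A` on the variables `x_v`, `v : σ`,
where `A` runs over the subsets of `σ`:
`∂ (m e_A) = ∑_{v ∈ A} (-1)^{#{w ∈ A | w < v}} x_v m e_{A ∖ v}`.
An element `∑_A c_A e_A` is the function `A ↦ c_A`. -/
def koszulDifferential : (Finset σ → M) →ₗ[K] (Finset σ → M) where
  toFun c := fun B => ∑ v ∈ Finset.univ \ B,
    ((-1 : MvPolynomial σ K) ^ (B.filter (· < v)).card * MvPolynomial.X v) • c (insert v B)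
  map_add' c d := by
    funext B
    simp only [Pi.add_apply, smul_add, Finset.sum_add_distrib]
  map_smul' a c := by
    funext B
    simp only [Pi.smul_apply, RingHom.id_apply, Finset.smul_sum]
    refine Finset.sum_congr rfl fun v _ => ?_
    exact smul_comm _ _ _

variable {K M}

/-- The degree `j` part of the `i`-th term of the Koszul complex of a graded module `M = ⨁ ℳ d`:
sums of `c_A e_A` with `#A = i` and `c_A` of degree `j - i` (each `e_A` has degree `#A`). -/
def koszulChains (σ : Type*) (ℳ : ℤ → Submodule K M) (i : ℕ) (j : ℤ) :
    Submodule K (Finset σ → M) where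
  carrier := {c | ∀ A : Finset σ, (A.card = i → c A ∈ ℳ (j - i)) ∧ (A.card ≠ i → c A = 0)}
  add_mem' {c d} hc hd A :=
    ⟨fun h => add_mem ((hc A).1 h) ((hd A).1 h),
      fun h => by rw [Pi.add_apply, (hc A).2 h, (hd A).2 h, add_zero]⟩
  zero_mem' _ := ⟨fun _ => zero_mem _, fun _ => rfl⟩
  smul_mem' a c hc A :=
    ⟨fun h => Submodule.smul_mem _ a ((hc A).1 h),
      fun h => by rw [Pi.smul_apply, (hc A).2 h, smul_zero]⟩

variable (σ)

/-- The cycles of degree `j` in homological degree `i`. -/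
def koszulCycles (ℳ : ℤ → Submodule K M) (i : ℕ) (j : ℤ) : Submodule K (Finset σ → M) :=
  koszulChains σ ℳ i j ⊓ LinearMap.ker (koszulDifferential (σ := σ) K M)

/-- The boundaries of degree `j` in homological degree `i`. -/
def koszulBoundaries (ℳ : ℤ → Submodule K M) (i : ℕ) (j : ℤ) : Submodule K (Finset σ → M) :=
  (koszulChains σ ℳ (i + 1) j).map (koszulDifferential (σ := σ) K M)

/-- The graded Betti number `β_{i,j}(M) = dim_K Tor_i^S(M, K)_j`, where `S = K[x_v : v ∈ σ]`
and `M = ⨁ ℳ d` is a finitely generated graded `S`-module. Here `Tor^S(M, K)` is computed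
from the Koszul complex, which resolves `K` over `S`. -/
def gradedBetti (ℳ : ℤ → Submodule K M) (i : ℕ) (j : ℤ) : ℕ :=
  Module.finrank K
    (koszulCycles σ ℳ i j ⧸ (koszulBoundaries σ ℳ i j).submoduleOf (koszulCycles σ ℳ i j))

/-- `r` is the Castelnuovo–Mumford regularity of `M`: the largest `j - i` with
`β_{i,j}(M) ≠ 0`. -/
def HasRegularity (ℳ : ℤ → Submodule K M) (r : ℤ) : Prop :=
  IsGreatest {m : ℤ | ∃ (i : ℕ) (j : ℤ), gradedBetti σ ℳ i j ≠ 0 ∧ m = j - i} r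

end Koszul

/-- The standard grading of `S ⧸ I` for a homogeneous ideal `I` of `S = K[x_v : v ∈ σ]`: the
degree `d` part is the image of the forms of degree `d` (and is zero for `d < 0`). -/
def quotientGrading {K : Type*} [Field K] {σ : Type*} (I : Ideal (MvPolynomial σ K)) (d : ℤ) :
    Submodule K (MvPolynomial σ K ⧸ I) :=
  if 0 ≤ d then
    (MvPolynomial.homogeneousSubmodule σ K d.toNat).map (Ideal.Quotient.mkₐ K I).toLinearMap
  else ⊥

end

/-! Shape of the graph. Let `T` be a set of vertices and `F` a set of edges avoiding `T` that
connects the ends of every edge of `G - T`. Krull's height theorem gives `ht J_G ≤ 2|T| + |F|`. The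
edge binomials being minimal generators, the almost complete intersection hypothesis yields `|E(G)|
≤ 2|T| + |F| + 1`. Taking `T` empty, a vertex, or two nonadjacent vertices bounds the number of
edges and the degrees. With the girth condition, some edge that is not a bridge meets all vertices
of degree three, and deleting it leaves a Hamiltonian path. So `J_G = J = I + (g)`: here `I` is
generated by the `ℓ = n - 1` binomials of a path, a regular sequence of quadrics, and `g = f_ab`
with `b ≥ a + 2` (`exists_pathVars`).

Upper bound. Put `Q = I : g`. Because `I` is quasi-regular and `g² u ∈ I` forces `g u ∈ I`, one has
`J^k ∩ (I^(k+1) : g) ⊆ Q I^k`, which gives the exact sequence `0 → J^k(-2) → J^(k+1) → I^(k+1) ⧸ g Q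
I^k → 0`. By induction, `reg J^s ≤ 2s + ℓ - 2` follows from `reg (I^(k+1) ⧸ g Q I^k) ≤ 2k + ℓ`. Two
facts give the latter. First, `reg (S ⧸ Q) ≤ ℓ - 2` (`regLT_quotBy_minor`), so `reg (g Q I^k) ≤ 2k +
ℓ + 1`. Second, the bound `2k + ℓ + 1` for `I^(k+1)` itself is one too large, but its critical
classes come from multiples of the product `Z` of the Koszul one-forms lifting the generators. An
explicit computation shows that `Z` is `g C` modulo `I` and boundaries, with `∂C` having
coefficients in `Q` (`exists_isAlmostCI`); hence these classes vanish in the quotient.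

Lower bound. Setting `x_a = y_a = 0` retracts onto the graph without the vertex `a`, a union of
paths with at least `n - 3` edges. There `f^(s-1) Z'`, with `f` an edge binomial and `Z'` the
product of one-forms, is not a boundary modulo the `s`-th power (`exists_cycle`).

Regularity is handled on Koszul chains with polynomial coefficients: `RegLT A B m` says `reg (A ⧸ B)
< m`, and long exact sequences become manipulations of chains. -/

set_option linter.unusedSectionVars false

noncomputable section

open MvPolynomial

universe u

namespace Koszul

/-! ### The Koszul complex on all variables: contraction, wedge, differential. -/

section Operators

variable {K : Type*} [Field K] {σ : Type*} [LinearOrder σ]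

/-- The chains of the Koszul complex of `K[x_v : v ∈ σ]`: `∑_A c_A e_A` is the function `c`. -/
abbrev Chain (K σ : Type*) [Field K] : Type _ := Finset σ → MvPolynomial σ K

/-- The sign of moving `e_v` into its place in `e_B`. -/
def sgn (K : Type*) [Field K] (v : σ) (B : Finset σ) : MvPolynomial σ K :=
  (-1) ^ (B.filter (· < v)).card

lemma sgn_mul_self (v : σ) (B : Finset σ) : sgn K v B * sgn K v B = 1 := by
  rw [sgn, ← mul_pow]; simp

lemma sgn_insert_self (v : σ) (B : Finset σ) : sgn K v (insert v B) = sgn K v B := by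
  rw [sgn, sgn, Finset.filter_insert, if_neg (lt_irrefl v)]

lemma sgn_erase_self (v : σ) (B : Finset σ) : sgn K v (B.erase v) = sgn K v B := by
  by_cases h : v ∈ B
  · conv_rhs => rw [← Finset.insert_erase h, sgn_insert_self]
  · rw [Finset.erase_eq_of_notMem h]

lemma sgn_insert {v w : σ} {B : Finset σ} (hw : w ∉ B) :
    sgn K v (insert w B) = if w < v then - sgn K v B else sgn K v B := by
  rw [sgn, sgn, Finset.filter_insert]
  split_ifs with h
  · rw [Finset.card_insert_of_notMem (by simp [hw]), pow_succ, mul_neg_one]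
  · rfl

/-- Inserting `e_v` and `e_w` in the two possible orders differs by one transposition; all
anticommutation rules below rest on this sign. -/
lemma sgn_swap {v w : σ} {B : Finset σ} (hvw : v ≠ w) (hv : v ∉ B) (hw : w ∉ B) :
    sgn K v (insert w B) * sgn K w B = - (sgn K w (insert v B) * sgn K v B) := by
  rw [sgn_insert hw, sgn_insert hv]
  rcases lt_or_gt_of_ne hvw with h | h
  · rw [if_neg h.not_gt, if_pos h]; ring
  · rw [if_pos h, if_neg h.not_gt]; ring

/-- Contraction with the dual of `e_v`. -/
def contract (v : σ) : Chain K σ →ₗ[MvPolynomial σ K] Chain K σ where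
  toFun c := fun B => if v ∈ B then 0 else sgn K v B * c (insert v B)
  map_add' c d := by funext B; by_cases h : v ∈ B <;> simp [h, mul_add]
  map_smul' a c := by funext B; by_cases h : v ∈ B <;> simp [h, mul_left_comm]

/-- Left multiplication by `e_v`. -/
def wedge (v : σ) : Chain K σ →ₗ[MvPolynomial σ K] Chain K σ where
  toFun c := fun B => if v ∈ B then sgn K v B * c (B.erase v) else 0
  map_add' c d := by funext B; by_cases h : v ∈ B <;> simp [h, mul_add]
  map_smul' a c := by funext B; by_cases h : v ∈ B <;> simp [h, mul_left_comm]

lemma contract_apply (v : σ) (c : Chain K σ) (B : Finset σ) :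
    contract v c B = if v ∈ B then 0 else sgn K v B * c (insert v B) := rfl

lemma wedge_apply (v : σ) (c : Chain K σ) (B : Finset σ) :
    wedge v c B = if v ∈ B then sgn K v B * c (B.erase v) else 0 := rfl

lemma contract_contract_self (v : σ) (c : Chain K σ) : contract v (contract v c) = 0 := by
  funext B; simp [contract_apply]

lemma wedge_wedge_self (v : σ) (c : Chain K σ) : wedge v (wedge v c) = 0 := by
  funext B; simp [wedge_apply]

lemma contract_contract (v w : σ) (c : Chain K σ) :
    contract v (contract w c) = - contract w (contract v c) := by
  by_cases hvw : v = w
  · subst hvw; rw [contract_contract_self, neg_zero]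
  funext B
  simp only [contract_apply, Pi.neg_apply]
  by_cases hv : v ∈ B
  · simp [hv]
  by_cases hw : w ∈ B
  · simp [hw]
  simp only [hv, hw, Finset.mem_insert, Ne.symm hvw, hvw, or_false, if_false, Finset.insert_comm w v]
  linear_combination (c (insert v (insert w B))) * (sgn_swap (K := K) hvw hv hw)

lemma contract_wedge_self (v : σ) (c : Chain K σ) :
    contract v (wedge v c) + wedge v (contract v c) = c := by
  funext B
  simp only [Pi.add_apply, contract_apply, wedge_apply]
  by_cases hv : v ∈ B
  · simp only [hv, if_true, Finset.mem_erase, ne_eq, not_true, false_and, if_false, zero_add,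
      Finset.insert_erase, sgn_erase_self, ← mul_assoc, sgn_mul_self, one_mul]
  · simp only [hv, if_false, Finset.mem_insert, true_or, if_true, sgn_insert_self, ← mul_assoc,
      sgn_mul_self, one_mul, add_zero, Finset.erase_insert hv]

lemma contract_wedge {v w : σ} (hvw : v ≠ w) (c : Chain K σ) :
    contract v (wedge w c) + wedge w (contract v c) = 0 := by
  funext B
  simp only [Pi.add_apply, contract_apply, wedge_apply, Pi.zero_apply]
  by_cases hv : v ∈ B
  · simp [hv, hvw]
  · by_cases hw : w ∈ B
    · obtain ⟨A, hwA, rfl⟩ : ∃ A : Finset σ, w ∉ A ∧ B = insert w A :=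
        ⟨B.erase w, by simp, by rw [Finset.insert_erase hw]⟩
      have hvA : v ∉ A := fun h => hv (by simp [h])
      have e2 : (insert v (insert w A)).erase w = insert v A := by
        rw [Finset.insert_comm, Finset.erase_insert (by simp [hwA, Ne.symm hvw])]
      have e3 : sgn K w (insert v (insert w A)) = sgn K w (insert v A) := by
        rw [Finset.insert_comm, sgn_insert_self]
      rw [e2, e3, Finset.erase_insert hwA, sgn_insert_self]
      simp only [hv, hvA, Finset.mem_insert, true_or, or_true, if_true, if_false]
      linear_combination (c (insert v A) * sgn K w A * sgn K w (insert v A)) *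
        (sgn_swap (K := K) hvw hvA hwA)
        - c (insert v A) * sgn K v (insert w A) * sgn K w (insert v A) * sgn_mul_self (K := K) w A
        - c (insert v A) * sgn K v A * sgn K w A * sgn_mul_self (K := K) w (insert v A)
    · simp [hv, hw, Ne.symm hvw]

variable [Fintype σ]

/-- The Koszul differential, as a linear map over the polynomial ring. -/
def del : Chain K σ →ₗ[MvPolynomial σ K] Chain K σ :=
  ∑ v, (X v : MvPolynomial σ K) • contract v

lemma koszulDifferential_eq_del (c : Chain K σ) :
    koszulDifferential K (MvPolynomial σ K) c = del c := by
  funext B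
  simp only [koszulDifferential, LinearMap.coe_mk, AddHom.coe_mk, del, LinearMap.sum_apply,
    LinearMap.smul_apply, Finset.sum_apply, Pi.smul_apply, contract_apply, smul_eq_mul]
  rw [← Finset.sum_subset (Finset.subset_univ (Finset.univ \ B))]
  · refine Finset.sum_congr rfl fun v hv => ?_
    rw [if_neg (by simpa using hv), sgn]; ring
  · intro v _ hv
    rw [if_pos (by simpa using hv), mul_zero]

lemma del_apply (c : Chain K σ) (B : Finset σ) :
    del c B = ∑ v ∈ Finset.univ \ B, sgn K v B * X v * c (insert v B) := by
  rw [← koszulDifferential_eq_del]; rfl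

/-- Only the summand of `∂` at `v` fails to anticommute with `e_v ∧`. So `e_v ∧` is a homotopy
showing that `x_v` kills Koszul homology. -/
lemma del_wedge (v : σ) (c : Chain K σ) :
    del (wedge v c) = (X v : MvPolynomial σ K) • c - wedge v (del c) := by
  simp only [del, LinearMap.sum_apply, LinearMap.smul_apply, map_sum, map_smul]
  rw [eq_sub_iff_add_eq, ← Finset.sum_add_distrib, Finset.sum_eq_single v]
  · rw [← smul_add, contract_wedge_self]
  · intro w _ hw
    rw [← smul_add, contract_wedge hw, smul_zero]
  · simp

lemma del_del (c : Chain K σ) : del (del c) = 0 := by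
  -- Induction over partial sums of the differential: the new contraction squares to zero and
  -- anticommutes with the old partial sum.
  have key : ∀ s : Finset σ, ∀ c : Chain K σ,
      (∑ v ∈ s, (X v : MvPolynomial σ K) • contract v)
        ((∑ v ∈ s, (X v : MvPolynomial σ K) • contract v) c) = 0 := by
    intro s
    induction s using Finset.induction_on with
    | empty => intro c; simp
    | insert a s ha ih =>
      intro c
      have hc : ∀ c : Chain K σ, (∑ v ∈ s, (X v : MvPolynomial σ K) • contract v) (contract a c)
          = - contract a ((∑ v ∈ s, (X v : MvPolynomial σ K) • contract v) c) := by
        intro c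
        simp only [LinearMap.sum_apply, LinearMap.smul_apply, map_sum, map_smul]
        rw [← Finset.sum_neg_distrib]
        refine Finset.sum_congr rfl fun v _ => ?_
        rw [contract_contract, smul_neg]
      rw [Finset.sum_insert ha]
      simp only [LinearMap.add_apply, LinearMap.smul_apply, map_add, map_smul, ih, hc,
        contract_contract_self, smul_zero, zero_add, add_zero, smul_neg]
      rw [neg_add_cancel]
  exact key _ c

end Operators

/-! ### Homogeneous ideals and colon ideals. -/

section Homogeneous

variable {R : Type*} [CommRing R] {σ : Type*}

lemma homogeneousComponent_mul_of_isHomogeneous {g : MvPolynomial σ R} {k : ℕ}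
    (hg : g.IsHomogeneous k) (n : ℕ) (p : MvPolynomial σ R) :
    homogeneousComponent (n + k) (g * p) = g * homogeneousComponent n p := by
  conv_lhs => rw [← sum_homogeneousComponent p, Finset.mul_sum, map_sum]
  have h : ∀ i, homogeneousComponent (n + k) (g * homogeneousComponent i p)
      = if i = n then g * homogeneousComponent n p else 0 := by
    intro i
    have hi : g * homogeneousComponent i p ∈ homogeneousSubmodule σ R (k + i) :=
      hg.mul (homogeneousComponent_isHomogeneous i p)
    rw [homogeneousComponent_of_mem hi]
    by_cases h : i = n
    · subst h; rw [if_pos (by ring), if_pos rfl]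
    · rw [if_neg (by omega), if_neg h]
  rw [Finset.sum_congr rfl fun i _ => h i, Finset.sum_ite_eq']
  split_ifs with hn
  · rfl
  · rw [homogeneousComponent_eq_zero, mul_zero]
    simpa using hn

lemma homogeneousComponent_mul_of_lt {g : MvPolynomial σ R} {k : ℕ}
    (hg : g.IsHomogeneous k) {n : ℕ} (hn : n < k) (p : MvPolynomial σ R) :
    homogeneousComponent n (g * p) = 0 := by
  conv_lhs => rw [← sum_homogeneousComponent p, Finset.mul_sum, map_sum]
  refine Finset.sum_eq_zero fun i _ => ?_
  have hi : g * homogeneousComponent i p ∈ homogeneousSubmodule σ R (k + i) :=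
    hg.mul (homogeneousComponent_isHomogeneous i p)
  rw [homogeneousComponent_of_mem hi, if_neg (by omega)]

lemma homogeneousComponent_eq_self {n : ℕ} {p : MvPolynomial σ R} (hp : p.IsHomogeneous n) :
    homogeneousComponent n p = p := by
  rw [homogeneousComponent_of_mem (m := n) hp, if_pos rfl]

/-- An ideal containing all the homogeneous components of its elements. -/
def IsHomog (A : Ideal (MvPolynomial σ R)) : Prop :=
  ∀ p ∈ A, ∀ n, homogeneousComponent n p ∈ A

lemma isHomog_top : IsHomog (⊤ : Ideal (MvPolynomial σ R)) := fun _ _ _ => trivial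

lemma isHomog_bot : IsHomog (⊥ : Ideal (MvPolynomial σ R)) := by
  intro p hp n
  rw [Ideal.mem_bot] at hp
  rw [hp, map_zero]; exact zero_mem _

lemma IsHomog.sup {A B : Ideal (MvPolynomial σ R)} (hA : IsHomog A) (hB : IsHomog B) :
    IsHomog (A ⊔ B) := by
  intro p hp n
  obtain ⟨a, ha, b, hb, rfl⟩ := Submodule.mem_sup.1 hp
  rw [map_add]
  exact Submodule.add_mem_sup (hA a ha n) (hB b hb n)

lemma isHomog_span {s : Set (MvPolynomial σ R)} (hs : ∀ g ∈ s, ∃ k, g.IsHomogeneous k) :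
    IsHomog (Ideal.span s) := by
  intro p hp n
  induction hp using Submodule.span_induction generalizing n with
  | mem x hx =>
    obtain ⟨k, hk⟩ := hs x hx
    rw [homogeneousComponent_of_mem (m := n) (n := k) hk]
    split_ifs
    · exact Ideal.subset_span hx
    · exact zero_mem _
  | zero => rw [map_zero]; exact zero_mem _
  | add x y _ _ hx hy => rw [map_add]; exact add_mem (hx n) (hy n)
  | smul a x _ hx =>
    rw [smul_eq_mul, ← sum_homogeneousComponent a, Finset.sum_mul, map_sum]
    refine sum_mem fun i _ => ?_
    by_cases hi : i ≤ n
    · obtain ⟨j, rfl⟩ := Nat.exists_eq_add_of_le' hi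
      rw [homogeneousComponent_mul_of_isHomogeneous (homogeneousComponent_isHomogeneous i a)]
      exact Ideal.mul_mem_left _ _ (hx _)
    · rw [homogeneousComponent_mul_of_lt (homogeneousComponent_isHomogeneous i a) (by omega)]
      exact zero_mem _

lemma IsHomog.eq_span {A : Ideal (MvPolynomial σ R)} (hA : IsHomog A) :
    A = Ideal.span {p | p ∈ A ∧ ∃ k, p.IsHomogeneous k} := by
  refine le_antisymm (fun p hp => ?_) (Ideal.span_le.2 fun p hp => hp.1)
  rw [← sum_homogeneousComponent p]
  exact sum_mem fun i _ => Ideal.subset_span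
    ⟨hA p hp i, i, homogeneousComponent_isHomogeneous i p⟩

lemma IsHomog.mul {A B : Ideal (MvPolynomial σ R)} (hA : IsHomog A) (hB : IsHomog B) :
    IsHomog (A * B) := by
  rw [hA.eq_span, hB.eq_span, Ideal.span_mul_span']
  refine isHomog_span ?_
  rintro _ ⟨p, ⟨-, k, hp⟩, q, ⟨-, l, hq⟩, rfl⟩
  exact ⟨k + l, hp.mul hq⟩

lemma IsHomog.pow {A : Ideal (MvPolynomial σ R)} (hA : IsHomog A) (k : ℕ) : IsHomog (A ^ k) := by
  induction k with
  | zero => rw [pow_zero, Ideal.one_eq_top]; exact isHomog_top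
  | succ k ih => rw [pow_succ]; exact ih.mul hA

/-- The colon ideal `C : g`. -/
def quotBy {R : Type*} [CommRing R] (C : Ideal R) (g : R) : Ideal R :=
  Submodule.comap (LinearMap.mulLeft R g) C

lemma mem_quotBy {R : Type*} [CommRing R] {C : Ideal R} {g u : R} :
    u ∈ quotBy C g ↔ g * u ∈ C := Iff.rfl

lemma le_quotBy {R : Type*} [CommRing R] (C : Ideal R) (g : R) : C ≤ quotBy C g :=
  fun _ h => Ideal.mul_mem_left _ _ h

lemma quotBy_eq_self {R : Type*} [CommRing R] {C : Ideal R} {g : R}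
    (h : ∀ u, g * u ∈ C → u ∈ C) : quotBy C g = C :=
  le_antisymm (fun u hu => h u hu) (le_quotBy C g)

lemma IsHomog.quotBy {C : Ideal (MvPolynomial σ R)} (hC : IsHomog C) {g : MvPolynomial σ R}
    {k : ℕ} (hg : g.IsHomogeneous k) : IsHomog (quotBy C g) := by
  intro p hp n
  rw [mem_quotBy, ← homogeneousComponent_mul_of_isHomogeneous hg]
  exact hC _ hp _

end Homogeneous

/-! ### Regularity of subquotients `A ⧸ B` via Koszul homology. -/

section Regularity

variable {K : Type*} [Field K] {σ : Type*}

/-- The chains with coefficients in the ideal `A`. -/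
def chainsIn (A : Ideal (MvPolynomial σ K)) : Submodule (MvPolynomial σ K) (Chain K σ) :=
  Submodule.pi Set.univ fun _ => A

lemma mem_chainsIn {A : Ideal (MvPolynomial σ K)} {c : Chain K σ} :
    c ∈ chainsIn A ↔ ∀ T, c T ∈ A := by simp [chainsIn]

lemma chainsIn_mono {A B : Ideal (MvPolynomial σ K)} (h : A ≤ B) : chainsIn A ≤ chainsIn B :=
  fun _ hc => mem_chainsIn.2 fun T => h (mem_chainsIn.1 hc T)

lemma mem_chainsIn_top (c : Chain K σ) : c ∈ chainsIn (⊤ : Ideal (MvPolynomial σ K)) :=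
  mem_chainsIn.2 fun _ => trivial

lemma mem_chainsIn_bot {c : Chain K σ} : c ∈ chainsIn (⊥ : Ideal (MvPolynomial σ K)) ↔ c = 0 := by
  simp [mem_chainsIn, funext_iff]

lemma smul_mem_chainsIn_mul {A B : Ideal (MvPolynomial σ K)} {q : MvPolynomial σ K}
    {c : Chain K σ} (hq : q ∈ A) (hc : c ∈ chainsIn B) : q • c ∈ chainsIn (A * B) :=
  mem_chainsIn.2 fun T => Ideal.mul_mem_mul hq (mem_chainsIn.1 hc T)

lemma smul_mem_chainsIn {A : Ideal (MvPolynomial σ K)} {q : MvPolynomial σ K}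
    (c : Chain K σ) (hq : q ∈ A) : q • c ∈ chainsIn A :=
  mem_chainsIn.2 fun _ => Ideal.mul_mem_right _ _ hq

lemma exists_of_mem_chainsIn_sup {A B : Ideal (MvPolynomial σ K)} {c : Chain K σ}
    (hc : c ∈ chainsIn (A ⊔ B)) : ∃ a ∈ chainsIn A, ∃ b ∈ chainsIn B, c = a + b := by
  choose a ha b hb h using fun T => Submodule.mem_sup.1 (mem_chainsIn.1 hc T)
  exact ⟨a, mem_chainsIn.2 ha, b, mem_chainsIn.2 hb, funext fun T => (h T).symm⟩

lemma exists_of_mem_chainsIn_span_mul {A : Ideal (MvPolynomial σ K)} {g : MvPolynomial σ K}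
    {c : Chain K σ} (hc : c ∈ chainsIn (Ideal.span {g} * A)) : ∃ a ∈ chainsIn A, c = g • a := by
  choose a ha h using fun T => Ideal.mem_span_singleton_mul.1 (mem_chainsIn.1 hc T)
  exact ⟨a, mem_chainsIn.2 ha, funext fun T => (h T).symm⟩

lemma exists_of_mem_chainsIn_span {g : MvPolynomial σ K}
    {c : Chain K σ} (hc : c ∈ chainsIn (Ideal.span {g})) : ∃ a, c = g • a := by
  rw [← Ideal.mul_top (Ideal.span {g})] at hc
  obtain ⟨a, -, h⟩ := exists_of_mem_chainsIn_span_mul hc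
  exact ⟨a, h⟩

/-- The chains all of whose coefficients are homogeneous of degree `δ`. -/
def IsHomogChain (δ : ℕ) (c : Chain K σ) : Prop := ∀ T, (c T).IsHomogeneous δ

lemma IsHomogChain.sub {δ : ℕ} {c d : Chain K σ} (hc : IsHomogChain δ c) (hd : IsHomogChain δ d) :
    IsHomogChain δ (c - d) := fun T => (hc T).sub (hd T)

lemma IsHomogChain.add {δ : ℕ} {c d : Chain K σ} (hc : IsHomogChain δ c) (hd : IsHomogChain δ d) :
    IsHomogChain δ (c + d) := fun T => (hc T).add (hd T)

lemma IsHomogChain.smul {δ k : ℕ} {g : MvPolynomial σ K} {c : Chain K σ} (hg : g.IsHomogeneous k)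
    (hc : IsHomogChain δ c) : IsHomogChain (δ + k) (g • c) := fun T => by
  rw [add_comm]; exact hg.mul (hc T)

/-- The component of coefficient degree `δ`. -/
def comp (δ : ℕ) (c : Chain K σ) : Chain K σ := fun T => homogeneousComponent δ (c T)

lemma isHomogChain_comp (δ : ℕ) (c : Chain K σ) : IsHomogChain δ (comp δ c) :=
  fun _ => homogeneousComponent_isHomogeneous _ _

lemma comp_add (δ : ℕ) (c d : Chain K σ) : comp δ (c + d) = comp δ c + comp δ d :=
  funext fun _ => map_add _ _ _

lemma comp_sub (δ : ℕ) (c d : Chain K σ) : comp δ (c - d) = comp δ c - comp δ d :=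
  funext fun _ => map_sub _ _ _

lemma comp_smul (δ : ℕ) {k : ℕ} {g : MvPolynomial σ K} (hg : g.IsHomogeneous k) (c : Chain K σ) :
    comp (δ + k) (g • c) = g • comp δ c :=
  funext fun _ => homogeneousComponent_mul_of_isHomogeneous hg _ _

lemma IsHomogChain.comp_eq {δ : ℕ} {c : Chain K σ} (hc : IsHomogChain δ c) : comp δ c = c :=
  funext fun T => homogeneousComponent_eq_self (hc T)

lemma comp_mem_chainsIn {A : Ideal (MvPolynomial σ K)} (hA : IsHomog A) {c : Chain K σ}
    (hc : c ∈ chainsIn A) (δ : ℕ) : comp δ c ∈ chainsIn A :=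
  mem_chainsIn.2 fun T => hA _ (mem_chainsIn.1 hc T) _

variable [LinearOrder σ]

lemma wedge_mem_chainsIn {A : Ideal (MvPolynomial σ K)} {c : Chain K σ} (hc : c ∈ chainsIn A)
    (v : σ) : wedge v c ∈ chainsIn A := by
  rw [mem_chainsIn] at *
  intro T
  rw [wedge_apply]
  split_ifs
  · exact Ideal.mul_mem_left _ _ (hc _)
  · exact zero_mem _

variable [Fintype σ]

lemma del_mem_chainsIn {A : Ideal (MvPolynomial σ K)} {c : Chain K σ} (hc : c ∈ chainsIn A) :
    del c ∈ chainsIn A := by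
  rw [mem_chainsIn] at *
  intro T
  rw [del_apply]
  exact sum_mem fun v _ => Ideal.mul_mem_left _ _ (hc _)

lemma isHomogeneous_sgn (v : σ) (T : Finset σ) : (sgn K v T).IsHomogeneous 0 := by
  rw [sgn]
  have : ((-1 : MvPolynomial σ K)).IsHomogeneous 0 := by
    rw [show (-1 : MvPolynomial σ K) = C (-1) by simp]
    exact isHomogeneous_C _ _
  simpa using this.pow _

lemma comp_succ_del (δ : ℕ) (c : Chain K σ) : comp (δ + 1) (del c) = del (comp δ c) := by
  funext T
  rw [comp, del_apply, del_apply, map_sum]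
  refine Finset.sum_congr rfl fun v _ => ?_
  have h : (sgn K v T * X v).IsHomogeneous 1 := by
    simpa using (isHomogeneous_sgn v T).mul (isHomogeneous_X K v)
  exact homogeneousComponent_mul_of_isHomogeneous h _ _

lemma comp_zero_del (c : Chain K σ) : comp 0 (del c) = 0 := by
  funext T
  rw [comp, del_apply, map_sum]
  refine Finset.sum_eq_zero fun v _ => ?_
  have h : (sgn K v T * X v).IsHomogeneous 1 := by
    simpa using (isHomogeneous_sgn v T).mul (isHomogeneous_X K v)
  exact homogeneousComponent_mul_of_lt h one_pos _

lemma IsHomogChain.del {δ : ℕ} {c : Chain K σ} (hc : IsHomogChain δ c) :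
    IsHomogChain (δ + 1) (del c) := by
  rw [← hc.comp_eq, ← comp_succ_del]
  exact isHomogChain_comp _ _

/-- `A ⧸ B` has regularity less than `m`: the Koszul homology of `A ⧸ B` vanishes in all
coefficient degrees `≥ m`. -/
def RegLT (A B : Ideal (MvPolynomial σ K)) (m : ℕ) : Prop :=
  ∀ δ, m ≤ δ → ∀ c ∈ chainsIn A, IsHomogChain δ c → del c ∈ chainsIn B →
    ∃ d ∈ chainsIn A, c - del d ∈ chainsIn B

variable {A B M : Ideal (MvPolynomial σ K)} {m : ℕ}

lemma RegLT.mono (h : RegLT A B m) {m' : ℕ} (hm : m ≤ m') : RegLT A B m' :=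
  fun δ hδ => h δ (hm.trans hδ)

lemma regLT_self (A : Ideal (MvPolynomial σ K)) (m : ℕ) : RegLT A A m :=
  fun _ _ c hc _ _ => ⟨0, zero_mem _, by simpa using hc⟩

/-- Only the component of `d` that `∂` sends into degree `δ` matters. For `δ = 0` it is `0`, because
`∂` raises the coefficient degree by one. -/
lemma exists_homog (hA : IsHomog A) (hB : IsHomog B) {δ : ℕ} {c d : Chain K σ}
    (hc : IsHomogChain δ c) (hd : d ∈ chainsIn A) (h : c - del d ∈ chainsIn B) :
    ∃ d' ∈ chainsIn A, c - del d' ∈ chainsIn B ∧ IsHomogChain δ (del d') ∧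
      ∀ e, δ = e + 1 → IsHomogChain e d' := by
  have h' := comp_mem_chainsIn hB h δ
  rw [comp_sub, hc.comp_eq] at h'
  rcases δ with _ | e
  · refine ⟨0, zero_mem _, ?_, ?_, fun e he => by omega⟩
    · rw [comp_zero_del] at h'; simpa using h'
    · intro T; rw [map_zero]; exact isHomogeneous_zero _ _ _
  · refine ⟨comp e d, comp_mem_chainsIn hA hd e, ?_, (isHomogChain_comp e d).del, ?_⟩
    · rwa [comp_succ_del] at h'
    · intro e' he'
      obtain rfl : e = e' := by omega
      exact isHomogChain_comp e d

/-- Middle term of `0 → M ⧸ B → A ⧸ B → A ⧸ M → 0`. -/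
lemma RegLT.ext (h₁ : RegLT A M m) (h₂ : RegLT M B m) (hA : IsHomog A) (hM : IsHomog M)
    (hBM : B ≤ M) (hMA : M ≤ A) : RegLT A B m := by
  intro δ hδ c hc hcδ hdc
  obtain ⟨d, hd, h⟩ := h₁ δ hδ c hc hcδ (chainsIn_mono hBM hdc)
  obtain ⟨d, hd, h, hdδ, -⟩ := exists_homog hA hM hcδ hd h
  obtain ⟨e, he, h'⟩ := h₂ δ hδ _ h (hcδ.sub hdδ) (by rw [map_sub, del_del, sub_zero]; exact hdc)
  refine ⟨d + e, add_mem hd (chainsIn_mono hMA he), ?_⟩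
  rwa [map_add, ← sub_sub]

/-- A cycle of `M ⧸ B` bounds some `d` in `A ⧸ B`. This `d` has degree one less and is a cycle of `A
⧸ M`, so it can be corrected into `M`; hence `m + 1` and `m` in the hypotheses. -/
lemma RegLT.sub (h₁ : RegLT A B (m + 1)) (h₂ : RegLT A M m) (hA : IsHomog A) (hB : IsHomog B)
    (hBM : B ≤ M) (hMA : M ≤ A) : RegLT M B (m + 1) := by
  intro δ hδ c hc hcδ hdc
  obtain ⟨d, hd, h⟩ := h₁ δ hδ c (chainsIn_mono hMA hc) hcδ hdc
  obtain ⟨d, hd, h, -, hdδ⟩ := exists_homog hA hB hcδ hd h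
  obtain ⟨δ', rfl⟩ : ∃ δ', δ = δ' + 1 := ⟨δ - 1, by omega⟩
  obtain ⟨e, -, h'⟩ := h₂ δ' (by omega) d hd (hdδ δ' rfl) (by
    have := sub_mem hc (chainsIn_mono hBM h)
    rwa [sub_sub_cancel] at this)
  refine ⟨d - del e, h', ?_⟩
  rwa [map_sub, del_del, sub_zero]

/-- The connecting map sends a cycle `c` of `A ⧸ M` to `∂c` in `M ⧸ B`, one degree higher, so `M ⧸
B` has to be controlled only from `m + 1` on. -/
lemma RegLT.quot (h₁ : RegLT A B m) (h₂ : RegLT M B (m + 1)) (hM : IsHomog M)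
    (hB : IsHomog B) (hBM : B ≤ M) (hMA : M ≤ A) : RegLT A M m := by
  intro δ hδ c hc hcδ hdc
  obtain ⟨e, he, h⟩ := h₂ (δ + 1) (by omega) (del c) hdc hcδ.del (by rw [del_del]; exact zero_mem _)
  obtain ⟨e, he, h, -, heδ⟩ := exists_homog hM hB hcδ.del he h
  obtain ⟨d, hd, h'⟩ := h₁ δ hδ (c - e) (sub_mem hc (chainsIn_mono hMA he))
    (hcδ.sub (heδ δ rfl)) (by rwa [map_sub])
  refine ⟨d, hd, ?_⟩
  have := add_mem (chainsIn_mono hBM h') he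
  rwa [sub_right_comm, sub_add_cancel] at this

/-- Multiplication by `g` identifies `S ⧸ (C : g)`, shifted by `deg g`, with `(C + (g)) ⧸ C`. The
converse is `RegLT.unshift`. -/
lemma RegLT.shift {C : Ideal (MvPolynomial σ K)} {g : MvPolynomial σ K} {k : ℕ}
    (hg : g.IsHomogeneous k) (hC : IsHomog C) (h : RegLT ⊤ (quotBy C g) m) :
    RegLT (C ⊔ Ideal.span {g}) C (m + k) := by
  intro δ hδ c hc hcδ hdc
  obtain ⟨a, ha, b, hb, rfl⟩ := exists_of_mem_chainsIn_sup hc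
  obtain ⟨e, rfl⟩ := exists_of_mem_chainsIn_span hb
  obtain ⟨δ', rfl⟩ : ∃ δ', δ = δ' + k := ⟨δ - k, by omega⟩
  have hc' : comp (δ' + k) a + g • comp δ' e = a + g • e := by
    rw [← comp_smul _ hg, ← comp_add, hcδ.comp_eq]
  rw [← hc'] at hdc ⊢
  have ha' := comp_mem_chainsIn hC ha (δ' + k)
  obtain ⟨d, -, h'⟩ := h δ' (by omega) (comp δ' e) (mem_chainsIn_top _) (isHomogChain_comp _ _) (by
    rw [map_add, map_smul] at hdc
    have := sub_mem hdc (del_mem_chainsIn ha')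
    rw [add_sub_cancel_left] at this
    exact mem_chainsIn.2 fun T => mem_chainsIn.1 this T)
  refine ⟨g • d, smul_mem_chainsIn _ (Ideal.mem_sup_right (Ideal.mem_span_singleton_self g)), ?_⟩
  rw [map_smul, add_sub_assoc, ← smul_sub]
  exact add_mem ha' (mem_chainsIn.2 fun T => mem_chainsIn.1 h' T)

/-- A regular element of degree `k + 1` embeds a copy of `S ⧸ B` shifted by `k + 1`; passing to the
quotient gains back one degree. -/
lemma RegLT.sup_span_singleton {h : MvPolynomial σ K} {k : ℕ} (hh : h.IsHomogeneous (k + 1))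
    (hB : IsHomog B) (hreg : ∀ u, h * u ∈ B → u ∈ B) (hm : RegLT ⊤ B m) :
    RegLT ⊤ (B ⊔ Ideal.span {h}) (m + k) := by
  refine RegLT.quot (B := B) (hm.mono (by omega)) ?_
    (hB.sup (isHomog_span (by simpa using ⟨_, hh⟩))) hB le_sup_left le_top
  exact RegLT.shift (k := k + 1) hh hB (by rwa [quotBy_eq_self hreg])

/-- Vanishing modulo `x_v` gives `c - ∂d = b + x_v e`. Regularity of `x_v` makes `e` a cycle modulo
`B`, and then `x_v e` is `∂(e_v ∧ e)` up to `B`, by `del_wedge`. -/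
lemma RegLT.of_sup_span_X (v : σ) (hreg : ∀ u, X v * u ∈ B → u ∈ B)
    (hm : RegLT ⊤ (B ⊔ Ideal.span {X v}) m) : RegLT ⊤ B m := by
  intro δ hδ c hc hcδ hdc
  obtain ⟨d, -, h⟩ := hm δ hδ c hc hcδ (chainsIn_mono le_sup_left hdc)
  obtain ⟨b, hb, x, hx, h⟩ := exists_of_mem_chainsIn_sup h
  obtain ⟨e, rfl⟩ := exists_of_mem_chainsIn_span hx
  have he : del e ∈ chainsIn B := by
    have h1 := congrArg del h
    rw [map_sub, del_del, sub_zero, map_add, map_smul] at h1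
    rw [h1] at hdc
    have := sub_mem hdc (del_mem_chainsIn hb)
    rw [add_sub_cancel_left] at this
    exact mem_chainsIn.2 fun T => hreg _ (mem_chainsIn.1 this T)
  refine ⟨d + wedge v e, mem_chainsIn_top _, ?_⟩
  rw [map_add, ← sub_sub, h, del_wedge, ← sub_add, add_sub_cancel_right]
  exact add_mem hb (wedge_mem_chainsIn he v)

lemma mem_span_X_image_of_X_mul_mem {s : Set σ} {v : σ} (hv : v ∉ s) {u : MvPolynomial σ K}
    (hu : X v * u ∈ Ideal.span (X '' s : Set (MvPolynomial σ K))) :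
    u ∈ Ideal.span (X '' s : Set (MvPolynomial σ K)) := by
  rw [mem_ideal_span_X_image] at *
  intro m hm
  obtain ⟨i, hi, h⟩ := hu (Finsupp.single v 1 + m) (by
    rw [mem_support_iff, coeff_X_mul]; exact mem_support_iff.1 hm)
  refine ⟨i, hi, ?_⟩
  have : v ≠ i := fun h => hv (h ▸ hi)
  simpa [Finsupp.single_apply, this] using h

/-- The polynomial ring has regularity zero. -/
lemma regLT_top_bot : RegLT (⊤ : Ideal (MvPolynomial σ K)) ⊥ 1 := by
  -- The variables outside `t` are set to zero. For `t = ∅` only the field is left, concentrated in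
  -- degree `0`; for `t = univ` nothing has been killed.
  have key : ∀ t : Finset σ,
      RegLT ⊤ (Ideal.span (X '' ((tᶜ : Finset σ) : Set σ) : Set (MvPolynomial σ K))) 1 := by
    intro t
    induction t using Finset.induction_on with
    | empty =>
      intro δ hδ c _ hcδ _
      refine ⟨0, zero_mem _, ?_⟩
      rw [map_zero, sub_zero, mem_chainsIn]
      intro T
      rw [mem_ideal_span_X_image]
      intro m hm
      have := hcδ T (mem_support_iff.1 hm)
      by_contra hcon
      push Not at hcon
      have hm0 : m = 0 := by ext i; exact hcon i (by simp)
      rw [hm0] at this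
      simp at this
      omega
    | insert a t ha ih =>
      refine RegLT.of_sup_span_X a (fun u hu => ?_) ?_
      · exact mem_span_X_image_of_X_mul_mem (by simp) hu
      · convert ih using 1
        rw [← Ideal.span_union, ← Set.image_singleton, ← Set.image_union]
        congr 2
        ext i
        by_cases hi : i = a
        · simp [hi, ha]
        · simp [hi]
  simpa using key Finset.univ

/-- The chain `e_∅`. -/
def unit : Chain K σ := Pi.single ∅ 1

lemma del_unit : del (unit : Chain K σ) = 0 := by
  funext T
  rw [del_apply]
  refine Finset.sum_eq_zero fun v _ => ?_
  rw [unit, Pi.single_eq_of_ne (Finset.insert_ne_empty v T), mul_zero]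

/-- With constant coefficients, the coefficient of `x_v` in the `B`-component of `∂c` is `±` the
component of `c` at `B ∪ {v}`, so a cycle has only its `e_∅` part. -/
lemma exists_eq_smul_unit {c : Chain K σ} (hc : IsHomogChain 0 c) (hdc : del c = 0) :
    ∃ β : MvPolynomial σ K, c = β • unit := by
  refine ⟨c ∅, ?_⟩
  funext T
  rcases T.eq_empty_or_nonempty with rfl | ⟨v, hv⟩
  · simp [unit]
  · obtain ⟨B, hvB, rfl⟩ : ∃ B : Finset σ, v ∉ B ∧ T = insert v B :=
      ⟨T.erase v, by simp, by rw [Finset.insert_erase hv]⟩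
    rw [Pi.smul_apply, unit, Pi.single_eq_of_ne (Finset.insert_ne_empty v B), smul_zero]
    have h0 := congrFun hdc B
    rw [del_apply, Pi.zero_apply] at h0
    have hC : ∀ T, c T = C (coeff 0 (c T)) := fun T => by
      rw [← homogeneousComponent_zero]; exact (homogeneousComponent_eq_self (hc T)).symm
    have h1 := congrArg (coeff (Finsupp.single v 1)) h0
    rw [coeff_sum, Finset.sum_eq_single v, coeff_zero] at h1
    · have hs : sgn K v B * X v * c (insert v B) = X v * (sgn K v B * c (insert v B)) := by ring
      rw [hs, ← add_zero (Finsupp.single v 1), coeff_X_mul] at h1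
      have h2 : sgn K v B * c (insert v B) = 0 := by
        have hh : (sgn K v B * c (insert v B)).IsHomogeneous 0 := by
          simpa using (isHomogeneous_sgn v B).mul (hc _)
        rw [← homogeneousComponent_eq_self hh, homogeneousComponent_zero, h1, C_0]
      calc c (insert v B) = sgn K v B * sgn K v B * c (insert v B) := by
            rw [sgn_mul_self, one_mul]
        _ = 0 := by rw [mul_assoc, h2, mul_zero]
    · intro w _ hw
      have hs : sgn K w B * X w * c (insert w B) = X w * (sgn K w B * c (insert w B)) := by ring
      rw [hs, coeff_X_mul', if_neg (by simp [hw])]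
    · intro h; simp [hvB] at h

end Regularity

/-! ### Initial ideals with pairwise coprime leading monomials. -/

section Groebner

open scoped MonomialOrder

variable {K : Type*} [Field K] {σ : Type*} {m : MonomialOrder σ}

/-- The monomials in `L` are leading monomials of elements of `I`, and they generate the
initial ideal of `I`. -/
structure IsInitial (m : MonomialOrder σ) (I : Ideal (MvPolynomial σ K)) (L : Set (σ →₀ ℕ)) :
    Prop where
  exists_mem : ∀ μ ∈ L, ∃ h ∈ I, h ≠ 0 ∧ m.degree h = μ
  exists_le : ∀ u ∈ I, u ≠ 0 → ∃ μ ∈ L, μ ≤ m.degree u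

lemma isInitial_bot : IsInitial m (⊥ : Ideal (MvPolynomial σ K)) ∅ :=
  ⟨fun _ h => h.elim, fun _ h h0 => (h0 h).elim⟩

lemma le_of_le_add_of_disjoint {μ ν τ : σ →₀ ℕ} (hd : Disjoint μ.support ν.support)
    (h : μ ≤ ν + τ) : μ ≤ τ := by
  intro i
  by_cases hi : i ∈ μ.support
  · have : ν i = 0 := by
      simpa using Finset.disjoint_left.1 hd hi
    simpa [this] using h i
  · rw [Finsupp.notMem_support_iff.1 hi]; exact Nat.zero_le _

variable {I : Ideal (MvPolynomial σ K)} {L : Set (σ →₀ ℕ)}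

/-- Division by all nonzero elements of `I` at once: no Gröbner basis has to be chosen. -/
lemma IsInitial.exists_reduced (hI : IsInitial m I L) (t : MvPolynomial σ K) :
    ∃ r, t - r ∈ I ∧ (r ≠ 0 → ∀ μ ∈ L, ¬ μ ≤ m.degree r) := by
  obtain ⟨g, r, h1, -, h3⟩ := m.div_set (B := {h | h ∈ I ∧ h ≠ 0})
    (fun b hb => (m.leadingCoeff_ne_zero_iff.2 hb.2).isUnit) t
  refine ⟨r, ?_, fun hr μ hμ hle => ?_⟩
  · rw [h1, add_sub_cancel_right, Finsupp.linearCombination_apply]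
    exact sum_mem fun b _ => Ideal.mul_mem_left _ _ b.2.1
  · obtain ⟨h, hh, h0, rfl⟩ := hI.exists_mem μ hμ
    exact h3 _ (m.degree_mem_support hr) h ⟨hh, h0⟩ hle

/-- Let `r` be a reduced remainder of `u`. A lead dividing `in(h) in(r)` is coprime to `in(h)`, so
it divides `in(r)`, which is excluded unless `r = 0`. -/
lemma IsInitial.mem_of_mul_mem (hI : IsInitial m I L) {h : MvPolynomial σ K} (h0 : h ≠ 0)
    (hd : ∀ μ ∈ L, Disjoint μ.support (m.degree h).support) (u : MvPolynomial σ K)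
    (hu : h * u ∈ I) : u ∈ I := by
  obtain ⟨r, hr, hr'⟩ := hI.exists_reduced u
  by_cases hr0 : r = 0
  · simpa [hr0] using hr
  exfalso
  have hhr : h * r ∈ I := by
    have := sub_mem hu (Ideal.mul_mem_left I h hr)
    rwa [← mul_sub, sub_sub_cancel] at this
  obtain ⟨μ, hμ, hle⟩ := hI.exists_le _ hhr (mul_ne_zero h0 hr0)
  rw [m.degree_mul h0 hr0] at hle
  exact hr' hr0 μ hμ (le_of_le_add_of_disjoint (hd μ hμ) hle)

/-- Buchberger's coprimality criterion without S-polynomials: once the multiplier of `h` is reduced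
modulo `I`, the leading terms of the two summands cannot cancel. -/
lemma IsInitial.sup_span_singleton (hI : IsInitial m I L) {h : MvPolynomial σ K} (h0 : h ≠ 0)
    (hd : ∀ μ ∈ L, Disjoint μ.support (m.degree h).support) :
    IsInitial m (I ⊔ Ideal.span {h}) (insert (m.degree h) L) := by
  constructor
  · rintro μ (rfl | hμ)
    · exact ⟨h, Ideal.mem_sup_right (Ideal.mem_span_singleton_self h), h0, rfl⟩
    · obtain ⟨g, hg, hg'⟩ := hI.exists_mem μ hμ
      exact ⟨g, Ideal.mem_sup_left hg, hg'⟩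
  · intro u hu hu0
    obtain ⟨w, hw, x, hx, rfl⟩ := Submodule.mem_sup.1 hu
    obtain ⟨t, rfl⟩ := Ideal.mem_span_singleton'.1 hx
    obtain ⟨r, hr, hr'⟩ := hI.exists_reduced t
    obtain ⟨w', hw', he⟩ : ∃ w' ∈ I, w + t * h = w' + r * h :=
      ⟨w + (t - r) * h, add_mem hw (Ideal.mul_mem_right _ _ hr), by ring⟩
    rw [he] at hu0 ⊢
    by_cases hr0 : r = 0
    · rw [hr0, zero_mul, add_zero] at hu0 ⊢
      obtain ⟨μ, hμ, h⟩ := hI.exists_le _ hw' hu0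
      exact ⟨μ, Or.inr hμ, h⟩
    by_cases hw0 : w' = 0
    · refine ⟨_, Or.inl rfl, ?_⟩
      rw [hw0, zero_add, m.degree_mul hr0 h0]
      exact le_add_self
    obtain ⟨μ, hμ, hle⟩ := hI.exists_le _ hw' hw0
    have hne : m.degree w' ≠ m.degree (r * h) := by
      intro heq
      rw [heq, m.degree_mul hr0 h0, add_comm] at hle
      exact hr' hr0 μ hμ (le_of_le_add_of_disjoint (hd μ hμ) hle)
    rcases lt_or_gt_of_ne (fun h => hne (m.toSyn.injective h)) with hlt | hlt
    · refine ⟨_, Or.inl rfl, ?_⟩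
      rw [m.degree_add_eq_right_of_lt hlt, m.degree_mul hr0 h0]
      exact le_add_self
    · refine ⟨μ, Or.inr hμ, ?_⟩
      rwa [m.degree_add_of_lt hlt]

/-- Squarefree leads force a radical ideal: a squarefree monomial dividing `in(r)²` divides `in(r)`.
-/
lemma IsInitial.mem_of_sq_mem (hI : IsInitial m I L) (hL : ∀ μ ∈ L, ∀ i, μ i ≤ 1)
    (u : MvPolynomial σ K) (hu : u * u ∈ I) : u ∈ I := by
  obtain ⟨r, hr, hr'⟩ := hI.exists_reduced u
  by_cases hr0 : r = 0
  · simpa [hr0] using hr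
  exfalso
  have hhr : r * r ∈ I := by
    have := sub_mem hu (Ideal.mul_mem_right (u + r) I hr)
    convert this using 1; ring
  obtain ⟨μ, hμ, hle⟩ := hI.exists_le _ hhr (mul_ne_zero hr0 hr0)
  rw [m.degree_mul hr0 hr0] at hle
  refine hr' hr0 μ hμ fun i => ?_
  have h1 := hle i
  have h2 := hL μ hμ i
  simp only [Finsupp.coe_add, Pi.add_apply] at h1
  omega

end Groebner

/-! ### Ideals generated by the binomials of sets of path edges. -/

/-- Variables `x_i, y_i` attached to the vertices `i < n` of a path. -/
structure PathVars (σ : Type u) (n : ℕ) where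
  x : ℕ → σ
  y : ℕ → σ
  x_inj : ∀ i < n, ∀ j < n, x i = x j → i = j
  y_inj : ∀ i < n, ∀ j < n, y i = y j → i = j
  x_ne_y : ∀ i < n, ∀ j < n, x i ≠ y j

namespace PathVars

variable {σ : Type u} {n : ℕ} (P : PathVars σ n) (K : Type*) [Field K]

/-- The binomial `x_i y_j - x_j y_i`. -/
def minor (i j : ℕ) : MvPolynomial σ K :=
  X (P.x i) * X (P.y j) - X (P.x j) * X (P.y i)

/-- The ideal generated by the binomials of the path edges `{e, e + 1}`, `e ∈ E`. -/
def edgeIdeal (E : Finset ℕ) : Ideal (MvPolynomial σ K) :=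
  Ideal.span ((fun e => P.minor K e (e + 1)) '' E)

variable {K}

lemma isHomogeneous_minor (i j : ℕ) : (P.minor K i j).IsHomogeneous 2 :=
  ((isHomogeneous_X K _).mul (isHomogeneous_X K _)).sub
    ((isHomogeneous_X K _).mul (isHomogeneous_X K _))

lemma isHomog_edgeIdeal (E : Finset ℕ) : IsHomog (P.edgeIdeal K E) := by
  refine isHomog_span ?_
  rintro _ ⟨e, -, rfl⟩
  exact ⟨2, P.isHomogeneous_minor e (e + 1)⟩

lemma minor_mem {E : Finset ℕ} {e : ℕ} (he : e ∈ E) : P.minor K e (e + 1) ∈ P.edgeIdeal K E :=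
  Ideal.subset_span ⟨e, he, rfl⟩

lemma edgeIdeal_mono {E F : Finset ℕ} (h : E ⊆ F) : P.edgeIdeal K E ≤ P.edgeIdeal K F :=
  Ideal.span_mono (Set.image_mono (by exact_mod_cast h))

lemma edgeIdeal_le_iff {E : Finset ℕ} {A : Ideal (MvPolynomial σ K)} :
    P.edgeIdeal K E ≤ A ↔ ∀ e ∈ E, P.minor K e (e + 1) ∈ A := by
  rw [edgeIdeal, Ideal.span_le, Set.image_subset_iff]; rfl

lemma edgeIdeal_empty : P.edgeIdeal K ∅ = ⊥ := by simp [edgeIdeal]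

lemma edgeIdeal_insert (e : ℕ) (E : Finset ℕ) :
    P.edgeIdeal K (insert e E) = P.edgeIdeal K E ⊔ Ideal.span {P.minor K e (e + 1)} := by
  rw [edgeIdeal, edgeIdeal, ← Ideal.span_union, Finset.coe_insert, Set.image_insert_eq,
    Set.union_singleton]

open Classical in
/-- The rank function `x_i ↦ i` that is `n` on the other variables. -/
def rank (v : σ) : ℕ := if h : ∃ i < n, P.x i = v then h.choose else n

lemma rank_x {i : ℕ} (hi : i < n) : P.rank (P.x i) = i := by
  have h : ∃ j < n, P.x j = P.x i := ⟨i, hi, rfl⟩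
  rw [rank, dif_pos h]
  exact P.x_inj _ h.choose_spec.1 _ hi h.choose_spec.2

lemma rank_y {i : ℕ} (hi : i < n) : P.rank (P.y i) = n := by
  rw [rank, dif_neg]
  rintro ⟨j, hj, h⟩
  exact P.x_ne_y j hj i hi h

section Order

variable [LinearOrder σ] [Finite σ]

lemma degree_sub_of_toSyn_lt {m : MonomialOrder σ} {μ ν : σ →₀ ℕ} (h : m.toSyn ν < m.toSyn μ) :
    m.degree (monomial μ 1 - monomial ν 1 : MvPolynomial σ K) = μ := by
  classical
  have h1 : ∀ μ, m.degree (monomial μ 1 : MvPolynomial σ K) = μ := fun μ => by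
    rw [m.degree_monomial, if_neg one_ne_zero]
  rw [m.degree_sub_of_lt (by rwa [h1, h1]), h1]

lemma minor_eq (i j : ℕ) : P.minor K i j =
    monomial (Finsupp.single (P.x i) 1 + Finsupp.single (P.y j) 1) 1 -
      monomial (Finsupp.single (P.x j) 1 + Finsupp.single (P.y i) 1) 1 := by
  rw [minor, X, X, X, X, monomial_mul, monomial_mul, one_mul]

lemma exists_linearOrder (r : σ → ℕ) :
    ∃ o : LinearOrder σ, ∀ v w, o.lt v w → r v ≤ r w ∧ v ≠ w := by
  let s : σ → Lex (ℕ × σ) := fun v => toLex (r v, v)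
  have hs : Function.Injective s := fun v w h => congrArg (fun z => (ofLex z).2) h
  refine ⟨LinearOrder.lift' s hs, fun v w h => ?_⟩
  have h' : s v < s w := h
  refine ⟨?_, fun hvw => (hvw ▸ h').ne rfl⟩
  rcases Prod.Lex.toLex_lt_toLex.1 h' with h | h
  · exact le_of_lt h
  · exact le_of_eq h.1

variable (K) in
/-- A monomial order for which `x_i y_j` is the leading monomial of `x_i y_j - x_j y_i`,
`i < j`. -/
lemma exists_monomialOrder : ∃ m : MonomialOrder.{u, u} σ, ∀ i j, i < j → j < n →
    m.degree (P.minor K i j) = Finsupp.single (P.x i) 1 + Finsupp.single (P.y j) 1 := by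
  obtain ⟨o, ho⟩ := exists_linearOrder P.rank
  refine ⟨@MonomialOrder.lex σ o (@Finite.to_wellFoundedGT σ _ o.toPreorder), fun i j hij hj => ?_⟩
  have hi := hij.trans hj
  rw [minor_eq]
  refine degree_sub_of_toSyn_lt ?_
  rw [MonomialOrder.lex_lt_iff]
  have e1 := P.x_ne_y i hi i hi
  have e2 := P.x_ne_y i hi j hj
  have e3 : P.x i ≠ P.x j := fun h => hij.ne (P.x_inj i hi j hj h)
  -- In this lexicographic order smaller variables dominate. The two terms first differ at `x_i`:
  -- any smaller variable has rank at most `i`, whereas `x_j`, `y_i`, `y_j` have larger rank.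
  refine ⟨P.x i, fun v hv => ?_, ?_⟩
  · obtain ⟨hle, n1⟩ := ho _ _ hv
    rw [P.rank_x hi] at hle
    replace n1 := n1.symm
    have n2 : P.x j ≠ v := by rintro rfl; rw [P.rank_x hj] at hle; omega
    have n3 : P.y i ≠ v := by rintro rfl; rw [P.rank_y hi] at hle; omega
    have n4 : P.y j ≠ v := by rintro rfl; rw [P.rank_y hj] at hle; omega
    simp [n1, n2, n3, n4]
  · simp [e1.symm, e2.symm, e3.symm]

variable (K) in
/-- The chosen monomial order. -/
def order : MonomialOrder.{u, u} σ := (P.exists_monomialOrder K).choose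

lemma degree_minor {i j : ℕ} (hij : i < j) (hj : j < n) : (P.order K).degree (P.minor K i j) =
    Finsupp.single (P.x i) 1 + Finsupp.single (P.y j) 1 :=
  (P.exists_monomialOrder K).choose_spec i j hij hj

lemma minor_ne_zero {i j : ℕ} (hij : i < j) (hj : j < n) : P.minor K i j ≠ 0 := by
  intro h
  have := P.degree_minor (K := K) hij hj
  rw [h, MonomialOrder.degree_zero] at this
  have h2 := DFunLike.congr_fun this (P.x i)
  have h3 := P.x_ne_y i (hij.trans hj) j hj
  simp [h3.symm] at h2

/-- The leading monomials of the edge binomials. -/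
def leads (E : Finset ℕ) : Set (σ →₀ ℕ) :=
  (fun e => Finsupp.single (P.x e) 1 + Finsupp.single (P.y (e + 1)) 1) '' E

lemma support_lead (i j : ℕ) :
    (Finsupp.single (P.x i) 1 + Finsupp.single (P.y j) 1 : σ →₀ ℕ).support ⊆ {P.x i, P.y j} := by
  refine Finsupp.support_add.trans ?_
  refine Finset.union_subset ?_ ?_ <;> refine Finsupp.support_single_subset.trans ?_ <;> simp

lemma disjoint_lead {i j k l : ℕ} (hi : i < n) (hj : j < n) (hk : k < n) (hl : l < n)
    (hik : i ≠ k) (hjl : j ≠ l) :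
    Disjoint (Finsupp.single (P.x i) 1 + Finsupp.single (P.y j) 1 : σ →₀ ℕ).support
      (Finsupp.single (P.x k) 1 + Finsupp.single (P.y l) 1 : σ →₀ ℕ).support := by
  refine Finset.disjoint_of_subset_left (P.support_lead i j)
    (Finset.disjoint_of_subset_right (P.support_lead k l) ?_)
  have h1 : P.x i ≠ P.x k := fun h => hik (P.x_inj _ hi _ hk h)
  have h2 : P.y j ≠ P.y l := fun h => hjl (P.y_inj _ hj _ hl h)
  have h3 := P.x_ne_y i hi l hl
  have h4 := (P.x_ne_y k hk j hj).symm
  simp [h1.symm, h2.symm, h3.symm, h4.symm]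

/-- `E` is a set of edges of the path on `n` vertices. -/
def IsEdgeSet (n : ℕ) (E : Finset ℕ) : Prop := ∀ e ∈ E, e + 1 < n

variable {E : Finset ℕ}

/-- The leads `x_e y_{e+1}` of distinct path edges share no variable, so the binomials form a
Gröbner basis, built up one edge at a time. -/
lemma isInitial_edgeIdeal (hE : IsEdgeSet n E) :
    IsInitial (P.order K) (P.edgeIdeal K E) (P.leads E) := by
  induction E using Finset.induction_on with
  | empty => rw [edgeIdeal_empty, leads]; simpa using isInitial_bot
  | insert e E he ih =>
    have hE' : IsEdgeSet n E := fun f hf => hE f (Finset.mem_insert_of_mem hf)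
    have hen := hE e (Finset.mem_insert_self e E)
    rw [edgeIdeal_insert, leads, Finset.coe_insert, Set.image_insert_eq]
    have h := (ih hE').sup_span_singleton (P.minor_ne_zero (Nat.lt_succ_self e) hen) ?_
    · rwa [P.degree_minor (Nat.lt_succ_self e) hen] at h
    · rintro _ ⟨f, hf, rfl⟩
      rw [P.degree_minor (by omega) hen]
      have hfn := hE' f hf
      have hfe : f ≠ e := by rintro rfl; exact he hf
      exact P.disjoint_lead (by omega) hfn (by omega) hen hfe (by omega)

lemma mem_of_minor_mul_mem (hE : IsEdgeSet n E) {i j : ℕ} (hij : i < j) (hj : j < n) (hi : i ∉ E)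
    (hj' : ∀ e ∈ E, e + 1 ≠ j) (u : MvPolynomial σ K)
    (hu : P.minor K i j * u ∈ P.edgeIdeal K E) : u ∈ P.edgeIdeal K E := by
  refine (P.isInitial_edgeIdeal hE).mem_of_mul_mem (P.minor_ne_zero hij hj) ?_ u hu
  rintro _ ⟨e, he, rfl⟩
  rw [P.degree_minor hij hj]
  have hen := hE e he
  exact P.disjoint_lead (by omega) hen (by omega) hj (by rintro rfl; exact hi he) (hj' e he)

lemma mem_of_X_mul_mem (hE : IsEdgeSet n E) {v : σ}
    (hv : ∀ e ∈ E, P.x e ≠ v ∧ P.y (e + 1) ≠ v) (u : MvPolynomial σ K)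
    (hu : X v * u ∈ P.edgeIdeal K E) : u ∈ P.edgeIdeal K E := by
  refine (P.isInitial_edgeIdeal hE).mem_of_mul_mem (X_ne_zero v) ?_ u hu
  rintro _ ⟨e, he, rfl⟩
  rw [MonomialOrder.degree_X]
  refine Finset.disjoint_of_subset_left (P.support_lead e (e + 1))
    (Finset.disjoint_of_subset_right Finsupp.support_single_subset ?_)
  simp [(hv e he).1.symm, (hv e he).2.symm]

lemma mem_of_X_x_mul_mem (hE : IsEdgeSet n E) {k : ℕ} (hk : k < n) (hkE : k ∉ E)
    (u : MvPolynomial σ K) (hu : X (P.x k) * u ∈ P.edgeIdeal K E) : u ∈ P.edgeIdeal K E := by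
  refine P.mem_of_X_mul_mem hE (fun e he => ⟨fun h => hkE ?_, fun h => ?_⟩) u hu
  · have hen := hE e he
    rwa [P.x_inj e (by omega) k hk h] at he
  · exact P.x_ne_y k hk (e + 1) (hE e he) h.symm

lemma mem_of_X_y_mul_mem (hE : IsEdgeSet n E) {k : ℕ} (hk : k < n) (hkE : ∀ e ∈ E, e + 1 ≠ k)
    (u : MvPolynomial σ K) (hu : X (P.y k) * u ∈ P.edgeIdeal K E) : u ∈ P.edgeIdeal K E := by
  refine P.mem_of_X_mul_mem hE (fun e he => ⟨fun h => ?_, fun h => hkE e he ?_⟩) u hu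
  · have hen := hE e he
    exact P.x_ne_y e (by omega) k hk h
  · exact P.y_inj _ (hE e he) _ hk h

lemma mem_of_sq_mem (hE : IsEdgeSet n E) (u : MvPolynomial σ K)
    (hu : u * u ∈ P.edgeIdeal K E) : u ∈ P.edgeIdeal K E := by
  refine (P.isInitial_edgeIdeal hE).mem_of_sq_mem ?_ u hu
  rintro _ ⟨e, he, rfl⟩ v
  have hen := hE e he
  have := P.x_ne_y e (by omega) (e + 1) hen
  simp only [Finsupp.coe_add, Pi.add_apply, Finsupp.single_apply]
  split_ifs with h1 h2 <;> first | omega | exact absurd (h1.trans h2.symm) this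

end Order

end PathVars

/-! ### Setting variables to zero. -/

section Kill

variable {K : Type*} [Field K] {σ : Type*}

open Classical in
/-- The substitution of zero for the variables in `V`. -/
def kill (K : Type*) [Field K] (V : Set σ) : MvPolynomial σ K →ₐ[K] MvPolynomial σ K :=
  aeval fun v => if v ∈ V then 0 else X v

lemma kill_X_of_mem {V : Set σ} {v : σ} (h : v ∈ V) : kill K V (X v) = 0 := by
  rw [kill, aeval_X, if_pos h]

lemma kill_X_of_notMem {V : Set σ} {v : σ} (h : v ∉ V) : kill K V (X v) = X v := by
  rw [kill, aeval_X, if_neg h]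

lemma sub_kill_mem {V : Set σ} {A : Ideal (MvPolynomial σ K)} (hA : ∀ v ∈ V, X v ∈ A)
    (p : MvPolynomial σ K) : p - kill K V p ∈ A := by
  have h : (Ideal.Quotient.mkₐ K A).comp (kill K V) = Ideal.Quotient.mkₐ K A := by
    refine algHom_ext fun v => ?_
    rw [AlgHom.comp_apply]
    by_cases hv : v ∈ V
    · rw [kill_X_of_mem hv, map_zero]
      exact (Ideal.Quotient.eq_zero_iff_mem.2 (hA v hv)).symm
    · rw [kill_X_of_notMem hv]
  rw [← Ideal.Quotient.eq_zero_iff_mem, map_sub, sub_eq_zero]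
  exact (DFunLike.congr_fun h p).symm

/-- Stability under `x_v ↦ 0` keeps `x_w` regular modulo `B + (x_v)`: a relation modulo that ideal
becomes one modulo `B` after the substitution. -/
lemma RegLT.sup_span_X_pair [LinearOrder σ] [Fintype σ] {B : Ideal (MvPolynomial σ K)} {m : ℕ}
    {v w : σ} (hvw : v ≠ w)
    (hB : IsHomog B) (hst : ∀ p ∈ B, kill K {v} p ∈ B) (hv : ∀ u, X v * u ∈ B → u ∈ B)
    (hw : ∀ u, X w * u ∈ B → u ∈ B) (h : RegLT ⊤ B m) :
    RegLT ⊤ (B ⊔ Ideal.span {X v} ⊔ Ideal.span {X w}) m := by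
  refine RegLT.sup_span_singleton (k := 0) (isHomogeneous_X K w)
    (hB.sup (isHomog_span (by simpa using ⟨1, isHomogeneous_X K v⟩))) (fun u hu => ?_)
    (RegLT.sup_span_singleton (k := 0) (isHomogeneous_X K v) hB hv h)
  obtain ⟨b, hb, x, hx, he⟩ := Submodule.mem_sup.1 hu
  obtain ⟨t, rfl⟩ := Ideal.mem_span_singleton'.1 hx
  have h1 := congrArg (kill K {v}) he
  rw [map_add, map_mul, map_mul, kill_X_of_mem (Set.mem_singleton v),
    kill_X_of_notMem (by simpa using hvw.symm), mul_zero, add_zero] at h1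
  have h2 := hw _ (h1 ▸ hst b hb)
  rw [← sub_add_cancel u (kill K {v} u)]
  refine add_mem (Ideal.mem_sup_right (sub_kill_mem ?_ u)) (Ideal.mem_sup_left h2)
  rintro _ rfl
  exact Ideal.mem_span_singleton_self _

end Kill

/-! ### Colon ideals by the variables at a vertex. -/

section RingLemma

/-- For two vectors `(p₁, p₂)`, `(q₁, q₂)` and generic `(x, y)`, the colon ideal of
`(p₁ y - p₂ x, q₁ y - q₂ x)` by `(x, y)` is generated by adding `p₁ q₂ - p₂ q₁`. -/
lemma exists_eq_of_colon_pair {R : Type*} [CommRing R] {x y p₁ p₂ q₁ q₂ u α β γ δ : R}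
    (hx : ∀ s, x * s = 0 → s = 0) (hxy : ∀ s t, y * t = x * s → ∃ η, t = x * η)
    (hP : ∀ s, (p₁ * y - p₂ * x) * s = 0 → s = 0)
    (hPQ : ∀ s t, (q₁ * y - q₂ * x) * t = (p₁ * y - p₂ * x) * s → ∃ ε, t = (p₁ * y - p₂ * x) * ε)
    (h₁ : x * u = α * (p₁ * y - p₂ * x) + β * (q₁ * y - q₂ * x))
    (h₂ : y * u = γ * (p₁ * y - p₂ * x) + δ * (q₁ * y - q₂ * x)) :
    ∃ η ζ ε, u = η * (p₁ * y - p₂ * x) + ζ * (q₁ * y - q₂ * x) + ε * (p₁ * q₂ - p₂ * q₁) := by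
  -- Equating `y (x u)` with `x (y u)` yields a relation between the two forms; its factor `ε`
  -- becomes the coefficient of the new determinant.
  obtain ⟨ε, hε⟩ := hPQ (y * α - x * γ) (x * δ - y * β)
    (by linear_combination y * h₁ - x * h₂)
  have hε' : y * α - x * γ = (q₁ * y - q₂ * x) * ε := by
    rw [← sub_eq_zero]
    refine hP _ ?_
    linear_combination (-y) * h₁ + x * h₂ + (q₁ * y - q₂ * x) * hε
  obtain ⟨η, hη⟩ := hxy (γ - q₂ * ε) (α - q₁ * ε) (by linear_combination hε')
  obtain ⟨ζ, hζ⟩ := hxy (δ + p₂ * ε) (β + p₁ * ε) (by linear_combination (-hε))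
  refine ⟨η, ζ, ε, ?_⟩
  rw [← sub_eq_zero]
  refine hx _ ?_
  linear_combination h₁ + (p₁ * y - p₂ * x) * hη + (q₁ * y - q₂ * x) * hζ

end RingLemma

namespace PathVars

variable {σ : Type u} {n : ℕ} (P : PathVars σ n) {K : Type*} [Field K]

/-- The edges not meeting the vertex `k`. -/
def away (E : Finset ℕ) (k : ℕ) : Finset ℕ := E.filter fun e => e ≠ k ∧ e + 1 ≠ k

lemma mem_away {E : Finset ℕ} {k e : ℕ} : e ∈ away E k ↔ e ∈ E ∧ e ≠ k ∧ e + 1 ≠ k := by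
  simp [away]

lemma away_subset (E : Finset ℕ) (k : ℕ) : away E k ⊆ E := Finset.filter_subset _ _

lemma IsEdgeSet.away {E : Finset ℕ} (hE : IsEdgeSet n E) (k : ℕ) : IsEdgeSet n (away E k) :=
  fun e he => hE e (away_subset E k he)

lemma kill_minor_of_ne {i j k : ℕ} (hi : i < n) (hj : j < n) (hk : k < n) (hik : i ≠ k)
    (hjk : j ≠ k) {V : Set σ} (hV : V ⊆ {P.x k, P.y k}) :
    kill K V (P.minor K i j) = P.minor K i j := by
  have h : ∀ l < n, l ≠ k → P.x l ∉ V ∧ P.y l ∉ V := by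
    intro l hl hlk
    refine ⟨fun hm => ?_, fun hm => ?_⟩
    · rcases hV hm with h | h
      · exact hlk (P.x_inj _ hl _ hk h)
      · exact P.x_ne_y _ hl _ hk h
    · rcases hV hm with h | h
      · exact P.x_ne_y _ hk _ hl h.symm
      · exact hlk (P.y_inj _ hl _ hk h)
  rw [minor, map_sub, map_mul, map_mul, kill_X_of_notMem (h i hi hik).1,
    kill_X_of_notMem (h i hi hik).2, kill_X_of_notMem (h j hj hjk).1,
    kill_X_of_notMem (h j hj hjk).2]

lemma kill_minor_left (k j : ℕ) : kill K {P.x k, P.y k} (P.minor K k j) = 0 := by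
  rw [minor, map_sub, map_mul, map_mul, kill_X_of_mem (v := P.x k) (by simp),
    kill_X_of_mem (v := P.y k) (by simp)]
  ring

lemma kill_minor_right (k j : ℕ) : kill K {P.x k, P.y k} (P.minor K j k) = 0 := by
  rw [minor, map_sub, map_mul, map_mul, kill_X_of_mem (v := P.x k) (by simp),
    kill_X_of_mem (v := P.y k) (by simp)]
  ring

lemma kill_mem_away {E : Finset ℕ} (hE : IsEdgeSet n E) {k : ℕ} (hk : k < n)
    {p : MvPolynomial σ K} (hp : p ∈ P.edgeIdeal K E) :
    kill K {P.x k, P.y k} p ∈ P.edgeIdeal K (away E k) := by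
  have h : P.edgeIdeal K E ≤ (P.edgeIdeal K (away E k)).comap (kill K {P.x k, P.y k}) := by
    rw [edgeIdeal_le_iff]
    intro e he
    rw [Ideal.mem_comap]
    have hen := hE e he
    by_cases h1 : e = k
    · rw [h1, kill_minor_left]; exact zero_mem _
    by_cases h2 : e + 1 = k
    · rw [h2, kill_minor_right]; exact zero_mem _
    rw [P.kill_minor_of_ne (by omega) hen hk h1 h2 subset_rfl]
    exact P.minor_mem (mem_away.2 ⟨he, h1, h2⟩)
  exact h hp

lemma kill_x_mem {E : Finset ℕ} (hE : IsEdgeSet n E) {k : ℕ} (hk : k < n)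
    (hkE : ∀ e ∈ E, e ≠ k ∧ e + 1 ≠ k) {p : MvPolynomial σ K} (hp : p ∈ P.edgeIdeal K E) :
    kill K {P.x k} p ∈ P.edgeIdeal K E := by
  have h : P.edgeIdeal K E ≤ (P.edgeIdeal K E).comap (kill K {P.x k}) := by
    rw [edgeIdeal_le_iff]
    intro e he
    rw [Ideal.mem_comap]
    have hen := hE e he
    rw [P.kill_minor_of_ne (by omega) hen hk (hkE e he).1 (hkE e he).2 (by simp)]
    exact P.minor_mem he
  exact h hp

variable (K) in
/-- The ideal of the variables at the vertex `k`. -/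
def vertexIdeal (k : ℕ) : Ideal (MvPolynomial σ K) :=
  Ideal.span {X (P.x k)} ⊔ Ideal.span {X (P.y k)}

lemma X_x_mem (k : ℕ) : X (P.x k) ∈ P.vertexIdeal K k :=
  Ideal.mem_sup_left (Ideal.mem_span_singleton_self _)

lemma X_y_mem (k : ℕ) : X (P.y k) ∈ P.vertexIdeal K k :=
  Ideal.mem_sup_right (Ideal.mem_span_singleton_self _)

lemma vertexIdeal_le {k : ℕ} {A : Ideal (MvPolynomial σ K)} (hx : X (P.x k) ∈ A)
    (hy : X (P.y k) ∈ A) : P.vertexIdeal K k ≤ A :=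
  sup_le ((Ideal.span_singleton_le_iff_mem _).2 hx) ((Ideal.span_singleton_le_iff_mem _).2 hy)

lemma sub_kill_mem_vertexIdeal (k : ℕ) (p : MvPolynomial σ K) :
    p - kill K {P.x k, P.y k} p ∈ P.vertexIdeal K k := by
  refine sub_kill_mem ?_ p
  rintro v (rfl | rfl)
  · exact P.X_x_mem k
  · exact P.X_y_mem k

lemma mem_sup_vertexIdeal {A : Ideal (MvPolynomial σ K)} {k : ℕ} {p : MvPolynomial σ K}
    (h : kill K {P.x k, P.y k} p ∈ A) : p ∈ A ⊔ P.vertexIdeal K k := by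
  rw [← sub_add_cancel p (kill K {P.x k, P.y k} p)]
  exact add_mem (Ideal.mem_sup_right (P.sub_kill_mem_vertexIdeal k p)) (Ideal.mem_sup_left h)

variable (K) in
/-- The colon ideal of an edge ideal by the variables at the vertex `a`. -/
def vertexColon (E : Finset ℕ) (a : ℕ) : Ideal (MvPolynomial σ K) :=
  quotBy (P.edgeIdeal K E) (X (P.x a)) ⊓ quotBy (P.edgeIdeal K E) (X (P.y a))

lemma mem_vertexColon {E : Finset ℕ} {a : ℕ} {u : MvPolynomial σ K} :
    u ∈ P.vertexColon K E a ↔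
      X (P.x a) * u ∈ P.edgeIdeal K E ∧ X (P.y a) * u ∈ P.edgeIdeal K E := Iff.rfl

lemma le_vertexColon (E : Finset ℕ) (a : ℕ) : P.edgeIdeal K E ≤ P.vertexColon K E a :=
  le_inf (le_quotBy _ _) (le_quotBy _ _)

lemma isHomog_vertexColon (E : Finset ℕ) (a : ℕ) : IsHomog (P.vertexColon K E a) :=
  fun p hp n => ⟨(P.isHomog_edgeIdeal E).quotBy (isHomogeneous_X K _) p hp.1 n,
    (P.isHomog_edgeIdeal E).quotBy (isHomogeneous_X K _) p hp.2 n⟩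

section Colon

variable [LinearOrder σ] [Finite σ] {E : Finset ℕ}

/-- Plücker relations write `x_{p+1} f_{p,p+2}` and `y_{p+1} f_{p,p+2}` through the two edges at `p
+ 1`. Conversely, once the vertex `p + 1` is killed, `f_{p,p+2}` is regular modulo the remaining
edges. -/
lemma quotBy_minor_add_two (hE : IsEdgeSet n E) {p : ℕ} (hp : p ∈ E) (hp' : p + 1 ∈ E) :
    quotBy (P.edgeIdeal K E) (P.minor K p (p + 2)) =
      P.edgeIdeal K (away E (p + 1)) ⊔ P.vertexIdeal K (p + 1) := by
  have hn := hE _ hp'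
  refine le_antisymm (fun u hu => P.mem_sup_vertexIdeal ?_) (sup_le ?_ (P.vertexIdeal_le ?_ ?_))
  · have h := P.kill_mem_away hE (k := p + 1) (by omega) (mem_quotBy.1 hu)
    rw [map_mul, P.kill_minor_of_ne (by omega) hn (k := p + 1) (by omega) (by omega) (by omega)
      subset_rfl] at h
    refine P.mem_of_minor_mul_mem (hE.away _) (by omega) hn ?_ ?_ _ h
    · simp [mem_away]
    · intro e he; have := (mem_away.1 he).2.1; omega
  · exact (P.edgeIdeal_mono (away_subset _ _)).trans (le_quotBy _ _)
  · rw [mem_quotBy]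
    have : P.minor K p (p + 2) * X (P.x (p + 1)) =
        X (P.x p) * P.minor K (p + 1) (p + 1 + 1) + X (P.x (p + 2)) * P.minor K p (p + 1) := by
      simp only [minor]; ring
    rw [this]
    exact add_mem (Ideal.mul_mem_left _ _ (P.minor_mem hp')) (Ideal.mul_mem_left _ _ (P.minor_mem hp))
  · rw [mem_quotBy]
    have : P.minor K p (p + 2) * X (P.y (p + 1)) =
        X (P.y p) * P.minor K (p + 1) (p + 1 + 1) + X (P.y (p + 2)) * P.minor K p (p + 1) := by
      simp only [minor]; ring
    rw [this]
    exact add_mem (Ideal.mul_mem_left _ _ (P.minor_mem hp')) (Ideal.mul_mem_left _ _ (P.minor_mem hp))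

lemma vertexColon_of_notMem (hE : IsEdgeSet n E) {a : ℕ} (ha : a < n) (haE : a ∉ E) :
    P.vertexColon K E a = P.edgeIdeal K E :=
  le_antisymm (fun u hu => P.mem_of_X_x_mul_mem hE ha haE u hu.1) (P.le_vertexColon E a)

lemma vertexColon_of_forall_ne (hE : IsEdgeSet n E) {a : ℕ} (ha : a < n)
    (haE : ∀ e ∈ E, e + 1 ≠ a) : P.vertexColon K E a = P.edgeIdeal K E :=
  le_antisymm (fun u hu => P.mem_of_X_y_mul_mem hE ha haE u hu.2) (P.le_vertexColon E a)

lemma exists_of_mem_edgeIdeal_insert {e : ℕ} {F : Finset ℕ} {u : MvPolynomial σ K}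
    (hu : u ∈ P.edgeIdeal K (insert e F)) :
    ∃ β, u - β * P.minor K e (e + 1) ∈ P.edgeIdeal K F := by
  rw [edgeIdeal_insert] at hu
  obtain ⟨w, hw, x, hx, rfl⟩ := Submodule.mem_sup.1 hu
  obtain ⟨t, rfl⟩ := Ideal.mem_span_singleton'.1 hx
  exact ⟨t, by simpa using hw⟩

/-- Modulo the edges `F` that avoid `p + 1`, the two edges at `p + 1` are linear forms in `x_{p+1},
y_{p+1}` with determinant `f_{p,p+2}`, and `exists_eq_of_colon_pair` applies. -/
lemma vertexColon_eq_sup (hE : IsEdgeSet n E) {p : ℕ} (hp : p ∈ E) (hp' : p + 1 ∈ E) :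
    P.vertexColon K E (p + 1) = P.edgeIdeal K E ⊔ Ideal.span {P.minor K p (p + 2)} := by
  have hn := hE _ hp'
  refine le_antisymm (fun u hu => ?_) (sup_le (P.le_vertexColon _ _) ?_)
  · set F := (E.erase (p + 1)).erase p with hF
    have hF1 : insert p F = E.erase (p + 1) := Finset.insert_erase (by simp [hp])
    have hF2 : insert (p + 1) (insert p F) = E := by rw [hF1, Finset.insert_erase hp']
    have hpF : p ∉ F := by simp [hF]
    have hpF' : p + 1 ∉ F := by simp [hF]
    have hFE : F ⊆ E := (Finset.erase_subset _ _).trans (Finset.erase_subset _ _)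
    have hFs : IsEdgeSet n F := fun e he => hE e (hFE he)
    have hF1s : IsEdgeSet n (insert p F) := fun e he => hE e (by
      rw [hF1] at he; exact Finset.erase_subset _ _ he)
    have hdec : ∀ w ∈ P.edgeIdeal K E, ∃ α β,
        w - (α * P.minor K p (p + 1) + β * P.minor K (p + 1) (p + 1 + 1)) ∈ P.edgeIdeal K F := by
      intro w hw
      rw [← hF2] at hw
      obtain ⟨β, h⟩ := P.exists_of_mem_edgeIdeal_insert hw
      obtain ⟨α, h⟩ := P.exists_of_mem_edgeIdeal_insert h
      exact ⟨α, β, by convert h using 1; ring⟩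
    obtain ⟨α, β, h1⟩ := hdec _ (P.mem_vertexColon.1 hu).1
    obtain ⟨γ, δ, h2⟩ := hdec _ (P.mem_vertexColon.1 hu).2
    let I := P.edgeIdeal K F
    let q := Ideal.Quotient.mk I
    have hq : ∀ z, q z = 0 ↔ z ∈ I := fun z => Ideal.Quotient.eq_zero_iff_mem
    have hsurj : Function.Surjective q := Ideal.Quotient.mk_surjective
    have eP : q (P.minor K p (p + 1)) =
        q (X (P.x p)) * q (X (P.y (p + 1))) - q (X (P.y p)) * q (X (P.x (p + 1))) := by
      rw [minor, map_sub, map_mul, map_mul]; ring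
    -- The second form is minus the edge binomial, which explains the signs on `β` and `δ` below.
    have eQ : q (P.minor K (p + 1) (p + 1 + 1)) =
        - (q (X (P.x (p + 2))) * q (X (P.y (p + 1)))
          - q (X (P.y (p + 2))) * q (X (P.x (p + 1)))) := by
      rw [minor, map_sub, map_mul, map_mul]; ring
    obtain ⟨η, ζ, ε, he⟩ := exists_eq_of_colon_pair (x := q (X (P.x (p + 1))))
      (y := q (X (P.y (p + 1)))) (p₁ := q (X (P.x p))) (p₂ := q (X (P.y p)))
      (q₁ := q (X (P.x (p + 2)))) (q₂ := q (X (P.y (p + 2)))) (u := q u)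
      (α := q α) (β := - q β) (γ := q γ) (δ := - q δ)
      (by
        intro s hs
        obtain ⟨s, rfl⟩ := hsurj s
        rw [← map_mul, hq] at hs
        exact (hq s).2 (P.mem_of_X_x_mul_mem hFs (by omega) hpF' s hs))
      (by
        intro s t hst
        obtain ⟨s, rfl⟩ := hsurj s
        obtain ⟨t, rfl⟩ := hsurj t
        rw [← map_mul, ← map_mul, ← sub_eq_zero, ← map_sub, hq] at hst
        have hk : ∀ e ∈ F, e ≠ p + 1 ∧ e + 1 ≠ p + 1 := fun e he =>
          ⟨by rintro rfl; exact hpF' he, by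
            intro h; obtain rfl : e = p := by omega
            exact hpF he⟩
        have h := P.kill_x_mem hFs (k := p + 1) (by omega) hk hst
        rw [map_sub, map_mul, map_mul, kill_X_of_mem (Set.mem_singleton _), zero_mul, sub_zero,
          kill_X_of_notMem (by
            simpa using (P.x_ne_y (p + 1) (by omega) (p + 1) (by omega)).symm)] at h
        have h' := P.mem_of_X_y_mul_mem hFs (k := p + 1) (by omega) (fun e he => (hk e he).2) _ h
        have hd := sub_kill_mem (V := {P.x (p + 1)})
          (A := Ideal.span {X (P.x (p + 1))}) (K := K) (by
            rintro _ rfl; exact Ideal.mem_span_singleton_self _) t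
        obtain ⟨r, hr⟩ := Ideal.mem_span_singleton'.1 hd
        refine ⟨q r, ?_⟩
        rw [← map_mul, mul_comm, hr, map_sub, (hq _).2 h', sub_zero])
      (by
        intro s hs
        obtain ⟨s, rfl⟩ := hsurj s
        rw [← eP, ← map_mul, hq] at hs
        exact (hq s).2 (P.mem_of_minor_mul_mem hFs (by omega) (by omega) hpF (by
          intro e he h; obtain rfl : e = p := by omega
          exact hpF he) s hs))
      (by
        intro s t hst
        obtain ⟨s, rfl⟩ := hsurj s
        obtain ⟨t, rfl⟩ := hsurj t
        have hst' : P.minor K (p + 1) (p + 1 + 1) * t + P.minor K p (p + 1) * s ∈ I := by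
          rw [← hq, map_add, map_mul, map_mul, eP, eQ]
          linear_combination (-hst)
        have ht : t ∈ P.edgeIdeal K (insert p F) := by
          refine P.mem_of_minor_mul_mem hF1s (i := p + 1) (j := p + 1 + 1) (by omega) (by omega)
            (by simp [hpF']) ?_ t ?_
          · intro e he h
            obtain rfl : e = p + 1 := by omega
            simp [hpF'] at he
          · have h3 := P.edgeIdeal_mono (K := K) (Finset.subset_insert p F) hst'
            have h4 := Ideal.mul_mem_right s _ (P.minor_mem (K := K) (Finset.mem_insert_self p F))
            have := sub_mem h3 h4
            rwa [add_sub_cancel_right] at this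
        obtain ⟨ε, hε⟩ := P.exists_of_mem_edgeIdeal_insert ht
        refine ⟨q ε, ?_⟩
        rw [← eP, ← map_mul, ← sub_eq_zero, ← map_sub, hq, mul_comm]
        exact hε)
      (by
        have := (hq _).2 h1
        rw [map_sub, map_add, map_mul, map_mul, map_mul, eP, eQ, sub_eq_zero] at this
        linear_combination this)
      (by
        have := (hq _).2 h2
        rw [map_sub, map_add, map_mul, map_mul, map_mul, eP, eQ, sub_eq_zero] at this
        linear_combination this)
    obtain ⟨η, rfl⟩ := hsurj η
    obtain ⟨ζ, rfl⟩ := hsurj ζ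
    obtain ⟨ε, rfl⟩ := hsurj ε
    have hfin : u - (η * P.minor K p (p + 1) - ζ * P.minor K (p + 1) (p + 1 + 1)
        + ε * P.minor K p (p + 2)) ∈ I := by
      rw [← hq, map_sub, map_add, map_sub, map_mul, map_mul, map_mul, eP, eQ, he]
      rw [minor, map_sub, map_mul, map_mul]; ring
    rw [← sub_add_cancel u (η * P.minor K p (p + 1) - ζ * P.minor K (p + 1) (p + 1 + 1)
        + ε * P.minor K p (p + 2))]
    refine add_mem (Ideal.mem_sup_left (P.edgeIdeal_mono hFE hfin)) (add_mem ?_ ?_)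
    · exact Ideal.mem_sup_left (sub_mem (Ideal.mul_mem_left _ _ (P.minor_mem hp))
        (Ideal.mul_mem_left _ _ (P.minor_mem hp')))
    · exact Ideal.mem_sup_right (Ideal.mul_mem_left _ _ (Ideal.mem_span_singleton_self _))
  · rw [Ideal.span_singleton_le_iff_mem, mem_vertexColon]
    have h := (P.quotBy_minor_add_two (K := K) hE hp hp').ge
    have hx := h (Ideal.mem_sup_right (P.X_x_mem (p + 1)))
    have hy := h (Ideal.mem_sup_right (P.X_y_mem (p + 1)))
    rw [mem_quotBy, mul_comm] at hx hy
    exact ⟨hx, hy⟩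

end Colon

end PathVars

/-! ### Colon ideals by a binomial `f_ab` and their regularity. -/

lemma derivation_mem_span {R S : Type*} [CommRing R] [CommRing S] [Algebra R S]
    (D : Derivation R S S) {s : Set S} (hs : ∀ g ∈ s, D g ∈ Ideal.span s) {p : S}
    (hp : p ∈ Ideal.span s) : D p ∈ Ideal.span s := by
  induction hp using Submodule.span_induction with
  | mem x hx => exact hs x hx
  | zero => rw [map_zero]; exact zero_mem _
  | add x y _ _ hx hy => rw [map_add]; exact add_mem hx hy
  | smul a x hx' hx =>
    rw [smul_eq_mul, Derivation.leibniz, smul_eq_mul, smul_eq_mul]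
    exact add_mem (Ideal.mul_mem_left _ _ hx) (Ideal.mul_mem_right _ _ hx')

lemma quotBy_sup_span_mul {R : Type*} [CommRing R] (I : Ideal R) (v w g : R) :
    quotBy (I ⊔ Ideal.span {v * g} ⊔ Ideal.span {w * g}) g =
      quotBy I g ⊔ (Ideal.span {v} ⊔ Ideal.span {w}) := by
  refine le_antisymm (fun u hu => ?_) (sup_le (fun u hu => ?_) (sup_le ?_ ?_))
  · obtain ⟨z, hz, c, hc, he⟩ := Submodule.mem_sup.1 (mem_quotBy.1 hu)
    obtain ⟨a, ha, b, hb, rfl⟩ := Submodule.mem_sup.1 hz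
    obtain ⟨s, rfl⟩ := Ideal.mem_span_singleton'.1 hb
    obtain ⟨t, rfl⟩ := Ideal.mem_span_singleton'.1 hc
    have : u = (u - s * v - t * w) + (s * v + t * w) := by ring
    rw [this]
    refine add_mem (Ideal.mem_sup_left ?_) (Ideal.mem_sup_right (add_mem (Ideal.mem_sup_left ?_)
      (Ideal.mem_sup_right ?_)))
    · rw [mem_quotBy]
      convert ha using 1
      linear_combination (-he)
    · exact Ideal.mul_mem_left _ _ (Ideal.mem_span_singleton_self _)
    · exact Ideal.mul_mem_left _ _ (Ideal.mem_span_singleton_self _)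
  · exact Ideal.mem_sup_left (Ideal.mem_sup_left hu)
  · rw [Ideal.span_singleton_le_iff_mem, mem_quotBy, mul_comm g]
    exact Ideal.mem_sup_left (Ideal.mem_sup_right (Ideal.mem_span_singleton_self _))
  · rw [Ideal.span_singleton_le_iff_mem, mem_quotBy, mul_comm g]
    exact Ideal.mem_sup_right (Ideal.mem_span_singleton_self _)

lemma RegLT.unshift {K : Type*} [Field K] {σ : Type*} [LinearOrder σ] [Fintype σ] {m : ℕ}
    {C : Ideal (MvPolynomial σ K)} {g : MvPolynomial σ K} {k : ℕ}
    (hg : g.IsHomogeneous k) (h : RegLT (C ⊔ Ideal.span {g}) C (m + k)) :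
    RegLT ⊤ (quotBy C g) m := by
  intro δ hδ c _ hcδ hdc
  obtain ⟨d, hd, h'⟩ := h (δ + k) (by omega) (g • c)
    (smul_mem_chainsIn _ (Ideal.mem_sup_right (Ideal.mem_span_singleton_self _)))
    (hcδ.smul hg) (by
      rw [map_smul]
      exact mem_chainsIn.2 fun T => mem_chainsIn.1 hdc T)
  obtain ⟨b, hb, x, hx, rfl⟩ := exists_of_mem_chainsIn_sup hd
  obtain ⟨e, rfl⟩ := exists_of_mem_chainsIn_span hx
  refine ⟨e, mem_chainsIn_top _, mem_chainsIn.2 fun T => ?_⟩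
  have h2 := add_mem h' (del_mem_chainsIn hb)
  rw [map_add, ← sub_sub, sub_right_comm, sub_add_cancel, map_smul, ← smul_sub] at h2
  exact mem_chainsIn.1 h2 T

namespace PathVars

variable {σ : Type u} {n : ℕ} (P : PathVars σ n) {K : Type*} [Field K] {E : Finset ℕ}

lemma derivation_mem_edgeIdeal (D : Derivation K (MvPolynomial σ K) (MvPolynomial σ K))
    (hD : ∀ e ∈ E, D (P.minor K e (e + 1)) ∈ P.edgeIdeal K E) {p : MvPolynomial σ K}
    (hp : p ∈ P.edgeIdeal K E) : D p ∈ P.edgeIdeal K E := by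
  refine derivation_mem_span D ?_ hp
  rintro _ ⟨e, he, rfl⟩
  exact hD e he

lemma derivation_minor (D : Derivation K (MvPolynomial σ K) (MvPolynomial σ K)) (i j : ℕ) :
    D (P.minor K i j) = X (P.x i) * D (X (P.y j)) + X (P.y j) * D (X (P.x i))
      - (X (P.x j) * D (X (P.y i)) + X (P.y i) * D (X (P.x j))) := by
  rw [minor, map_sub, Derivation.leibniz, Derivation.leibniz]
  simp only [smul_eq_mul]

open Classical in
/-- The derivation `y_i ↦ y_i`, `b ≤ i`, that kills the other variables. -/
lemma exists_derivation_y (b : ℕ) :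
    ∃ D : Derivation K (MvPolynomial σ K) (MvPolynomial σ K),
      (∀ i < n, D (X (P.x i)) = 0) ∧
      ∀ i < n, D (X (P.y i)) = if b ≤ i then X (P.y i) else 0 := by
  refine ⟨mkDerivation K fun v => if ∃ i < n, b ≤ i ∧ v = P.y i then X v else 0,
    fun i hi => ?_, fun i hi => ?_⟩
  · rw [mkDerivation_X, if_neg]
    rintro ⟨j, hj, -, h⟩
    exact P.x_ne_y i hi j hj h
  · rw [mkDerivation_X]
    refine if_congr ⟨?_, fun h => ⟨i, hi, h, rfl⟩⟩ rfl rfl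
    rintro ⟨j, hj, hbj, h⟩
    rwa [P.y_inj i hi j hj h]

open Classical in
/-- The derivation `x_i ↦ y_i`, `b ≤ i`, that kills the other variables. -/
lemma exists_derivation_x (b : ℕ) :
    ∃ D : Derivation K (MvPolynomial σ K) (MvPolynomial σ K),
      (∀ i < n, D (X (P.y i)) = 0) ∧
      ∀ i < n, D (X (P.x i)) = if b ≤ i then X (P.y i) else 0 := by
  refine ⟨mkDerivation K fun v => if h : ∃ i < n, b ≤ i ∧ v = P.x i then X (P.y h.choose) else 0,
    fun i hi => ?_, fun i hi => ?_⟩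
  · rw [mkDerivation_X, dif_neg]
    rintro ⟨j, hj, -, h⟩
    exact P.x_ne_y j hj i hi h.symm
  · rw [mkDerivation_X]
    by_cases hb : b ≤ i
    · have h : ∃ j < n, b ≤ j ∧ P.x i = P.x j := ⟨i, hi, hb, rfl⟩
      rw [dif_pos h, if_pos hb]
      rw [← P.x_inj _ hi _ h.choose_spec.1 h.choose_spec.2.2]
    · rw [dif_neg, if_neg hb]
      rintro ⟨j, hj, hbj, h⟩
      rw [P.x_inj i hi j hj h] at hb
      exact hb hbj

section Regularity

variable [LinearOrder σ]

lemma mem_of_sq_mul_mem [Finite σ] (hE : IsEdgeSet n E) {u z : MvPolynomial σ K}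
    (h : u * (u * z) ∈ P.edgeIdeal K E) : u * z ∈ P.edgeIdeal K E := by
  refine P.mem_of_sq_mem hE _ ?_
  have := Ideal.mul_mem_left _ z h
  convert this using 1; ring

/-- If no edge of `E` ends at `b`, then `E : f_{ab}` is the colon ideal by the variables at `a`. -/
lemma mem_vertexColon_of_minor_mul_mem [Finite σ] (hE : IsEdgeSet n E) {a b : ℕ} (hab : a < b)
    (hb : b < n) (hbE : ∀ e ∈ E, e + 1 ≠ b) {u : MvPolynomial σ K}
    (hu : P.minor K a b * u ∈ P.edgeIdeal K E) : u ∈ P.vertexColon K E a := by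
  have ha := hab.trans hb
  -- If `D` preserves `I` and `f_ab u ∈ I`, the Leibniz rule gives `u² D(f_ab) ∈ I`. As `I` is
  -- radical and `y_b` is regular, `z u ∈ I`. The derivations used move only indices `≥ b`; they
  -- preserve `I` because no edge joins `b - 1` to `b`, and they give `z = x_a` and `z = -y_a`.
  have key : ∀ D : Derivation K (MvPolynomial σ K) (MvPolynomial σ K),
      (∀ e ∈ E, D (P.minor K e (e + 1)) ∈ P.edgeIdeal K E) → ∀ z,
      D (P.minor K a b) = z * X (P.y b) → z * u ∈ P.edgeIdeal K E := by
    intro D hD z hz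
    have h1 := P.derivation_mem_edgeIdeal D hD hu
    rw [Derivation.leibniz, hz, smul_eq_mul, smul_eq_mul] at h1
    have h2 : u * (u * (z * X (P.y b))) ∈ P.edgeIdeal K E := by
      have := sub_mem (Ideal.mul_mem_left _ u h1) (Ideal.mul_mem_right (D u) _ hu)
      convert this using 1; ring
    have h3 := P.mem_of_sq_mul_mem hE h2
    refine P.mem_of_X_y_mul_mem hE hb hbE _ ?_
    convert h3 using 1; ring
  rw [mem_vertexColon]
  constructor
  · obtain ⟨D, hDx, hDy⟩ := P.exists_derivation_y (K := K) b
    refine key D (fun e he => ?_) _ ?_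
    · have hen := hE e he
      have hbe := hbE e he
      rw [derivation_minor, hDx e (by omega), hDx (e + 1) hen, hDy e (by omega), hDy (e + 1) hen]
      by_cases h : b ≤ e
      · rw [if_pos h, if_pos (by omega)]
        have := P.minor_mem (K := K) he
        rw [minor] at this
        convert this using 1; ring
      · rw [if_neg h, if_neg (by omega)]
        simp
    · rw [derivation_minor, hDx a ha, hDx b hb, hDy a ha, hDy b hb, if_neg (show ¬ b ≤ a by omega),
        if_pos le_rfl]
      ring
  · obtain ⟨D, hDy, hDx⟩ := P.exists_derivation_x (K := K) b
    have := key D (fun e he => ?_) (- X (P.y a)) ?_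
    · simpa using this
    · have hen := hE e he
      have hbe := hbE e he
      rw [derivation_minor, hDy e (by omega), hDy (e + 1) hen, hDx e (by omega), hDx (e + 1) hen]
      by_cases h : b ≤ e
      · rw [if_pos h, if_pos (by omega)]
        convert zero_mem (P.edgeIdeal K E) using 1; ring
      · rw [if_neg h, if_neg (by omega)]
        simp
    · rw [derivation_minor, hDy a ha, hDy b hb, hDx a ha, hDx b hb, if_neg (show ¬ b ≤ a by omega),
        if_pos le_rfl]
      ring

lemma minor_mul_mem_of_mem_vertexColon {a : ℕ} (b : ℕ) {u : MvPolynomial σ K}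
    (hu : u ∈ P.vertexColon K E a) : P.minor K a b * u ∈ P.edgeIdeal K E := by
  obtain ⟨h1, h2⟩ := P.mem_vertexColon.1 hu
  have := sub_mem (Ideal.mul_mem_left _ (X (P.y b)) h1) (Ideal.mul_mem_left _ (X (P.x b)) h2)
  convert this using 1; rw [minor]; ring

/-- Killing the vertex `k` leaves no edge ending at `k + 1`, so the colon by `f_{a,k+1}` turns into
the colon by the vertex `a`. -/
lemma quotBy_minor_sup_vertexIdeal [Finite σ] (hE : IsEdgeSet n E) {a k : ℕ} (hak : a < k)
    (hk : k + 1 < n) :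
    quotBy (P.edgeIdeal K E) (P.minor K a (k + 1)) ⊔ P.vertexIdeal K k =
      P.vertexColon K (away E k) a ⊔ P.vertexIdeal K k := by
  refine le_antisymm (sup_le (fun u hu => P.mem_sup_vertexIdeal ?_) le_sup_right)
    (sup_le (fun u hu => Ideal.mem_sup_left ?_) le_sup_right)
  · have h := P.kill_mem_away hE (k := k) (by omega) (mem_quotBy.1 hu)
    rw [map_mul, P.kill_minor_of_ne (by omega) hk (by omega) (by omega) (by omega)
      subset_rfl] at h
    refine P.mem_vertexColon_of_minor_mul_mem (hE.away k) (by omega) hk (fun e he => ?_) h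
    have := (mem_away.1 he).2.1
    omega
  · exact P.edgeIdeal_mono (away_subset E k) (P.minor_mul_mem_of_mem_vertexColon (k + 1) hu)

lemma quotBy_minor_sup_vertexIdeal_of_ne [Finite σ] (hE : IsEdgeSet n E) {a k b : ℕ} (ha : a < n)
    (hk : k < n) (hb : b < n) (hab : a ≠ b) (hkb : k ≠ b) :
    quotBy (P.edgeIdeal K E) (P.minor K a k) ⊔ P.vertexIdeal K b =
      quotBy (P.edgeIdeal K (away E b)) (P.minor K a k) ⊔ P.vertexIdeal K b := by
  refine le_antisymm (sup_le (fun u hu => P.mem_sup_vertexIdeal ?_) le_sup_right)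
    (sup_le (fun u hu => Ideal.mem_sup_left ?_) le_sup_right)
  · have h := P.kill_mem_away hE hb (mem_quotBy.1 hu)
    rwa [map_mul, P.kill_minor_of_ne ha hk hb hab hkb subset_rfl] at h
  · exact P.edgeIdeal_mono (away_subset E b) hu

variable [Fintype σ]

lemma regLT_edgeIdeal (hE : IsEdgeSet n E) : RegLT ⊤ (P.edgeIdeal K E) (E.card + 1) := by
  induction E using Finset.induction_on with
  | empty => rw [edgeIdeal_empty]; exact regLT_top_bot
  | insert e E he ih =>
    have hE' : IsEdgeSet n E := fun f hf => hE f (Finset.mem_insert_of_mem hf)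
    have hen := hE e (Finset.mem_insert_self e E)
    rw [edgeIdeal_insert, Finset.card_insert_of_notMem he]
    refine RegLT.sup_span_singleton (k := 1) (P.isHomogeneous_minor _ _) (P.isHomog_edgeIdeal E)
      (P.mem_of_minor_mul_mem hE' (by omega) hen he ?_) (ih hE')
    intro f hf h
    obtain rfl : f = e := by omega
    exact he hf

lemma regLT_sup_vertexIdeal {B : Ideal (MvPolynomial σ K)} {m k : ℕ} (hk : k < n)
    (hB : IsHomog B) (hst : ∀ p ∈ B, kill K {P.x k} p ∈ B)
    (hx : ∀ u, X (P.x k) * u ∈ B → u ∈ B)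
    (hy : ∀ u, X (P.y k) * u ∈ B → u ∈ B) (h : RegLT ⊤ B m) :
    RegLT ⊤ (B ⊔ P.vertexIdeal K k) m := by
  rw [vertexIdeal, ← sup_assoc]
  exact RegLT.sup_span_X_pair (P.x_ne_y k hk k hk) hB hst hx hy h

lemma regLT_edgeIdeal_sup_vertexIdeal (hE : IsEdgeSet n E) {k : ℕ} (hk : k < n) :
    RegLT ⊤ (P.edgeIdeal K (away E k) ⊔ P.vertexIdeal K k) ((away E k).card + 1) := by
  refine P.regLT_sup_vertexIdeal hk (P.isHomog_edgeIdeal _)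
    (fun p hp => P.kill_x_mem (hE.away k) hk (fun e he => (mem_away.1 he).2) hp)
    (P.mem_of_X_x_mul_mem (hE.away k) hk (by simp [mem_away]))
    (P.mem_of_X_y_mul_mem (hE.away k) hk (fun e he => (mem_away.1 he).2.2))
    (P.regLT_edgeIdeal (hE.away k))

/-- Unless both path edges at `a` are present, the colon ideal is `I`. Otherwise one quadric is
added, and its own colon ideal involves fewer edges, so the bound for `I` persists. -/
lemma regLT_vertexColon (hE : IsEdgeSet n E) {a : ℕ} (ha : a < n) :
    RegLT ⊤ (P.vertexColon K E a) (E.card + 1) := by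
  by_cases h1 : a ∈ E
  · by_cases h2 : ∀ e ∈ E, e + 1 ≠ a
    · rw [P.vertexColon_of_forall_ne hE ha h2]
      exact P.regLT_edgeIdeal hE
    · push Not at h2
      obtain ⟨p, hp, rfl⟩ := h2
      rw [P.vertexColon_eq_sup hE hp h1]
      have hI := P.isHomog_edgeIdeal (K := K) E
      refine RegLT.quot (B := P.edgeIdeal K E) (P.regLT_edgeIdeal hE) ?_
        (hI.sup (isHomog_span (by simpa using ⟨2, P.isHomogeneous_minor p (p + 2)⟩))) hI le_sup_left
        le_top
      refine RegLT.mono (RegLT.shift (P.isHomogeneous_minor p (p + 2)) hI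
        (m := (away E (p + 1)).card + 1) ?_) ?_
      · rw [P.quotBy_minor_add_two hE hp h1]
        exact P.regLT_edgeIdeal_sup_vertexIdeal hE ha
      · have : away E (p + 1) ⊂ E := by
          refine Finset.ssubset_iff_subset_ne.2 ⟨away_subset _ _, fun h => ?_⟩
          rw [← h] at hp
          simp [mem_away] at hp
        have := Finset.card_lt_card this
        omega
  · rw [P.vertexColon_of_notMem hE ha h1]
    exact P.regLT_edgeIdeal hE

lemma regLT_vertexColon_sup_vertexIdeal (hE : IsEdgeSet n E) {a k : ℕ} (ha : a < n) (hk : k < n)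
    (hak : a ≠ k) :
    RegLT ⊤ (P.vertexColon K (away E k) a ⊔ P.vertexIdeal K k) ((away E k).card + 1) := by
  have hE' := hE.away k
  have hne : ∀ e ∈ away E k, e ≠ k ∧ e + 1 ≠ k := fun e he => (mem_away.1 he).2
  refine P.regLT_sup_vertexIdeal hk (P.isHomog_vertexColon _ _) (fun p hp => ?_) (fun u hu => ?_)
    (fun u hu => ?_) (P.regLT_vertexColon hE' ha)
  · rw [mem_vertexColon] at hp ⊢
    have h1 := P.kill_x_mem hE' hk hne hp.1
    have h2 := P.kill_x_mem hE' hk hne hp.2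
    rw [map_mul, kill_X_of_notMem (by
      simpa using fun h => hak (P.x_inj a ha k hk h))] at h1
    rw [map_mul, kill_X_of_notMem (by simpa using (P.x_ne_y k hk a ha).symm)] at h2
    exact ⟨h1, h2⟩
  · rw [mem_vertexColon] at hu ⊢
    have hkk : k ∉ away E k := by simp [mem_away]
    exact ⟨P.mem_of_X_x_mul_mem hE' hk hkk _ (by rw [mul_left_comm]; exact hu.1),
      P.mem_of_X_x_mul_mem hE' hk hkk _ (by rw [mul_left_comm]; exact hu.2)⟩
  · rw [mem_vertexColon] at hu ⊢
    have hkk : ∀ e ∈ away E k, e + 1 ≠ k := fun e he => (hne e he).2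
    exact ⟨P.mem_of_X_y_mul_mem hE' hk hkk _ (by rw [mul_left_comm]; exact hu.1),
      P.mem_of_X_y_mul_mem hE' hk hkk _ (by rw [mul_left_comm]; exact hu.2)⟩

/-- Modulo `f_{k,k+1}` the Plücker relation exchanges `x_k f_{a,k+1}` for `x_{k+1} f_{a,k}`. This
lets the induction in `regLT_quotBy_minor` descend from `k + 1` to `k`. -/
lemma sup_span_mul_minor_eq {a k : ℕ} (hk : k ∈ E) :
    P.edgeIdeal K E ⊔ Ideal.span {X (P.x k) * P.minor K a (k + 1)} ⊔
        Ideal.span {X (P.y k) * P.minor K a (k + 1)} =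
      P.edgeIdeal K E ⊔ Ideal.span {X (P.x (k + 1)) * P.minor K a k} ⊔
        Ideal.span {X (P.y (k + 1)) * P.minor K a k} := by
  have hx : X (P.x k) * P.minor K a (k + 1) =
      X (P.x (k + 1)) * P.minor K a k + X (P.x a) * P.minor K k (k + 1) := by
    simp only [minor]; ring
  have hy : X (P.y k) * P.minor K a (k + 1) =
      X (P.y (k + 1)) * P.minor K a k + X (P.y a) * P.minor K k (k + 1) := by
    simp only [minor]; ring
  have hm := P.minor_mem (K := K) hk
  refine le_antisymm (sup_le (sup_le (le_sup_left.trans le_sup_left) ?_) ?_)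
    (sup_le (sup_le (le_sup_left.trans le_sup_left) ?_) ?_) <;>
    rw [Ideal.span_singleton_le_iff_mem]
  · rw [hx]
    exact add_mem (Ideal.mem_sup_left (Ideal.mem_sup_right (Ideal.mem_span_singleton_self _)))
      (Ideal.mem_sup_left (Ideal.mem_sup_left (Ideal.mul_mem_left _ _ hm)))
  · rw [hy]
    exact add_mem (Ideal.mem_sup_right (Ideal.mem_span_singleton_self _))
      (Ideal.mem_sup_left (Ideal.mem_sup_left (Ideal.mul_mem_left _ _ hm)))
  · rw [← sub_eq_iff_eq_add.2 hx]
    exact sub_mem (Ideal.mem_sup_left (Ideal.mem_sup_right (Ideal.mem_span_singleton_self _)))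
      (Ideal.mem_sup_left (Ideal.mem_sup_left (Ideal.mul_mem_left _ _ hm)))
  · rw [← sub_eq_iff_eq_add.2 hy]
    exact sub_mem (Ideal.mem_sup_right (Ideal.mem_span_singleton_self _))
      (Ideal.mem_sup_left (Ideal.mem_sup_left (Ideal.mul_mem_left _ _ hm)))

lemma sup_span_mul_le {R : Type*} [CommRing R] (I : Ideal R) (v w g : R) :
    I ⊔ Ideal.span {v * g} ⊔ Ideal.span {w * g} ≤ I ⊔ Ideal.span {g} := by
  refine sup_le (sup_le le_sup_left ?_) ?_ <;> rw [Ideal.span_singleton_le_iff_mem] <;>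
    exact Ideal.mem_sup_right (Ideal.mul_mem_left _ _ (Ideal.mem_span_singleton_self _))

lemma isHomog_sup_span_mul {k a b : ℕ} :
    IsHomog (P.edgeIdeal K E ⊔ Ideal.span {X (P.x k) * P.minor K a b} ⊔
      Ideal.span {X (P.y k) * P.minor K a b}) :=
  ((P.isHomog_edgeIdeal E).sup (isHomog_span (by
    simpa using ⟨3, (isHomogeneous_X K (P.x k)).mul (P.isHomogeneous_minor a b)⟩))).sup
    (isHomog_span (by
      simpa using ⟨3, (isHomogeneous_X K (P.y k)).mul (P.isHomogeneous_minor a b)⟩))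

/-- The colon ideal of the edge ideal of a set `E` of path edges by the binomial `f_{ab}`, where
`E` contains the edges from `a` to `b ≥ a + 2`, has regularity at most `#E - 2`. -/
theorem regLT_quotBy_minor {a b : ℕ} (hab : a + 2 ≤ b) (hb : b < n) (hE : IsEdgeSet n E)
    (hsub : ∀ e, a ≤ e → e < b → e ∈ E) :
    RegLT ⊤ (quotBy (P.edgeIdeal K E) (P.minor K a b)) (E.card - 1) := by
  induction b using Nat.strong_induction_on generalizing E with
  | _ b ih =>
    obtain ⟨k, rfl⟩ : ∃ k, b = k + 1 := ⟨b - 1, by omega⟩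
    have hkE : k ∈ E := hsub k (by omega) (by omega)
    have hkE' : k - 1 ∈ E := hsub (k - 1) (by omega) (by omega)
    have hcard : (away E k).card + 2 ≤ E.card := by
      have h1 : away E k ⊆ (E.erase k).erase (k - 1) := by
        intro e he
        have := mem_away.1 he
        simp only [Finset.mem_erase]
        exact ⟨by omega, this.2.1, this.1⟩
      have h2 := Finset.card_le_card h1
      rw [Finset.card_erase_of_mem (by simp [hkE']; omega), Finset.card_erase_of_mem hkE] at h2
      have := Finset.one_lt_card.2 ⟨k, hkE, k - 1, hkE', by omega⟩
      omega
    have hcard' : (away E (k + 1)).card + 1 ≤ E.card := by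
      have : away E (k + 1) ⊂ E := by
        refine Finset.ssubset_iff_subset_ne.2 ⟨away_subset _ _, fun h => ?_⟩
        rw [← h] at hkE
        simp [mem_away] at hkE
      exact Finset.card_lt_card this
    set I := P.edgeIdeal K E with hI
    have hIh : IsHomog I := P.isHomog_edgeIdeal E
    -- `S ⧸ (I : f_ab)`, shifted by `2`, is `(I + (f_ab)) ⧸ I`, filtered here by `Cc`. The upper
    -- piece kills the vertex `k = b - 1`; the lower piece lies in `(I + (f_ak)) ⧸ I`, where
    -- induction applies.
    set Cc := I ⊔ Ideal.span {X (P.x k) * P.minor K a (k + 1)} ⊔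
        Ideal.span {X (P.y k) * P.minor K a (k + 1)} with hC
    have hC' : Cc = I ⊔ Ideal.span {X (P.x (k + 1)) * P.minor K a k} ⊔
        Ideal.span {X (P.y (k + 1)) * P.minor K a k} := P.sup_span_mul_minor_eq hkE
    have hCh : IsHomog Cc := P.isHomog_sup_span_mul
    have hIC : I ≤ Cc := le_sup_left.trans le_sup_left
    have hgh : ∀ i j, IsHomog (I ⊔ Ideal.span {P.minor K i j}) := fun i j =>
      hIh.sup (isHomog_span (by simpa using ⟨2, P.isHomogeneous_minor i j⟩))
    have hCg : Cc ≤ I ⊔ Ideal.span {P.minor K a (k + 1)} := sup_span_mul_le _ _ _ _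
    have hCg' : Cc ≤ I ⊔ Ideal.span {P.minor K a k} := by
      rw [hC']; exact sup_span_mul_le _ _ _ _
    have hCsup : Cc ⊔ Ideal.span {P.minor K a (k + 1)} = I ⊔ Ideal.span {P.minor K a (k + 1)} :=
      le_antisymm (sup_le hCg le_sup_right) (sup_le_sup_right hIC _)
    have hCsup' : Cc ⊔ Ideal.span {P.minor K a k} = I ⊔ Ideal.span {P.minor K a k} :=
      le_antisymm (sup_le hCg' le_sup_right) (sup_le_sup_right hIC _)
    -- the quotient by the variables at `k`
    have hA : RegLT (I ⊔ Ideal.span {P.minor K a (k + 1)}) Cc (E.card - 1 + 2) := by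
      rw [← hCsup]
      refine RegLT.shift (P.isHomogeneous_minor _ _) hCh ?_
      rw [hC, quotBy_sup_span_mul, ← vertexIdeal, P.quotBy_minor_sup_vertexIdeal hE (by omega) hb]
      exact (P.regLT_vertexColon_sup_vertexIdeal hE (by omega) (by omega) (by omega)).mono
        (by omega)
    -- the ideal generated by the minor of `a` and `k`
    have hB : RegLT Cc I (E.card - 1 + 2) := by
      rcases Nat.eq_or_lt_of_le (show a + 1 ≤ k by omega) with hk | hk
      · have : Cc = I := by
          refine le_antisymm ?_ hIC
          refine hCg'.trans (sup_le le_rfl ?_)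
          rw [Ideal.span_singleton_le_iff_mem, ← hk]
          exact P.minor_mem (hsub a le_rfl (by omega))
        rw [this]
        exact regLT_self _ _
      · have h1 := RegLT.shift (P.isHomogeneous_minor a k) hIh
          (ih k (by omega) (by omega) (by omega) hE fun e h1 h2 => hsub e h1 (by omega))
        have h2 : RegLT (I ⊔ Ideal.span {P.minor K a k}) Cc (E.card - 2 + 2) := by
          rw [← hCsup']
          refine RegLT.shift (P.isHomogeneous_minor _ _) hCh ?_
          rw [hC', quotBy_sup_span_mul, ← vertexIdeal,
            P.quotBy_minor_sup_vertexIdeal_of_ne hE (by omega) (by omega) hb (by omega) (by omega)]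
          have hE' := hE.away (k + 1)
          have hne : ∀ e ∈ away E (k + 1), e ≠ k + 1 ∧ e + 1 ≠ k + 1 :=
            fun e he => (mem_away.1 he).2
          refine RegLT.mono (m := (away E (k + 1)).card - 1) ?_ (by omega)
          refine P.regLT_sup_vertexIdeal hb ((P.isHomog_edgeIdeal _).quotBy
            (P.isHomogeneous_minor _ _)) (fun p hp => ?_) (fun u hu => ?_) (fun u hu => ?_) ?_
          · have h := P.kill_x_mem hE' hb hne (mem_quotBy.1 hp)
            rwa [map_mul, P.kill_minor_of_ne (by omega) (by omega) hb (by omega) (by omega)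
              (by simp)] at h
          · rw [mem_quotBy, mul_left_comm] at hu
            exact P.mem_of_X_x_mul_mem hE' hb (by simp [mem_away]) _ hu
          · rw [mem_quotBy, mul_left_comm] at hu
            exact P.mem_of_X_y_mul_mem hE' hb (fun e he => (hne e he).2) _ hu
          · refine ih k (by omega) (by omega) (by omega) hE' fun e h1 h2 => ?_
            exact mem_away.2 ⟨hsub e h1 (by omega), by omega, by omega⟩
        -- `RegLT.sub` needs the quotient by `Cc` to be one degree better than the whole; killing
        -- the vertex `b` loses an edge and provides it.
        have e1 : E.card - 1 + 2 = (E.card - 2 + 2) + 1 := by omega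
        rw [e1] at h1 ⊢
        exact RegLT.sub h1 h2 (hgh a k) hIh hIC hCg'
    exact RegLT.unshift (P.isHomogeneous_minor _ _) (RegLT.ext hA hB (hgh _ _) hCh hIC hCg)

end Regularity

end PathVars

/-! ### Quasi-regular sequences. -/

section QuasiRegular

variable {R : Type*} [CommRing R] {ι : Type*} [DecidableEq ι] (f : ι → R)

/-- The forms of degree `k` in the variables `s` with coefficients in the ideal `N`. -/
structure IsForm (s : Finset ι) (k : ℕ) (N : Ideal R) (F : MvPolynomial ι R) : Prop where
  homog : F.IsHomogeneous k
  coeff_mem : ∀ α, coeff α F ∈ N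
  supp : ∀ α, coeff α F ≠ 0 → α.support ⊆ s

variable {f} {s t : Finset ι} {k : ℕ} {N N' : Ideal R} {F G : MvPolynomial ι R}

lemma IsForm.add (hF : IsForm s k N F) (hG : IsForm s k N G) : IsForm s k N (F + G) where
  homog := hF.homog.add hG.homog
  coeff_mem α := by rw [coeff_add]; exact add_mem (hF.coeff_mem α) (hG.coeff_mem α)
  supp α h := by
    rw [coeff_add] at h
    by_cases h1 : coeff α F = 0
    · exact hG.supp α fun h2 => h (by rw [h1, h2, add_zero])
    · exact hF.supp α h1

lemma IsForm.C_mul (hF : IsForm s k N F) (r : R) : IsForm s k N (C r * F) where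
  homog := by simpa using (isHomogeneous_C ι r).mul hF.homog
  coeff_mem α := by rw [coeff_C_mul]; exact Ideal.mul_mem_left _ _ (hF.coeff_mem α)
  supp α h := by
    rw [coeff_C_mul] at h
    exact hF.supp α fun h2 => h (by rw [h2, mul_zero])

lemma IsForm.X_mul (hF : IsForm s k N F) {i : ι} (hi : i ∈ s) : IsForm s (k + 1) N (X i * F) where
  homog := by rw [add_comm]; exact (isHomogeneous_X R i).mul hF.homog
  coeff_mem α := by
    rw [coeff_X_mul']
    split_ifs
    · exact hF.coeff_mem _
    · exact zero_mem _
  supp α h := by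
    rw [coeff_X_mul'] at h
    split_ifs at h with hα
    · intro j hj
      by_cases hji : j = i
      · exact hji ▸ hi
      · refine hF.supp _ h ?_
        rw [Finsupp.mem_support_iff] at hj ⊢
        simpa [Finsupp.single_apply, Ne.symm hji] using hj
    · exact (h rfl).elim

lemma IsForm.mono (hF : IsForm s k N F) (h : N ≤ N') (hs : s ⊆ t) : IsForm t k N' F :=
  ⟨hF.homog, fun α => h (hF.coeff_mem α), fun α hα => (hF.supp α hα).trans hs⟩

lemma isForm_zero : IsForm s k N (0 : MvPolynomial ι R) :=
  ⟨isHomogeneous_zero _ _ _, fun _ => by rw [coeff_zero]; exact zero_mem _,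
    fun _ h => (h (coeff_zero _)).elim⟩

lemma IsForm.eval_mem (hF : IsForm s k N F) : eval f F ∈ N * Ideal.span (f '' s) ^ k := by
  rw [eval_eq]
  refine sum_mem fun α hα => Ideal.mul_mem_mul (hF.coeff_mem α) ?_
  have hα' := mem_support_iff.1 hα
  have hk : ∑ i ∈ α.support, α i = k := by
    have := hF.homog hα'
    rwa [Finsupp.weight_apply, Finsupp.sum, Finset.sum_congr rfl fun i _ => by
      rw [Pi.one_apply, smul_eq_mul, mul_one]] at this
  rw [← hk, ← Finset.prod_pow_eq_pow_sum]
  refine Ideal.prod_mem_prod fun i hi => Ideal.pow_mem_pow (Ideal.subset_span ?_) _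
  exact ⟨i, hF.supp α hα' hi, rfl⟩

lemma exists_isForm {u : R} (hu : u ∈ N * Ideal.span (f '' s) ^ k) :
    ∃ F, IsForm s k N F ∧ eval f F = u := by
  induction k generalizing u with
  | zero =>
    rw [pow_zero, mul_one] at hu
    refine ⟨C u, ⟨isHomogeneous_C _ _, fun α => ?_, fun α h => ?_⟩, eval_C _⟩
    · rw [coeff_C]
      split_ifs
      · exact hu
      · exact zero_mem _
    · rw [coeff_C] at h
      split_ifs at h with h0
      · rw [← h0]; simp
      · exact (h rfl).elim
  | succ k ih =>
    rw [pow_succ, ← mul_assoc] at hu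
    refine Submodule.mul_induction_on hu (fun v hv w hw => ?_) ?_
    · obtain ⟨F, hF, rfl⟩ := ih hv
      induction hw using Submodule.span_induction with
      | mem x hx =>
        obtain ⟨i, hi, rfl⟩ := hx
        exact ⟨X i * F, hF.X_mul hi, by rw [map_mul, eval_X, mul_comm]⟩
      | zero => exact ⟨0, isForm_zero, by rw [mul_zero, map_zero]⟩
      | add x y _ _ hx hy =>
        obtain ⟨A, hA, hA'⟩ := hx
        obtain ⟨B, hB, hB'⟩ := hy
        exact ⟨A + B, hA.add hB, by rw [map_add, hA', hB', mul_add]⟩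
      | smul a x _ hx =>
        obtain ⟨A, hA, hA'⟩ := hx
        exact ⟨C a * A, hA.C_mul a, by rw [map_mul, eval_C, hA', smul_eq_mul, mul_left_comm]⟩
    · rintro _ _ ⟨A, hA, rfl⟩ ⟨B, hB, rfl⟩
      exact ⟨A + B, hA.add hB, map_add _ _ _⟩

/-- A finite family is quasi-regular: a form of degree `k` whose value lies in the
`(k + 1)`-st power has its coefficients in the ideal. -/
def IsQuasiRegular (f : ι → R) (s : Finset ι) : Prop :=
  ∀ k F, IsForm s k ⊤ F → eval f F ∈ Ideal.span (f '' s) ^ (k + 1) →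
    ∀ α, coeff α F ∈ Ideal.span (f '' s)

/-- A form with value in the next power can be corrected, by a form with coefficients in the ideal,
to have value zero; so genuine relations suffice. -/
lemma coeff_mem_of_eval_eq_zero
    (h : ∀ F, IsForm s k ⊤ F → eval f F = 0 → ∀ α, coeff α F ∈ Ideal.span (f '' s))
    (hF : IsForm s k ⊤ F) (hFe : eval f F ∈ Ideal.span (f '' s) ^ (k + 1)) (α : ι →₀ ℕ) :
    coeff α F ∈ Ideal.span (f '' s) := by
  rw [pow_succ'] at hFe
  obtain ⟨G, hG, hGe⟩ := exists_isForm hFe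
  have h1 := h (F + C (-1) * G) (hF.add ((hG.mono le_top subset_rfl).C_mul _))
    (by rw [map_add, map_mul, eval_C, hGe]; ring) α
  rw [coeff_add, coeff_C_mul] at h1
  have h2 := add_mem h1 (hG.coeff_mem α)
  rwa [neg_one_mul, neg_add_cancel_right] at h2

/-- Coefficients of forms are well defined modulo the ideal, so an element regular modulo the ideal
is regular on every layer of the power filtration. -/
lemma IsQuasiRegular.mem_pow_of_mul_mem (hs : IsQuasiRegular f s) {h : R}
    (hh : ∀ u, h * u ∈ Ideal.span (f '' s) → u ∈ Ideal.span (f '' s)) (k : ℕ) {u : R}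
    (hu : h * u ∈ Ideal.span (f '' s) ^ k) : u ∈ Ideal.span (f '' s) ^ k := by
  induction k with
  | zero => simp
  | succ k ih =>
    have h1 := ih (Ideal.pow_le_pow_right (Nat.le_succ k) hu)
    rw [← Ideal.top_mul (Ideal.span (f '' s) ^ k)] at h1
    obtain ⟨F, hF, rfl⟩ := exists_isForm h1
    have h2 := hs k (C h * F) (hF.C_mul h) (by rwa [map_mul, eval_C])
    rw [pow_succ']
    refine IsForm.eval_mem ⟨hF.homog, fun α => hh _ ?_, hF.supp⟩
    rw [← coeff_C_mul]
    exact h2 α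

/-- Induction on the family, then on the degree. In `F = X_e H + G` with `G` free of `X_e`,
regularity of `f e` puts the value of `H` into a power of the smaller ideal. Then `H` is settled by
the degree, and `G`, corrected by `f e` times a form with the same value as `H`, by the smaller
family. -/
lemma isQuasiRegular_of_regular (s : Finset ι)
    (h : ∀ t ⊆ s, ∀ e ∈ s, e ∉ t → ∀ u, f e * u ∈ Ideal.span (f '' t) → u ∈ Ideal.span (f '' t)) :
    IsQuasiRegular f s := by
  induction s using Finset.induction_on with
  | empty =>
    intro k F hF
    refine coeff_mem_of_eval_eq_zero (fun F hF hFe α => ?_) hF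
    by_contra hα
    have hα0 : coeff α F ≠ 0 := fun h => hα (by rw [h]; exact zero_mem _)
    have hsupp := fun β hβ => Finsupp.support_eq_empty.1 (Finset.subset_empty.1 (hF.supp β hβ))
    have hFC : F = C (coeff 0 F) := by
      ext β
      rw [coeff_C]
      split_ifs with h0
      · rw [h0]
      · by_contra hne
        exact h0 (hsupp β hne).symm
    rw [hFC, eval_C] at hFe
    rw [hsupp α hα0] at hα0
    exact hα0 hFe
  | insert e s he ih =>
    have ihs := ih fun t ht e he => h t (ht.trans (Finset.subset_insert _ _)) e
      (Finset.mem_insert_of_mem he)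
    have hreg : ∀ u, f e * u ∈ Ideal.span (f '' s) → u ∈ Ideal.span (f '' s) :=
      h s (Finset.subset_insert _ _) e (Finset.mem_insert_self _ _) he
    have hle : Ideal.span (f '' s) ≤ Ideal.span (f '' (insert e s : Finset ι)) :=
      Ideal.span_mono (Set.image_mono (by simp))
    have hfe : f e ∈ Ideal.span (f '' (insert e s : Finset ι)) :=
      Ideal.subset_span ⟨e, by simp, rfl⟩
    have key : ∀ k F, IsForm (insert e s) k ⊤ F → eval f F = 0 →
        ∀ α, coeff α F ∈ Ideal.span (f '' (insert e s : Finset ι)) := by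
      intro k
      induction k with
      | zero =>
        intro F hF hFe α
        have hFC : F = C (coeff 0 F) := by
          rw [← homogeneousComponent_zero]
          exact (homogeneousComponent_eq_self hF.homog).symm
        rw [hFC, eval_C] at hFe
        rw [hFC, hFe, C_0, coeff_zero]
        exact zero_mem _
      | succ k ihk =>
        intro F hF hFe
        set H := F.divMonomial (Finsupp.single e 1) with hH
        set G := F.modMonomial (Finsupp.single e 1) with hG
        have hFHG : X e * H + G = F := divMonomial_add_modMonomial_single F e
        have hHf : IsForm (insert e s) k ⊤ H := by
          refine ⟨fun α hα => ?_, fun _ => trivial, fun α hα => ?_⟩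
          · rw [hH, coeff_divMonomial] at hα
            have := hF.homog hα
            rw [map_add, Finsupp.weight_single] at this
            simp at this
            omega
          · rw [hH, coeff_divMonomial] at hα
            refine Finset.Subset.trans (fun i hi => ?_) (hF.supp _ hα)
            rw [Finsupp.mem_support_iff] at hi ⊢
            rw [Finsupp.add_apply]; omega
        have hGf : IsForm s (k + 1) ⊤ G := by
          have hα' : ∀ α, coeff α G ≠ 0 → ¬ Finsupp.single e 1 ≤ α ∧ coeff α F ≠ 0 := by
            intro α hα
            by_cases hle : Finsupp.single e 1 ≤ α
            · rw [hG, coeff_modMonomial_of_le _ hle] at hα; exact (hα rfl).elim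
            · rw [hG, coeff_modMonomial_of_not_le _ hle] at hα; exact ⟨hle, hα⟩
          refine ⟨fun α hα => hF.homog (hα' α hα).2, fun _ => trivial, fun α hα i hi => ?_⟩
          obtain ⟨h1, h2⟩ := hα' α hα
          rcases Finset.mem_insert.1 (hF.supp α h2 hi) with rfl | h3
          · refine (h1 ?_).elim
            rw [Finsupp.single_le_iff]
            exact Nat.one_le_iff_ne_zero.2 (Finsupp.mem_support_iff.1 hi)
          · exact h3
        rw [← hFHG, map_add, map_mul, eval_X] at hFe
        have hH1 : eval f H ∈ Ideal.span (f '' s) ^ (k + 1) := by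
          refine ihs.mem_pow_of_mul_mem hreg _ ?_
          rw [eq_neg_of_add_eq_zero_left hFe]
          have := hGf.eval_mem (f := f)
          rw [Ideal.top_mul] at this
          exact neg_mem this
        have hHc := coeff_mem_of_eval_eq_zero ihk hHf (Ideal.pow_right_mono hle _ hH1)
        have hH2 := hH1
        rw [← Ideal.top_mul (Ideal.span (f '' s) ^ (k + 1))] at hH2
        obtain ⟨h', hh', hhe⟩ := exists_isForm hH2
        have hGc := ihs (k + 1) (G + C (f e) * h') (hGf.add (hh'.C_mul _)) (by
          rw [map_add, map_mul, eval_C, hhe, add_comm (eval f G), hFe]; exact zero_mem _)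
        intro α
        rw [← hFHG, coeff_add]
        refine add_mem ?_ ?_
        · rw [coeff_X_mul']
          split_ifs
          · exact hHc _
          · exact zero_mem _
        · have h1 := hle (hGc α)
          rw [coeff_add, coeff_C_mul] at h1
          have := sub_mem h1 (Ideal.mul_mem_right (coeff α h') _ hfe)
          rwa [add_sub_cancel_right] at this
    exact fun k F hF hFe => coeff_mem_of_eval_eq_zero (key k) hF hFe

end QuasiRegular

/-! ### Intersections of powers of `I + (g)` with colon ideals. -/

section Powers

variable {R : Type*} [CommRing R] {I J : Ideal R} {g : R}

lemma sup_span_pow_succ_le (I : Ideal R) (g : R) (k : ℕ) :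
    (I ⊔ Ideal.span {g}) ^ (k + 1) ≤
      I ^ (k + 1) ⊔ Ideal.span {g} * (I ⊔ Ideal.span {g}) ^ k := by
  induction k with
  | zero => simp
  | succ k ih =>
    conv_lhs => rw [pow_succ', Ideal.sup_mul]
    refine sup_le ?_ le_sup_right
    refine (Ideal.mul_mono_right ih).trans ?_
    rw [Ideal.mul_sup, ← pow_succ', mul_left_comm]
    refine sup_le_sup_left (Ideal.mul_mono_right ?_) _
    rw [pow_succ']
    exact Ideal.mul_mono_left le_sup_left

lemma sup_span_pow_succ_le' (I : Ideal R) (g : R) (k : ℕ) :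
    (I ⊔ Ideal.span {g}) ^ (k + 1) ≤
      I * (I ⊔ Ideal.span {g}) ^ k ⊔ Ideal.span {g ^ (k + 1)} := by
  induction k with
  | zero => simp
  | succ k ih =>
    conv_lhs => rw [pow_succ', Ideal.sup_mul]
    refine sup_le le_sup_left ?_
    refine (Ideal.mul_mono_right ih).trans ?_
    rw [Ideal.mul_sup, mul_left_comm, Ideal.span_singleton_mul_span_singleton, ← pow_succ']
    refine sup_le_sup_right (Ideal.mul_mono_right ?_) _
    rw [pow_succ']
    exact Ideal.mul_mono_left le_sup_right

/-- If `g²u ∈ I` implies `gu ∈ I` then `(I : g) ∩ J ^ (m + 1) ⊆ I J ^ m`, where `J = I + (g)`. -/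
lemma quotBy_inf_pow_le (hg : ∀ u, g * u ∈ quotBy I g → u ∈ quotBy I g) (m : ℕ) :
    quotBy I g ⊓ (I ⊔ Ideal.span {g}) ^ (m + 1) ≤ (I ⊔ Ideal.span {g}) ^ m * I := by
  rintro u ⟨hu, huJ⟩
  -- Modulo `I J ^ m`, which lies in `I : g`, the element is `g ^ (m + 1) t`. The hypothesis cancels
  -- the powers of `g`, so `g t ∈ I`.
  obtain ⟨v, hv, w, hw, rfl⟩ := Submodule.mem_sup.1 (sup_span_pow_succ_le' I g m huJ)
  obtain ⟨t, rfl⟩ := Ideal.mem_span_singleton'.1 hw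
  have hvI : v ∈ quotBy I g := le_quotBy I g (Ideal.mul_le_right (mul_comm I _ ▸ hv))
  have h1 : g ^ (m + 1) * t ∈ quotBy I g := by
    have h := Ideal.sub_mem _ hu hvI
    rwa [add_sub_cancel_left, mul_comm] at h
  rw [mul_comm I] at hv
  refine Ideal.add_mem _ hv ?_
  have h2 : t ∈ quotBy I g := by
    have : ∀ k, g ^ k * t ∈ quotBy I g → t ∈ quotBy I g := by
      intro k
      induction k with
      | zero => simp
      | succ k ih => exact fun h => ih (hg _ (by rwa [pow_succ', mul_assoc] at h))
    exact this _ h1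
  have h3 : t * g ^ (m + 1) = g ^ m * (g * t) := by ring
  rw [h3]
  exact Ideal.mul_mem_mul
    (Ideal.pow_mem_pow (Ideal.mem_sup_right (Ideal.mem_span_singleton_self g)) m) h2

variable {ι : Type*} [DecidableEq ι] {f : ι → R} {s : Finset ι}

/-- Quasi-regularity applied to `g` times a form for `u` puts each coefficient into `I : g`, while
it remains in `N`. -/
lemma IsQuasiRegular.mem_mul_pow (hs : IsQuasiRegular f s) {N : Ideal R} {k : ℕ} {u g : R}
    (hu : u ∈ N * Ideal.span (f '' s) ^ k) (hgu : g * u ∈ Ideal.span (f '' s) ^ (k + 1)) :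
    u ∈ (quotBy (Ideal.span (f '' s)) g ⊓ N) * Ideal.span (f '' s) ^ k := by
  obtain ⟨F, hF, rfl⟩ := exists_isForm hu
  refine IsForm.eval_mem ⟨hF.homog, fun α => ⟨?_, hF.coeff_mem α⟩, hF.supp⟩
  have := hs k (C g * F) ((hF.mono le_top subset_rfl).C_mul g) (by rwa [map_mul, eval_C]) α
  rwa [coeff_C_mul] at this

/-- `J ^ k ∩ (I ^ (k + 1) : g) ⊆ (I : g) I ^ k` for `J = I + (g)`. -/
lemma IsQuasiRegular.mem_quotBy_mul_pow (hs : IsQuasiRegular f s)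
    (hg : ∀ u, g * u ∈ quotBy (Ideal.span (f '' s)) g → u ∈ quotBy (Ideal.span (f '' s)) g)
    (k : ℕ) {u : R} (hu : u ∈ (Ideal.span (f '' s) ⊔ Ideal.span {g}) ^ k)
    (hgu : g * u ∈ Ideal.span (f '' s) ^ (k + 1)) :
    u ∈ quotBy (Ideal.span (f '' s)) g * Ideal.span (f '' s) ^ k := by
  -- The factors `J` are traded for `I` one at a time: the coefficients lie in `(I : g) ∩ J ^ (j +
  -- 1)`, hence in `J ^ j I`.
  have key : ∀ i j, i + j = k →
      u ∈ (Ideal.span (f '' s) ⊔ Ideal.span {g}) ^ j * Ideal.span (f '' s) ^ i := by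
    intro i
    induction i with
    | zero => rintro j rfl; simpa using hu
    | succ i ih =>
      intro j hij
      have h1 := hs.mem_mul_pow (ih (j + 1) (by omega))
        (Ideal.pow_le_pow_right (by omega) hgu)
      rw [pow_succ', ← mul_assoc]
      exact Ideal.mul_mono_left (quotBy_inf_pow_le hg j) h1
  exact Ideal.mul_mono_left inf_le_left (hs.mem_mul_pow (key k 0 rfl) hgu)

end Powers

/-! ### Powers of complete and almost complete intersections of quadrics. -/

section Families

variable {K : Type*} [Field K] {σ : Type*} [LinearOrder σ] [Fintype σ]
  {ι : Type*} [DecidableEq ι]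

/-- A permutable regular sequence of quadrics. -/
structure IsRegularFamily (f : ι → MvPolynomial σ K) (E : Finset ι) : Prop where
  homog : ∀ e ∈ E, (f e).IsHomogeneous 2
  reg : ∀ t ⊆ E, ∀ e ∈ E, e ∉ t → ∀ u, f e * u ∈ Ideal.span (f '' t) → u ∈ Ideal.span (f '' t)

variable {f : ι → MvPolynomial σ K} {E : Finset ι}

lemma IsRegularFamily.mono (h : IsRegularFamily f E) {t : Finset ι} (ht : t ⊆ E) :
    IsRegularFamily f t :=
  ⟨fun e he => h.homog e (ht he), fun t' ht' e he => h.reg t' (ht'.trans ht) e (ht he)⟩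

lemma IsRegularFamily.isHomog (h : IsRegularFamily f E) : IsHomog (Ideal.span (f '' E)) := by
  refine isHomog_span ?_
  rintro _ ⟨e, he, rfl⟩
  exact ⟨2, h.homog e he⟩

lemma span_image_insert (f : ι → MvPolynomial σ K) (e : ι) (E : Finset ι) :
    Ideal.span (f '' (insert e E : Finset ι)) = Ideal.span (f '' E) ⊔ Ideal.span {f e} := by
  rw [← Ideal.span_union, Finset.coe_insert, Set.image_insert_eq, Set.union_singleton]

lemma IsRegularFamily.regLT (h : IsRegularFamily f E) :
    RegLT ⊤ (Ideal.span (f '' E)) (E.card + 1) := by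
  induction E using Finset.induction_on with
  | empty => simpa using regLT_top_bot
  | insert e E he ih =>
    have h' := h.mono (Finset.subset_insert e E)
    rw [span_image_insert, Finset.card_insert_of_notMem he]
    exact RegLT.sup_span_singleton (k := 1) (h.homog e (Finset.mem_insert_self _ _)) h'.isHomog
      (h.reg E (Finset.subset_insert _ _) e (Finset.mem_insert_self _ _) he) (ih h')

lemma IsRegularFamily.isQuasiRegular (h : IsRegularFamily f E) : IsQuasiRegular f E :=
  isQuasiRegular_of_regular E h.reg

/-- An operator of left multiplication by a one-form with boundary `f`. -/
structure IsLift (f : MvPolynomial σ K)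
    (z : Chain K σ →ₗ[MvPolynomial σ K] Chain K σ) : Prop where
  del_apply : ∀ c, del (z c) = f • c - z (del c)
  mem : ∀ A c, c ∈ chainsIn A → z c ∈ chainsIn A
  homog : ∀ δ c, IsHomogChain δ c → IsHomogChain (δ + 1) (z c)

/-- The product of the one-forms in a list. -/
def prodLift (z : ι → Chain K σ →ₗ[MvPolynomial σ K] Chain K σ) : List ι → Chain K σ
  | [] => unit
  | e :: l => z e (prodLift z l)

variable {z : ι → Chain K σ →ₗ[MvPolynomial σ K] Chain K σ}

/-- The Koszul homology of a complete intersection of quadrics in the top degree is generated by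
the product of the one-forms. -/
lemma IsRegularFamily.exists_of_top {l : List ι} (hl : l.Nodup)
    (h : IsRegularFamily f l.toFinset) (hz : ∀ e ∈ l, IsLift (f e) (z e)) {c : Chain K σ}
    (hc : IsHomogChain l.length c) (hdc : del c ∈ chainsIn (Ideal.span (f '' l.toFinset))) :
    ∃ (d : Chain K σ) (β : MvPolynomial σ K),
      c - del d - β • prodLift z l ∈ chainsIn (Ideal.span (f '' l.toFinset)) := by
  induction l generalizing c with
  | nil =>
    have : del c = 0 := by simpa [mem_chainsIn_bot] using hdc
    obtain ⟨β, hβ⟩ := exists_eq_smul_unit hc this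
    refine ⟨0, β, ?_⟩
    rw [map_zero, sub_zero, prodLift, hβ, sub_self]
    exact zero_mem _
  | cons e l ih =>
    obtain ⟨hel, hl⟩ := List.nodup_cons.1 hl
    have hze := hz e (by simp)
    rw [List.toFinset_cons] at h hdc ⊢
    have h' := h.mono (Finset.subset_insert e l.toFinset)
    have hfe := h.homog e (Finset.mem_insert_self _ _)
    rw [span_image_insert] at hdc ⊢
    set I := Ideal.span (f '' (l.toFinset : Set ι)) with hI
    -- In `∂c = a + f_e b`, regularity makes `b` a cycle modulo the smaller ideal, in its top
    -- degree, so induction applies to `b`. Then `c - z_e b` is a cycle modulo that ideal in a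
    -- degree above its regularity, hence a boundary.
    obtain ⟨a, ha, b, hb, hab⟩ := exists_of_mem_chainsIn_sup hdc
    obtain ⟨b, rfl⟩ := exists_of_mem_chainsIn_span hb
    have hab' : del c = comp (l.length + 2) a + f e • comp l.length b := by
      rw [← comp_smul _ hfe, ← comp_add, ← hab]
      exact (hc.del.comp_eq).symm
    have ha' := comp_mem_chainsIn h'.isHomog ha (l.length + 2)
    have hbδ := isHomogChain_comp l.length b
    generalize comp (l.length + 2) a = a' at hab' ha'
    generalize comp l.length b = b' at hab' hbδ
    have hdb : del b' ∈ chainsIn I := by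
      have h1 := congrArg del hab'
      rw [del_del, map_add, map_smul] at h1
      have h2 : f e • del b' ∈ chainsIn I := by
        rw [← neg_eq_of_add_eq_zero_right h1.symm]
        exact neg_mem (del_mem_chainsIn ha')
      exact mem_chainsIn.2 fun T => h.reg _ (Finset.subset_insert _ _) e
        (Finset.mem_insert_self _ _) (by simpa using hel) _ (mem_chainsIn.1 h2 T)
    obtain ⟨d, β, hd⟩ := ih hl h' (fun i hi => hz i (by simp [hi])) hbδ hdb
    have hcard : l.toFinset.card = l.length :=
  List.toFinset_card_of_nodup hl
    obtain ⟨d', -, hd'⟩ := h'.regLT (l.length + 1) (by omega) (c - z e b') (mem_chainsIn_top _)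
      (hc.sub (hze.homog _ _ hbδ)) (by
        rw [map_sub, hze.del_apply, hab', sub_sub_eq_add_sub, add_right_comm, add_sub_cancel_right]
        exact add_mem ha' (hze.mem _ _ hdb))
    refine ⟨d' - z e d, β, ?_⟩
    have h1 := hze.mem _ _ hd
    have h2 : f e • d ∈ chainsIn (Ideal.span {f e}) :=
      smul_mem_chainsIn _ (Ideal.mem_span_singleton_self _)
    have e1 : c - del (d' - z e d) - β • prodLift z (e :: l) =
        (c - z e b' - del d' + z e (b' - del d - β • prodLift z l)) + f e • d := by
      rw [map_sub, hze.del_apply, prodLift, map_sub, map_sub, map_smul]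
      abel
    rw [e1]
    exact add_mem (chainsIn_mono le_sup_left (add_mem hd' h1)) (chainsIn_mono le_sup_right h2)

/-- `I^k ⧸ N I^k` is a sum of copies of `S ⧸ N` indexed by the monomials of degree `k` in the
generators; quasi-regularity makes each coefficient chain a cycle modulo `N`. -/
lemma IsRegularFamily.exists_layers (h : IsRegularFamily f E) {N : Ideal (MvPolynomial σ K)}
    (hN : Ideal.span (f '' E) ≤ N) {k δ : ℕ} {c : Chain K σ}
    (hc : c ∈ chainsIn (Ideal.span (f '' E) ^ k)) (hcδ : IsHomogChain (δ + 2 * k) c)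
    (hdc : del c ∈ chainsIn (N * Ideal.span (f '' E) ^ k)) :
    ∃ (A : Finset (ι →₀ ℕ)) (m : (ι →₀ ℕ) → MvPolynomial σ K) (cc : (ι →₀ ℕ) → Chain K σ),
      (∀ α ∈ A, m α ∈ Ideal.span (f '' E) ^ k) ∧
      (∀ α ∈ A, IsHomogChain δ (cc α) ∧ del (cc α) ∈ chainsIn N) ∧
      c = ∑ α ∈ A, m α • cc α := by
  classical
  have hc' : ∀ T, c T ∈ ⊤ * Ideal.span (f '' E) ^ k := fun T => by
    rw [Ideal.top_mul]; exact mem_chainsIn.1 hc T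
  choose F hF hFe using fun T => exists_isForm (hc' T)
  let m : (ι →₀ ℕ) → MvPolynomial σ K := fun α => eval f (monomial α 1)
  let A : Finset (ι →₀ ℕ) := Finset.univ.biUnion fun T => (F T).support
  have hA : ∀ α ∈ A, (∑ i ∈ α.support, α i = k) ∧ α.support ⊆ E := by
    intro α hα
    obtain ⟨T, -, hT⟩ := Finset.mem_biUnion.1 hα
    have hα' := mem_support_iff.1 hT
    refine ⟨?_, (hF T).supp α hα'⟩
    have h1 := (hF T).homog hα'
    rw [Finsupp.weight_apply, Finsupp.sum] at h1
    simpa using h1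
  have hmeq : ∀ α, m α = ∏ i ∈ α.support, f i ^ α i := fun α => by
    simp [m, eval_monomial, Finsupp.prod]
  have hm2 : ∀ α ∈ A, (m α).IsHomogeneous (2 * k) := by
    intro α hα
    obtain ⟨hs, hE⟩ := hA α hα
    rw [hmeq, ← hs, Finset.mul_sum]
    exact IsHomogeneous.prod _ _ _ fun i hi => (h.homog i (hE hi)).pow _
  have hmI : ∀ α ∈ A, m α ∈ Ideal.span (f '' E) ^ k := by
    intro α hα
    obtain ⟨hs, hE⟩ := hA α hα
    rw [hmeq, ← hs, ← Finset.prod_pow_eq_pow_sum]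
    refine Ideal.prod_mem_prod fun i hi => Ideal.pow_mem_pow (Ideal.subset_span ?_) _
    exact ⟨i, hE hi, rfl⟩
  have hsum : ∀ T, c T = ∑ α ∈ A, m α * coeff α (F T) := by
    intro T
    rw [← hFe T, eval_eq]
    have hsub : (F T).support ⊆ A := fun α hα =>
      Finset.mem_biUnion.2 ⟨T, Finset.mem_univ _, hα⟩
    rw [Finset.sum_subset hsub fun α _ hα => by rw [notMem_support_iff.1 hα, zero_mul]]
    exact Finset.sum_congr rfl fun α _ => by rw [hmeq, mul_comm]
  let cc : (ι →₀ ℕ) → Chain K σ := fun α => comp δ fun T => coeff α (F T)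
  have hcc : c = ∑ α ∈ A, m α • cc α := by
    funext T
    rw [← hcδ.comp_eq, Finset.sum_apply]
    simp only [comp, Pi.smul_apply, smul_eq_mul, cc]
    rw [hsum T, map_sum]
    exact Finset.sum_congr rfl fun α hα => homogeneousComponent_mul_of_isHomogeneous (hm2 α hα) _ _
  refine ⟨A, m, cc, hmI, fun α hα => ⟨isHomogChain_comp _ _, mem_chainsIn.2 fun B => ?_⟩, hcc⟩
  -- A form with coefficients `∂ (cc β) B` and value `∂c B`, to be compared with a form with
  -- coefficients in `N` having the same value.
  let G : MvPolynomial ι (MvPolynomial σ K) := ∑ β ∈ A, monomial β (del (cc β) B)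
  have hGc : coeff α G = del (cc α) B := by
    rw [coeff_sum, Finset.sum_eq_single α]
    · rw [coeff_monomial, if_pos rfl]
    · intro β _ hβ; rw [coeff_monomial, if_neg hβ]
    · intro h; exact (h hα).elim
  have hGf : IsForm E k ⊤ G := by
    refine ⟨?_, fun _ => trivial, fun β hβ => ?_⟩
    · refine IsHomogeneous.sum _ _ _ fun β hβ => isHomogeneous_monomial _ ?_
      rw [← (hA β hβ).1, Finsupp.degree]; rfl
    · by_cases hβA : β ∈ A
      · exact (hA β hβA).2
      · refine (hβ ?_).elim
        rw [coeff_sum]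
        refine Finset.sum_eq_zero fun γ hγ => ?_
        rw [coeff_monomial, if_neg]
        rintro rfl; exact hβA hγ
  have hGe : eval f G = del c B := by
    conv_rhs => rw [hcc]
    rw [map_sum, map_sum, Finset.sum_apply]
    refine Finset.sum_congr rfl fun β _ => ?_
    rw [map_smul, Pi.smul_apply, smul_eq_mul, hmeq, eval_monomial, Finsupp.prod, mul_comm]
  have h1 := mem_chainsIn.1 hdc B
  obtain ⟨H, hH, hHe⟩ := exists_isForm h1
  have h2 := h.isQuasiRegular k (G + C (-1) * H)
    (hGf.add ((hH.mono le_top subset_rfl).C_mul _)) (by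
      rw [map_add, map_mul, eval_C, hGe, hHe, neg_one_mul, add_neg_cancel]; exact zero_mem _) α
  rw [coeff_add, coeff_C_mul, hGc] at h2
  have h3 := add_mem (hN h2) (hH.coeff_mem α)
  rwa [neg_one_mul, neg_add_cancel_right] at h3

lemma IsRegularFamily.regLT_layer (h : IsRegularFamily f E) {N : Ideal (MvPolynomial σ K)}
    (hN : Ideal.span (f '' E) ≤ N) {r : ℕ} (hr : RegLT ⊤ N r) (k : ℕ) :
    RegLT (Ideal.span (f '' E) ^ k) (N * Ideal.span (f '' E) ^ k) (r + 2 * k) := by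
  intro δ hδ c hc hcδ hdc
  obtain ⟨δ, rfl⟩ : ∃ δ', δ = δ' + 2 * k := ⟨δ - 2 * k, by omega⟩
  obtain ⟨A, m, cc, hm, hcc, rfl⟩ := h.exists_layers hN hc hcδ hdc
  have : ∀ α, ∃ d : Chain K σ, α ∈ A → cc α - del d ∈ chainsIn N := by
    intro α
    by_cases hα : α ∈ A
    · obtain ⟨d, -, hd⟩ := hr δ (by omega) (cc α) (mem_chainsIn_top _) (hcc α hα).1 (hcc α hα).2
      exact ⟨d, fun _ => hd⟩
    · exact ⟨0, fun h => (hα h).elim⟩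
  choose d hd using this
  refine ⟨∑ α ∈ A, m α • d α, sum_mem fun α hα => smul_mem_chainsIn _ (hm α hα), ?_⟩
  rw [map_sum, ← Finset.sum_sub_distrib]
  refine sum_mem fun α hα => ?_
  rw [map_smul, ← smul_sub, mul_comm]
  exact smul_mem_chainsIn_mul (hm α hα) (hd α hα)

/-- The layer `I^k ⧸ I^(k+1)` has regularity at most `#E + 2k`. At `k = 0` the quotient `S ⧸ I^0` is
zero, so any bound holds. -/
lemma IsRegularFamily.regLT_pow (h : IsRegularFamily f E) (k : ℕ) :
    RegLT ⊤ (Ideal.span (f '' E) ^ k) (2 * k + E.card - 1) := by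
  induction k with
  | zero => rw [pow_zero, Ideal.one_eq_top]; exact regLT_self _ _
  | succ k ih =>
    refine RegLT.ext (M := Ideal.span (f '' E) ^ k) (ih.mono (by omega)) ?_ isHomog_top
      (h.isHomog.pow k) (Ideal.pow_le_pow_right (Nat.le_succ k)) le_top
    rw [pow_succ']
    exact (h.regLT_layer le_rfl h.regLT k).mono (by omega)

/-- The degree exceeds the regularity of `S ⧸ I^k`, so the cycle moves into `I^k`; there its layer
coefficients are top-degree cycles modulo `I`. -/
lemma IsRegularFamily.exists_of_top_pow {l : List ι} (hl : l.Nodup)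
    (h : IsRegularFamily f l.toFinset) (hz : ∀ e ∈ l, IsLift (f e) (z e)) {k : ℕ}
    {b : Chain K σ} (hb : IsHomogChain (l.length + 2 * k) b)
    (hdb : del b ∈ chainsIn (Ideal.span (f '' l.toFinset) ^ (k + 1))) :
    ∃ d : Chain K σ, ∃ q ∈ Ideal.span (f '' l.toFinset) ^ k,
      b - del d - q • prodLift z l ∈ chainsIn (Ideal.span (f '' l.toFinset) ^ (k + 1)) := by
  set I := Ideal.span (f '' (l.toFinset : Set ι)) with hI
  have hle : I ^ (k + 1) ≤ I ^ k := Ideal.pow_le_pow_right (Nat.le_succ k)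
  have hcard : l.toFinset.card = l.length :=
  List.toFinset_card_of_nodup hl
  obtain ⟨d, hd, hbd⟩ := h.regLT_pow k _ (by omega) b (mem_chainsIn_top _) hb
    (chainsIn_mono hle hdb)
  obtain ⟨d, -, hbd, hdδ, -⟩ := exists_homog isHomog_top (h.isHomog.pow k) hb hd hbd
  obtain ⟨A, m, cc, hm, hcc, hsum⟩ := h.exists_layers le_rfl hbd (hb.sub hdδ) (by
    rw [map_sub, del_del, sub_zero, ← pow_succ']; exact hdb)
  have : ∀ α, ∃ (d : Chain K σ) (β : MvPolynomial σ K), α ∈ A →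
      cc α - del d - β • prodLift z l ∈ chainsIn I := by
    intro α
    by_cases hα : α ∈ A
    · obtain ⟨d, β, hd⟩ := h.exists_of_top hl hz (hcc α hα).1 (hcc α hα).2
      exact ⟨d, β, fun _ => hd⟩
    · exact ⟨0, 0, fun h => (hα h).elim⟩
  choose d' β hd' using this
  refine ⟨d + ∑ α ∈ A, m α • d' α, ∑ α ∈ A, m α * β α,
    sum_mem fun α hα => Ideal.mul_mem_right _ _ (hm α hα), ?_⟩
  rw [map_add, ← sub_sub, hsum, map_sum, Finset.sum_smul, ← Finset.sum_sub_distrib,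
    ← Finset.sum_sub_distrib]
  refine sum_mem fun α hα => ?_
  rw [map_smul, mul_smul, ← smul_sub, ← smul_sub, pow_succ]
  exact smul_mem_chainsIn_mul (hm α hα) (hd' α hα)

/-- The data of an almost complete intersection `(f_e, g)` of quadrics from which the regularity
of the powers is computed. -/
structure IsAlmostCI (f : ι → MvPolynomial σ K) (l : List ι) (g : MvPolynomial σ K)
    (z : ι → Chain K σ →ₗ[MvPolynomial σ K] Chain K σ) : Prop where
  nodup : l.Nodup
  two_le : 2 ≤ l.length
  family : IsRegularFamily f l.toFinset
  lift : ∀ e ∈ l, IsLift (f e) (z e)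
  homog : g.IsHomogeneous 2
  ne_zero : g ≠ 0
  quotBy_quotBy : ∀ u, g * u ∈ quotBy (Ideal.span (f '' l.toFinset)) g →
    u ∈ quotBy (Ideal.span (f '' l.toFinset)) g
  regLT_quotBy : RegLT ⊤ (quotBy (Ideal.span (f '' l.toFinset)) g) (l.length - 1)
  exists_prodLift : ∃ d C : Chain K σ, del C ∈ chainsIn (quotBy (Ideal.span (f '' l.toFinset)) g) ∧
    prodLift z l - del d - g • C ∈ chainsIn (Ideal.span (f '' l.toFinset))

lemma exists_eq_del {δ : ℕ} (hδ : 1 ≤ δ) {c : Chain K σ} (hc : IsHomogChain δ c)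
    (hdc : del c = 0) : ∃ b, c = del b ∧ ∀ e, δ = e + 1 → IsHomogChain e b := by
  obtain ⟨d, hd, h⟩ := regLT_top_bot δ hδ c (mem_chainsIn_top _) hc
    (by rw [hdc]; exact zero_mem _)
  obtain ⟨d, -, h, -, hdδ⟩ := exists_homog isHomog_top isHomog_bot hc hd h
  rw [mem_chainsIn_bot, sub_eq_zero] at h
  exact ⟨d, h, hdδ⟩

namespace IsAlmostCI

variable {l : List ι} {g : MvPolynomial σ K}

lemma isHomog_quotBy (H : IsAlmostCI f l g z) : IsHomog (quotBy (Ideal.span (f '' l.toFinset)) g) :=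
  H.family.isHomog.quotBy H.homog

lemma card_eq (H : IsAlmostCI f l g z) : l.toFinset.card = l.length :=
  List.toFinset_card_of_nodup H.nodup

/-- Comes from the filtration `S ⊇ I^k ⊇ Q I^k` with `Q = I : g`; passing from the quotient to the
ideal costs one degree. -/
lemma regLT_quotBy_mul_pow (H : IsAlmostCI f l g z) (k : ℕ) :
    RegLT (quotBy (Ideal.span (f '' l.toFinset)) g * Ideal.span (f '' l.toFinset) ^ k) ⊥
      (2 * k + l.length) := by
  have h2 := H.two_le
  have hc := H.card_eq
  have hI := H.family.isHomog
  have h1 : RegLT ⊤ (quotBy (Ideal.span (f '' l.toFinset)) g * Ideal.span (f '' l.toFinset) ^ k)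
      (2 * k + l.length - 1) :=
    RegLT.ext (M := Ideal.span (f '' l.toFinset) ^ k)
      ((H.family.regLT_pow k).mono (by omega))
      ((H.family.regLT_layer (le_quotBy _ _) H.regLT_quotBy k).mono (by omega)) isHomog_top
      (hI.pow k) Ideal.mul_le_right le_top
  have e1 : 2 * k + l.length = 2 * k + l.length - 1 + 1 := by omega
  rw [e1]
  exact RegLT.sub (A := ⊤) (regLT_top_bot.mono (by omega)) h1 isHomog_top isHomog_bot bot_le le_top

/-- The regularity of `I^(k+1)` alone gives a bound one larger. The critical classes stem from
multiples `q Z` of the product of one-forms, and `exists_prodLift` makes them vanish modulo `g Q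
I^k`. -/
lemma regLT_pow_succ (H : IsAlmostCI f l g z) (k : ℕ) :
    RegLT (Ideal.span (f '' l.toFinset) ^ (k + 1))
      (Ideal.span {g} *
        (quotBy (Ideal.span (f '' l.toFinset)) g * Ideal.span (f '' l.toFinset) ^ k))
      (2 * k + l.length + 1) := by
  have h2 := H.two_le
  have hcard := H.card_eq
  have hfam := H.family
  have hI := H.family.isHomog
  have hQ := H.isHomog_quotBy
  have htop := fun (b : Chain K σ) => hfam.exists_of_top_pow (b := b) H.nodup H.lift (k := k)
  obtain ⟨d₀, C, hC, hZ⟩ := H.exists_prodLift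
  have hpow := hfam.regLT_pow (k + 1)
  have hQk := H.regLT_quotBy_mul_pow k
  set I := Ideal.span (f '' (l.toFinset : Set ι)) with hIdef
  have hgQ : ∀ e ∈ chainsIn (quotBy I g * I ^ k), g • e ∈ chainsIn (I ^ (k + 1)) := by
    intro e he
    refine mem_chainsIn.2 fun T => ?_
    have h1 : g * e T ∈ Ideal.span {g} * (quotBy I g * I ^ k) :=
      Ideal.mul_mem_mul (Ideal.mem_span_singleton_self g) (mem_chainsIn.1 he T)
    have h3 : Ideal.span {g} * (quotBy I g * I ^ k) ≤ I ^ (k + 1) := by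
      rw [← mul_assoc, pow_succ']
      refine Ideal.mul_mono_left (Ideal.span_singleton_mul_le_iff.2 fun u hu => hu)
    exact h3 h1
  intro δ hδ c hc hcδ hdc
  obtain ⟨δ, rfl⟩ : ∃ δ', δ = δ' + 1 := ⟨δ - 1, by omega⟩
  obtain ⟨c', hc', hcc⟩ := exists_of_mem_chainsIn_span_mul hdc
  have hcc' : del c = g • comp δ c' := by
    rw [← comp_smul δ H.homog, ← hcc]; exact (hcδ.del.comp_eq).symm
  have hcm := comp_mem_chainsIn (hQ.mul (hI.pow k)) hc' δ
  have hcδ' := isHomogChain_comp δ c'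
  generalize comp δ c' = c' at hcc' hcm hcδ'
  have hdc' : del c' = 0 := by
    have h1 := congrArg del hcc'
    rw [del_del, map_smul] at h1
    exact (smul_eq_zero.1 h1.symm).resolve_left H.ne_zero
  -- Here `∂c = g c'` with `c'` a cycle in `Q I^k`, so `c' = ∂e`. Then `c - g e` is a cycle over the
  -- polynomial ring, equal to `∂b`, and `b` is a cycle modulo `I^(k+1)`.
  obtain ⟨e, he, hce⟩ := hQk δ (by omega) c' hcm hcδ' (by rw [hdc']; exact zero_mem _)
  obtain ⟨e, he, hce, -, heδ⟩ := exists_homog (hQ.mul (hI.pow k)) isHomog_bot hcδ' he hce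
  rw [mem_chainsIn_bot, sub_eq_zero] at hce
  obtain ⟨δ, rfl⟩ : ∃ δ', δ = δ' + 1 := ⟨δ - 1, by omega⟩
  have heδ' := (heδ δ rfl).smul H.homog
  obtain ⟨b, hb, hbδ⟩ := exists_eq_del (c := c - g • e) (by omega) (hcδ.sub heδ')
    (by rw [map_sub, map_smul, hcc', hce, sub_self])
  have hbδ' := hbδ (δ + 1) rfl
  have hdb : del b ∈ chainsIn (I ^ (k + 1)) := by
    rw [← hb]; exact sub_mem hc (hgQ e he)
  have hge : g • e ∈ chainsIn (Ideal.span {g} * (quotBy I g * I ^ k)) :=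
    smul_mem_chainsIn_mul (Ideal.mem_span_singleton_self g) he
  -- In degree `ℓ + 2k` the ring `S ⧸ I^(k+1)` still has homology, and `b` is a multiple `q Z` up to
  -- boundaries. The relation `Z ≡ g C` replaces this by `g q C`, whose boundary lies in `g Q I^k`.
  -- In higher degrees `b` is a boundary.
  rcases Nat.eq_or_lt_of_le (show l.length + 2 * k ≤ δ + 1 by omega) with hδ' | hδ'
  · rw [← hδ'] at hbδ'
    obtain ⟨d, q, hq, hbd⟩ := htop b hbδ' hdb
    refine ⟨(b - del d - q • prodLift z l) + q • (prodLift z l - del d₀ - g • C), ?_, ?_⟩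
    · refine add_mem hbd ?_
      rw [pow_succ]
      exact smul_mem_chainsIn_mul hq hZ
    · have e1 : c - del ((b - del d - q • prodLift z l) + q • (prodLift z l - del d₀ - g • C)) =
          g • e + g • (q • del C) := by
        simp only [map_add, map_sub, map_smul, del_del, ← hb]
        rw [smul_comm g q]
        simp only [smul_sub, smul_zero]
        abel
      rw [e1]
      refine add_mem hge (smul_mem_chainsIn_mul (Ideal.mem_span_singleton_self g) ?_)
      rw [mul_comm]
      exact smul_mem_chainsIn_mul hq hC
  · obtain ⟨d, -, hbd⟩ := hpow (δ + 1) (by omega) b (mem_chainsIn_top _) hbδ' hdb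
    refine ⟨b - del d, hbd, ?_⟩
    rw [map_sub, del_del, sub_zero, ← hb, sub_sub_cancel]
    exact hge

/-- Induction along `0 → J^k(-2) → J^(k+1) → I^(k+1) ⧸ g Q I^k → 0`, whose exactness rests on
`IsQuasiRegular.mem_quotBy_mul_pow`. The start `s = 0` uses `2 ≤ ℓ`. -/
lemma regLT_pow_bot (H : IsAlmostCI f l g z) (s : ℕ) :
    RegLT ((Ideal.span (f '' l.toFinset) ⊔ Ideal.span {g}) ^ s) ⊥ (2 * s + l.length - 1) := by
  have h2 := H.two_le
  have hI := H.family.isHomog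
  have hQ := H.isHomog_quotBy
  induction s with
  | zero =>
    rw [pow_zero, Ideal.one_eq_top]
    exact regLT_top_bot.mono (by omega)
  | succ k ih =>
    have hk := H.regLT_pow_succ k
    have hcap := fun u => H.family.isQuasiRegular.mem_quotBy_mul_pow H.quotBy_quotBy k (u := u)
    set I := Ideal.span (f '' (l.toFinset : Set ι)) with hIdef
    set J := I ⊔ Ideal.span {g} with hJ
    have hg : IsHomog (Ideal.span {g}) := isHomog_span (by simpa using ⟨2, H.homog⟩)
    have hJh : IsHomog J := hI.sup hg
    have hIJ : ∀ m, I ^ m ≤ J ^ m := fun m => Ideal.pow_right_mono le_sup_left m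
    intro δ hδ c hc hcδ hdc
    rw [mem_chainsIn_bot] at hdc
    obtain ⟨δ, rfl⟩ : ∃ δ', δ = δ' + 2 := ⟨δ - 2, by omega⟩
    obtain ⟨c₁, hc₁, x, hx, hcc⟩ := exists_of_mem_chainsIn_sup
      (chainsIn_mono (sup_span_pow_succ_le I g k) hc)
    obtain ⟨c₂, hc₂, rfl⟩ := exists_of_mem_chainsIn_span_mul hx
    have hcc' : c = comp (δ + 2) c₁ + g • comp δ c₂ := by
      rw [← comp_smul δ H.homog, ← comp_add, ← hcc]; exact hcδ.comp_eq.symm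
    have hm₁ := comp_mem_chainsIn (hI.pow (k + 1)) hc₁ (δ + 2)
    have hm₂ := comp_mem_chainsIn (hJh.pow k) hc₂ δ
    have hh₁ := isHomogChain_comp (δ + 2) c₁
    have hh₂ := isHomogChain_comp δ c₂
    generalize comp (δ + 2) c₁ = c₁ at hcc' hm₁ hh₁
    generalize comp δ c₂ = c₂ at hcc' hm₂ hh₂
    have hd : del c₁ = - (g • del c₂) := by
      rw [hcc', map_add, map_smul] at hdc
      exact eq_neg_of_add_eq_zero_left hdc
    have hd₂ : del c₂ ∈ chainsIn (quotBy I g * I ^ k) := by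
      refine mem_chainsIn.2 fun T => hcap _ (mem_chainsIn.1 (del_mem_chainsIn hm₂) T) ?_
      have h1 := mem_chainsIn.1 (neg_mem (del_mem_chainsIn hm₁)) T
      rwa [hd, neg_neg] at h1
    have hgI : IsHomog (Ideal.span {g} * (quotBy I g * I ^ k)) := hg.mul (hQ.mul (hI.pow k))
    obtain ⟨d₁, hd₁, h₁⟩ := hk (δ + 2) (by omega) c₁ hm₁ hh₁ (by
      rw [hd]
      exact neg_mem (smul_mem_chainsIn_mul (Ideal.mem_span_singleton_self g) hd₂))
    obtain ⟨d₁, hd₁, h₁, hdδ₁, -⟩ := exists_homog (hI.pow (k + 1)) hgI hh₁ hd₁ h₁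
    obtain ⟨e, he, hge⟩ := exists_of_mem_chainsIn_span_mul h₁
    have hge' : c₁ - del d₁ = g • comp δ e := by
      rw [← comp_smul δ H.homog, ← hge]
      exact (hh₁.sub hdδ₁).comp_eq.symm
    have hme := comp_mem_chainsIn (hQ.mul (hI.pow k)) he δ
    have hhe := isHomogChain_comp δ e
    generalize comp δ e = e at hge' hme hhe
    have hw : c - del d₁ = g • (e + c₂) := by
      rw [hcc', smul_add, ← hge']; abel
    have hdw : del (e + c₂) = 0 := by
      have h1 := congrArg del hw
      rw [map_sub, del_del, sub_zero, hdc, map_smul] at h1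
      exact (smul_eq_zero.1 h1.symm).resolve_left H.ne_zero
    obtain ⟨d₂, hd₂, h₂⟩ := ih δ (by omega) (e + c₂)
      (add_mem (chainsIn_mono (Ideal.mul_le_right.trans (hIJ k)) hme) hm₂) (hhe.add hh₂)
      (by rw [hdw]; exact zero_mem _)
    rw [mem_chainsIn_bot, sub_eq_zero] at h₂
    refine ⟨d₁ + g • d₂, add_mem (chainsIn_mono (hIJ _) hd₁) ?_, ?_⟩
    · rw [pow_succ']
      exact smul_mem_chainsIn_mul (Ideal.mem_sup_right (Ideal.mem_span_singleton_self g)) hd₂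
    · rw [map_add, map_smul, ← sub_sub, hw, h₂, sub_self]
      exact zero_mem _

/-- The powers of the almost complete intersection `(f_e, g)`. -/
theorem regLT_pow (H : IsAlmostCI f l g z) {s : ℕ} (hs : 1 ≤ s) :
    RegLT ⊤ ((Ideal.span (f '' l.toFinset) ⊔ Ideal.span {g}) ^ s) (2 * s + l.length - 2) := by
  have h2 := H.two_le
  have hg : IsHomog (Ideal.span {g}) := isHomog_span (by simpa using ⟨2, H.homog⟩)
  refine RegLT.quot (B := ⊥) (regLT_top_bot.mono (by omega)) ((H.regLT_pow_bot s).mono (by omega))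
    ((H.family.isHomog.sup hg).pow s) isHomog_bot bot_le le_top

end IsAlmostCI

end Families

/-! ### One-forms lifting the binomials, and the top Koszul class of a path. -/

section Lifts

variable {K : Type*} [Field K] {σ : Type*} [LinearOrder σ] [Fintype σ]

lemma IsHomogChain.wedge {δ : ℕ} {c : Chain K σ} (hc : IsHomogChain δ c) (v : σ) :
    IsHomogChain δ (wedge v c) := by
  intro T
  rw [wedge_apply]
  split_ifs
  · simpa using (isHomogeneous_sgn v T).mul (hc (T.erase v))
  · exact isHomogeneous_zero _ _ _

/-- Modulo an ideal containing `f` the operator `z` anticommutes with `∂`, so it preserves homology,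
with bounding chain `-z d`. -/
lemma IsLift.mem_of_mem {f : MvPolynomial σ K}
    {z : Chain K σ →ₗ[MvPolynomial σ K] Chain K σ} (hz : IsLift f z)
    {I : Ideal (MvPolynomial σ K)} (hf : f ∈ I) {c d : Chain K σ}
    (h : c - del d ∈ chainsIn I) : z c - del (-z d) ∈ chainsIn I := by
  have h1 := hz.mem _ _ h
  have e1 : z c - del (-z d) = z (c - del d) + f • d := by
    rw [map_neg, hz.del_apply, map_sub]; abel
  rw [e1]
  exact add_mem h1 (smul_mem_chainsIn _ hf)

lemma exists_prodLift_append {ι : Type*} [DecidableEq ι] {f : ι → MvPolynomial σ K}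
    {z : ι → Chain K σ →ₗ[MvPolynomial σ K] Chain K σ} {I : Ideal (MvPolynomial σ K)}
    {g : MvPolynomial σ K} {l : List ι}
    (hl : ∃ d C : Chain K σ, del C ∈ chainsIn (quotBy I g) ∧
      prodLift z l - del d - g • C ∈ chainsIn I)
    (l' : List ι) (hz : ∀ e ∈ l', IsLift (f e) (z e)) (hf : ∀ e ∈ l', f e ∈ I) :
    ∃ d C : Chain K σ, del C ∈ chainsIn (quotBy I g) ∧
      prodLift z (l' ++ l) - del d - g • C ∈ chainsIn I := by
  induction l' with
  | nil => exact hl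
  | cons e l' ih =>
    obtain ⟨d, C, hC, h⟩ := ih (fun i hi => hz i (by simp [hi])) fun i hi => hf i (by simp [hi])
    have hze := hz e (by simp)
    have hfe := hf e (by simp)
    refine ⟨-z e d, z e C, ?_, ?_⟩
    · rw [hze.del_apply]
      exact sub_mem (smul_mem_chainsIn _ (le_quotBy _ _ hfe)) (hze.mem _ _ hC)
    · rw [sub_right_comm] at h ⊢
      have h1 := hze.mem_of_mem hfe h
      rwa [map_sub, map_smul] at h1

end Lifts

namespace PathVars

variable {σ : Type u} [LinearOrder σ] [Fintype σ] {n : ℕ} (P : PathVars σ n)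
  (K : Type*) [Field K]

/-- Left multiplication by the one-form `x_i e_{y_j} - x_j e_{y_i}`. -/
def lift (i j : ℕ) : Chain K σ →ₗ[MvPolynomial σ K] Chain K σ :=
  (X (P.x i) : MvPolynomial σ K) • wedge (P.y j) - (X (P.x j) : MvPolynomial σ K) • wedge (P.y i)

/-- Left multiplication by the one-form `x_k e_{y_k} - y_k e_{x_k}`. -/
def rot (k : ℕ) : Chain K σ →ₗ[MvPolynomial σ K] Chain K σ :=
  (X (P.x k) : MvPolynomial σ K) • wedge (P.y k) - (X (P.y k) : MvPolynomial σ K) • wedge (P.x k)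

variable {K}

lemma lift_apply (i j : ℕ) (c : Chain K σ) : P.lift K i j c =
    (X (P.x i) : MvPolynomial σ K) • wedge (P.y j) c -
      (X (P.x j) : MvPolynomial σ K) • wedge (P.y i) c := rfl

lemma rot_apply (k : ℕ) (c : Chain K σ) : P.rot K k c =
    (X (P.x k) : MvPolynomial σ K) • wedge (P.y k) c -
      (X (P.y k) : MvPolynomial σ K) • wedge (P.x k) c := rfl

lemma isLift (i j : ℕ) : IsLift (P.minor K i j) (P.lift K i j) where
  del_apply c := by
    simp only [lift_apply, map_sub, map_smul, del_wedge, minor]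
    module
  mem A c hc := by
    rw [lift_apply]
    exact sub_mem (Submodule.smul_mem _ _ (wedge_mem_chainsIn hc _))
      (Submodule.smul_mem _ _ (wedge_mem_chainsIn hc _))
  homog δ c hc := by
    rw [lift_apply]
    exact ((hc.wedge _).smul (isHomogeneous_X K _)).sub ((hc.wedge _).smul (isHomogeneous_X K _))

lemma del_rot (k : ℕ) (c : Chain K σ) : del (P.rot K k c) = - P.rot K k (del c) := by
  simp only [rot_apply, map_sub, map_smul, del_wedge]
  module

lemma del_wedge_wedge (k : ℕ) (c : Chain K σ) :
    del (wedge (P.x k) (wedge (P.y k) c)) =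
      P.rot K k c + wedge (P.x k) (wedge (P.y k) (del c)) := by
  simp only [rot_apply, map_sub, map_smul, del_wedge]
  module

/-- The product of the one-forms `x_k e_{y_k} - y_k e_{x_k}` for `a < k ≤ a + j`. -/
def rotProd (K : Type*) [Field K] (a : ℕ) : ℕ → Chain K σ
  | 0 => unit
  | j + 1 => P.rot K (a + 1 + j) (rotProd K a j)

lemma del_rotProd (a j : ℕ) : del (P.rotProd K a j) = 0 := by
  induction j with
  | zero => exact del_unit
  | succ j ih => rw [rotProd, del_rot, ih, map_zero, neg_zero]

/-- The Plücker relation `x_k f_{a,k+1} = x_{k+1} f_{a,k} + x_a f_{k,k+1}`, and its analogue with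
`y`, turn annihilation by `f_{a,k}` into annihilation by `f_{a,k+1}`. -/
lemma rot_mem {E : Finset ℕ} {a k : ℕ} (hk : k ∈ E) {c : Chain K σ}
    (hc : c ∈ chainsIn (quotBy (P.edgeIdeal K E) (P.minor K a k))) :
    P.rot K k c ∈ chainsIn (quotBy (P.edgeIdeal K E) (P.minor K a (k + 1))) := by
  have key : ∀ u v, u ∈ quotBy (P.edgeIdeal K E) (P.minor K a k) →
      (∃ p q, P.minor K a (k + 1) * v = p * P.minor K k (k + 1) + q * P.minor K a k) →
      v * u ∈ quotBy (P.edgeIdeal K E) (P.minor K a (k + 1)) := by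
    rintro u v hu ⟨p, q, hv⟩
    rw [mem_quotBy] at hu ⊢
    have e1 : P.minor K a (k + 1) * (v * u) =
        p * u * P.minor K k (k + 1) + q * (P.minor K a k * u) := by
      rw [← mul_assoc, hv]; ring
    rw [e1]
    exact add_mem (Ideal.mul_mem_left _ _ (P.minor_mem hk)) (Ideal.mul_mem_left _ _ hu)
  rw [rot_apply]
  refine sub_mem (mem_chainsIn.2 fun T => ?_) (mem_chainsIn.2 fun T => ?_)
  · refine key _ _ (mem_chainsIn.1 (wedge_mem_chainsIn hc _) T)
      ⟨X (P.x a), X (P.x (k + 1)), ?_⟩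
    simp only [minor]; ring
  · refine key _ _ (mem_chainsIn.1 (wedge_mem_chainsIn hc _) T)
      ⟨X (P.y a), X (P.y (k + 1)), ?_⟩
    simp only [minor]; ring

lemma rotProd_mem {E : Finset ℕ} {a j : ℕ} (hE : ∀ e, a ≤ e → e ≤ a + j → e ∈ E) :
    P.rotProd K a j ∈ chainsIn (quotBy (P.edgeIdeal K E) (P.minor K a (a + 1 + j))) := by
  induction j with
  | zero =>
    refine mem_chainsIn.2 fun T => ?_
    rw [mem_quotBy]
    exact Ideal.mul_mem_right _ _ (P.minor_mem (hE a le_rfl le_rfl))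
  | succ j ih =>
    exact P.rot_mem (hE (a + 1 + j) (by omega) (by omega)) (ih fun e h1 h2 => hE e h1 (by omega))

/-- A Koszul version of the Plücker relation: up to a boundary, the one-forms of `ak` and `kb`
multiply to `f_ab e_{x_k} e_{y_k}` plus multiples of `f_ak` and `f_kb`. -/
lemma lift_lift (a k b : ℕ) {c : Chain K σ} (hc : del c = 0) :
    P.lift K k b (P.lift K a k c) =
      del (wedge (P.x k) ((X (P.x a) : MvPolynomial σ K) • wedge (P.y b) (wedge (P.y k) c)
        - (X (P.x k) : MvPolynomial σ K) • wedge (P.y b) (wedge (P.y a) c)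
        + (X (P.x b) : MvPolynomial σ K) • wedge (P.y k) (wedge (P.y a) c)))
      + P.minor K a b • wedge (P.x k) (wedge (P.y k) c)
      - P.minor K a k • wedge (P.x k) (wedge (P.y b) c)
      - P.minor K k b • wedge (P.x k) (wedge (P.y a) c) := by
  simp only [lift_apply, map_sub, map_add, map_smul, del_wedge, minor, hc, map_zero,
    wedge_wedge_self]
  module

/-- The list `[a + j, …, a + 1, a]`. -/
def descList (a : ℕ) : ℕ → List ℕ
  | 0 => [a]
  | j + 1 => (a + 1 + j) :: descList a j

lemma mem_descList {a j e : ℕ} : e ∈ descList a j ↔ a ≤ e ∧ e ≤ a + j := by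
  induction j with
  | zero => simp [descList]; omega
  | succ j ih => rw [descList, List.mem_cons, ih]; omega

lemma nodup_descList (a j : ℕ) : (descList a j).Nodup := by
  induction j with
  | zero => simp [descList]
  | succ j ih =>
    rw [descList, List.nodup_cons, mem_descList]
    exact ⟨by omega, ih⟩

/-- For `k = a + 1 + j` and `b = k + 1`, two terms of `lift_lift` disappear: `f_{k,b}` is an edge
binomial, and `f_{a,k}` kills `rotProd` modulo `I`. -/
lemma exists_lift_lift {E : Finset ℕ} {a j : ℕ} (hE : ∀ e, a ≤ e → e ≤ a + j + 1 → e ∈ E) :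
    ∃ d : Chain K σ, P.lift K (a + 1 + j) (a + 1 + j + 1)
        (P.lift K a (a + 1 + j) (P.rotProd K a j)) - del d
      - P.minor K a (a + 1 + j + 1) • wedge (P.x (a + 1 + j)) (wedge (P.y (a + 1 + j))
        (P.rotProd K a j)) ∈ chainsIn (P.edgeIdeal K E) := by
  have key : ∀ D u v w : Chain K σ, v ∈ chainsIn (P.edgeIdeal K E) →
      w ∈ chainsIn (P.edgeIdeal K E) →
      ∃ d, del D + u - v - w - del d - u ∈ chainsIn (P.edgeIdeal K E) := by
    intro D u v w hv hw
    refine ⟨D, ?_⟩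
    have e1 : del D + u - v - w - del D - u = -(v + w) := by abel
    rw [e1]
    exact neg_mem (add_mem hv hw)
  rw [P.lift_lift a _ _ (P.del_rotProd a j)]
  refine key _ _ _ _ ?_ (smul_mem_chainsIn _ (P.minor_mem (hE _ (by omega) (by omega))))
  have h := wedge_mem_chainsIn (wedge_mem_chainsIn
    (P.rotProd_mem (K := K) (E := E) (a := a) (j := j) fun e h1 h2 => hE e h1 (by omega))
    (P.y (a + 1 + j + 1))) (P.x (a + 1 + j))
  exact mem_chainsIn.2 fun T => mem_quotBy.1 (mem_chainsIn.1 h T)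

/-- A stretch of edges collapses to one one-form starting at `a`. By `exists_lift_lift` the next
product is homologous to `f_{a,k+1} w` with `w = e_{x_k} e_{y_k} R`, and hence to the one-form of
`a, k + 1` applied to `∂w`, which is the next rotation product. -/
lemma exists_prodLift_descList {E : Finset ℕ} {a j : ℕ} (hE : ∀ e, a ≤ e → e ≤ a + j → e ∈ E) :
    ∃ (d : Chain K σ) (ε : MvPolynomial σ K),
      prodLift (fun e => P.lift K e (e + 1)) (descList a j) - del d
        - ε • P.lift K a (a + 1 + j) (P.rotProd K a j) ∈ chainsIn (P.edgeIdeal K E) := by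
  induction j with
  | zero =>
    refine ⟨0, 1, ?_⟩
    simp [descList, prodLift, rotProd]
  | succ j ih =>
    obtain ⟨d, ε, h⟩ := ih fun e h1 h2 => hE e h1 (by omega)
    have hk : a + 1 + j ∈ E := hE _ (by omega) (by omega)
    have h0 := (P.isLift (K := K) (a + 1 + j) (a + 1 + j + 1)).mem_of_mem (P.minor_mem hk)
      (by rwa [sub_right_comm] at h)
    rw [map_sub, map_smul] at h0
    obtain ⟨d', h'⟩ := P.exists_lift_lift (K := K) (E := E) (a := a) (j := j)
      fun e h1 h2 => hE e h1 (by omega)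
    have h1 := Submodule.smul_mem _ ε h'
    have hz := (P.isLift (K := K) a (a + 1 + j + 1)).del_apply
      (wedge (P.x (a + 1 + j)) (wedge (P.y (a + 1 + j)) (P.rotProd K a j)))
    rw [del_wedge_wedge, del_rotProd, map_zero, map_zero, add_zero] at hz
    have h2 := add_mem h0 h1
    rw [sub_eq_iff_eq_add.1 hz.symm] at h2
    refine ⟨-(P.lift K (a + 1 + j) (a + 1 + j + 1)) d + ε • d' + ε • P.lift K a (a + 1 + j + 1)
      (wedge (P.x (a + 1 + j)) (wedge (P.y (a + 1 + j)) (P.rotProd K a j))), ε, ?_⟩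
    convert h2 using 1
    rw [descList, prodLift, rotProd, map_add, map_add, map_smul, map_smul]
    simp only [← add_assoc]
    module

variable {P}

/-- The almost complete intersection obtained from a path by adding one edge. -/
theorem exists_isAlmostCI {E : Finset ℕ} {a b : ℕ} (hab : a + 2 ≤ b) (hb : b < n)
    (hE : IsEdgeSet n E) (hsub : ∀ e, a ≤ e → e < b → e ∈ E) :
    ∃ l : List ℕ, l.toFinset = E ∧ l.length = E.card ∧
      IsAlmostCI (fun e => P.minor K e (e + 1)) l (P.minor K a b)
        fun e => P.lift K e (e + 1) := by
  obtain ⟨j, rfl⟩ : ∃ j, b = a + 1 + (j + 1) := ⟨b - (a + 2), by omega⟩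
  have hsub' : (descList a (j + 1)).toFinset ⊆ E := by
    intro e he
    rw [List.mem_toFinset, mem_descList] at he
    exact hsub e (by omega) (by omega)
  -- The edges from `a` to `b` are the innermost factors; the others multiply the relation from
  -- outside, by `exists_prodLift_append`.
  set l := (E \ (descList a (j + 1)).toFinset).toList ++ descList a (j + 1) with hl
  have hlE : l.toFinset = E := by
    rw [hl, List.toFinset_append, Finset.toList_toFinset, Finset.sdiff_union_of_subset hsub']
  have hnd : l.Nodup := by
    refine List.Nodup.append (Finset.nodup_toList _) (nodup_descList _ _) ?_
    intro e he he'
    rw [Finset.mem_toList, Finset.mem_sdiff, List.mem_toFinset] at he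
    exact he.2 he'
  have hlen : l.length = E.card := by rw [← hlE, List.toFinset_card_of_nodup hnd]
  have hmem : ∀ e ∈ l, e ∈ E := fun e he => by rwa [← hlE, List.mem_toFinset]
  have hI : Ideal.span ((fun e => P.minor K e (e + 1)) '' (l.toFinset : Set ℕ)) =
      P.edgeIdeal K E := by rw [hlE, edgeIdeal]
  refine ⟨l, hlE, hlen, hnd, ?_, ⟨fun e _ => P.isHomogeneous_minor _ _, ?_⟩,
    fun e _ => P.isLift _ _, P.isHomogeneous_minor _ _, P.minor_ne_zero (by omega) hb, ?_, ?_, ?_⟩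
  · have : 2 ≤ (descList a (j + 1)).length := by cases j <;> simp [descList]
    rw [hl, List.length_append]; omega
  · rw [hlE]
    intro t ht e he het u hu
    refine P.mem_of_minor_mul_mem (fun i hi => hE i (ht hi)) (Nat.lt_succ_self e) (hE e he) het
      (fun i hi hie => het ?_) u hu
    rwa [← Nat.succ_injective hie]
  · rw [hI]
    intro u hu
    rw [mem_quotBy] at hu ⊢
    refine P.mem_of_sq_mem hE _ ?_
    have e1 : P.minor K a (a + 1 + (j + 1)) * u * (P.minor K a (a + 1 + (j + 1)) * u) =
        u * (P.minor K a (a + 1 + (j + 1)) * (P.minor K a (a + 1 + (j + 1)) * u)) := by ring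
    rw [e1]
    exact Ideal.mul_mem_left _ _ hu
  · rw [hI, hlen]
    exact P.regLT_quotBy_minor hab hb hE hsub
  · rw [hI]
    refine exists_prodLift_append ?_ _ (fun e _ => P.isLift e (e + 1)) fun e he =>
      P.minor_mem (hmem e (List.mem_append_left _ he))
    obtain ⟨d, ε, h⟩ := P.exists_prodLift_descList (K := K) (E := E) (a := a) (j := j)
      fun e h1 h2 => hsub e h1 (by omega)
    have hk : a + 1 + j ∈ E := hsub _ (by omega) (by omega)
    have h0 := (P.isLift (K := K) (a + 1 + j) (a + 1 + j + 1)).mem_of_mem (P.minor_mem hk)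
      (by rwa [sub_right_comm] at h)
    rw [map_sub, map_smul] at h0
    obtain ⟨d', h'⟩ := P.exists_lift_lift (K := K) (E := E) (a := a) (j := j)
      fun e h1 h2 => hsub e h1 (by omega)
    have h2 := add_mem h0 (Submodule.smul_mem _ ε h')
    -- The witness `C` is `ε e_{x_k} e_{y_k} R` with `k = b - 1`; its boundary is `ε` times the full
    -- rotation product, which lies in `I : f_ab`.
    refine ⟨-(P.lift K (a + 1 + j) (a + 1 + j + 1)) d + ε • d',
      ε • wedge (P.x (a + 1 + j)) (wedge (P.y (a + 1 + j)) (P.rotProd K a j)), ?_, ?_⟩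
    · rw [map_smul, del_wedge_wedge, del_rotProd, map_zero, map_zero, add_zero]
      exact Submodule.smul_mem _ _ (P.rotProd_mem (j := j + 1) fun e h1 h2 =>
        hsub e h1 (by omega))
    · convert h2 using 1
      rw [descList, prodLift, map_add, map_smul]
      simp only [← add_assoc]
      module

/-- The powers of the binomial edge ideal of a path with one further edge. -/
theorem regLT_pow {a b s : ℕ} (hab : a + 2 ≤ b) (hb : b < n) (hs : 1 ≤ s) :
    RegLT ⊤ ((P.edgeIdeal K (Finset.range (n - 1)) ⊔ Ideal.span {P.minor K a b}) ^ s)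
      (2 * s + (n - 1) - 2) := by
  obtain ⟨l, hl, hlen, H⟩ := exists_isAlmostCI (P := P) (K := K) hab hb
    (E := Finset.range (n - 1)) (fun e he => by rw [Finset.mem_range] at he; omega)
    (fun e _ he => by rw [Finset.mem_range]; omega)
  have h := H.regLT_pow hs
  rwa [hl, hlen, Finset.card_range] at h

end PathVars

/-! ### A nonvanishing class: the lower bound. -/

section TopClass

variable {K : Type*} [Field K] {σ : Type*} [LinearOrder σ] [Fintype σ]
  {ι : Type*} [DecidableEq ι] {f : ι → MvPolynomial σ K}
  {z : ι → Chain K σ →ₗ[MvPolynomial σ K] Chain K σ}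

lemma unit_apply_empty : (unit : Chain K σ) ∅ = 1 := Pi.single_eq_same _ _

lemma isHomogChain_unit : IsHomogChain 0 (unit : Chain K σ) := by
  intro T
  rw [unit, Pi.single_apply]
  split_ifs
  · exact isHomogeneous_one _ _
  · exact isHomogeneous_zero _ _ _

lemma unit_ne_del (d : Chain K σ) : unit ≠ del d := by
  intro h
  have h1 := congrArg constantCoeff (congrFun h ∅)
  rw [unit_apply_empty, del_apply, map_one, map_sum, Finset.sum_eq_zero] at h1
  · exact one_ne_zero h1
  · intro v _
    rw [map_mul, map_mul, constantCoeff_X, mul_zero, zero_mul]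

lemma isHomogChain_prodLift {l : List ι} (hz : ∀ e ∈ l, IsLift (f e) (z e)) :
    IsHomogChain l.length (prodLift z l) := by
  induction l with
  | nil => exact isHomogChain_unit
  | cons e l ih => exact (hz e (by simp)).homog _ _ (ih fun i hi => hz i (by simp [hi]))

lemma del_prodLift_mem {l : List ι} (hz : ∀ e ∈ l, IsLift (f e) (z e)) :
    del (prodLift z l) ∈ chainsIn (Ideal.span (f '' l.toFinset)) := by
  induction l with
  | nil => rw [prodLift, del_unit]; exact zero_mem _
  | cons e l ih =>
    rw [prodLift, (hz e (by simp)).del_apply, List.toFinset_cons, span_image_insert]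
    refine sub_mem (smul_mem_chainsIn _
      (Ideal.mem_sup_right (Ideal.mem_span_singleton_self _))) ?_
    exact chainsIn_mono le_sup_left
      ((hz e (by simp)).mem _ _ (ih fun i hi => hz i (by simp [hi])))

/-- Let `I'` be the ideal of `l`. Modulo `I'` the `(k + 1)`-st power is generated by `f_e ^ (k +
1)`, so the difference is `f_e ^ (k + 1) b` up to `I'`. Applying `∂` and cancelling the regular
element `f_e ^ (k + 1)` shows that `b` bounds the shorter product modulo `I'`. -/
lemma IsRegularFamily.exists_of_smul_prodLift {e : ι} {l : List ι} (hl : (e :: l).Nodup)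
    (h : IsRegularFamily f (e :: l).toFinset) (hz : ∀ i ∈ e :: l, IsLift (f i) (z i)) (k : ℕ)
    {d : Chain K σ} (hd : f e ^ k • prodLift z (e :: l) - del d ∈
      chainsIn (Ideal.span (f '' (e :: l).toFinset) ^ (k + 1))) :
    ∃ d', prodLift z l - del d' ∈ chainsIn (Ideal.span (f '' l.toFinset)) := by
  have hZ := del_prodLift_mem (l := l) fun i hi => hz i (by simp [hi])
  have hze := hz e (by simp)
  rw [List.nodup_cons] at hl
  rw [List.toFinset_cons] at h hd
  have hreg := h.reg l.toFinset (Finset.subset_insert _ _) e (Finset.mem_insert_self _ _)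
    (by simpa using hl.1)
  rw [span_image_insert] at hd
  set I := Ideal.span (f '' (l.toFinset : Set ι)) with hI
  obtain ⟨a, ha, b, hb, hab⟩ := exists_of_mem_chainsIn_sup
    (chainsIn_mono (sup_span_pow_succ_le' I (f e) k) hd)
  obtain ⟨b, rfl⟩ := exists_of_mem_chainsIn_span hb
  have ha' : a ∈ chainsIn I := chainsIn_mono Ideal.mul_le_left ha
  refine ⟨b, ?_⟩
  have hreg' : ∀ (m : ℕ) (c : Chain K σ), f e ^ m • c ∈ chainsIn I → c ∈ chainsIn I := by
    intro m
    induction m with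
    | zero => intro c; simp
    | succ m ih =>
      intro c hc
      refine ih c (mem_chainsIn.2 fun T => hreg _ ?_)
      have := mem_chainsIn.1 hc T
      rwa [pow_succ', mul_smul] at this
  refine hreg' (k + 1) _ ?_
  have h1 := congrArg del hab
  rw [map_sub, del_del, sub_zero, map_smul, prodLift, hze.del_apply, map_add, map_smul] at h1
  have e1 : f e ^ (k + 1) • (prodLift z l - del b) =
      del a + f e ^ k • z e (del (prodLift z l)) := by
    rw [smul_sub, sub_eq_iff_eq_add] at h1
    rw [smul_sub, pow_succ, mul_smul, h1, ← pow_succ]; abel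
  rw [e1]
  exact add_mem (del_mem_chainsIn ha') (Submodule.smul_mem _ _ (hze.mem _ _ hZ))

/-- Peeling off the factors one by one ends at `e_∅`, which is not a boundary since boundaries have
no constant terms. -/
lemma IsRegularFamily.prodLift_sub_notMem {l : List ι} (hl : l.Nodup)
    (h : IsRegularFamily f l.toFinset) (hz : ∀ i ∈ l, IsLift (f i) (z i)) (d : Chain K σ) :
    prodLift z l - del d ∉ chainsIn (Ideal.span (f '' l.toFinset)) := by
  induction l generalizing d with
  | nil =>
    intro hd
    have : prodLift z [] - del d = 0 := by simpa [mem_chainsIn_bot] using hd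
    exact unit_ne_del d (sub_eq_zero.1 this)
  | cons e l ih =>
    intro hd
    obtain ⟨d', hd'⟩ := h.exists_of_smul_prodLift hl hz 0 (d := d) (by simpa using hd)
    exact ih (List.nodup_cons.1 hl).2
      (h.mono (by rw [List.toFinset_cons]; exact Finset.subset_insert _ _))
      (fun i hi => hz i (by simp [hi])) d' hd'

/-- The class of `f_e ^ k` times the product of the one-forms is not a boundary modulo the
`(k + 1)`-st power of a complete intersection. -/
lemma IsRegularFamily.smul_prodLift_sub_notMem {e : ι} {l : List ι} (hl : (e :: l).Nodup)
    (h : IsRegularFamily f (e :: l).toFinset) (hz : ∀ i ∈ e :: l, IsLift (f i) (z i)) (k : ℕ)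
    (d : Chain K σ) : f e ^ k • prodLift z (e :: l) - del d ∉
      chainsIn (Ideal.span (f '' (e :: l).toFinset) ^ (k + 1)) := by
  intro hd
  obtain ⟨d', hd'⟩ := h.exists_of_smul_prodLift hl hz k hd
  exact (h.mono (by rw [List.toFinset_cons]; exact Finset.subset_insert _ _)).prodLift_sub_notMem
    (List.nodup_cons.1 hl).2 (fun i hi => hz i (by simp [hi])) d' hd'

open Classical in
/-- The restriction of chains to the variables outside `V`. -/
def killChain (V : Set σ) (c : Chain K σ) : Chain K σ :=
  fun A => if ∀ v ∈ A, v ∉ V then kill K V (c A) else 0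

lemma killChain_sub (V : Set σ) (c d : Chain K σ) :
    killChain V (c - d) = killChain V c - killChain V d := by
  funext A
  simp only [killChain, Pi.sub_apply, map_sub]
  split_ifs <;> simp

lemma killChain_smul (V : Set σ) (p : MvPolynomial σ K) (c : Chain K σ) :
    killChain V (p • c) = kill K V p • killChain V c := by
  funext A
  simp only [killChain, Pi.smul_apply, smul_eq_mul, map_mul]
  split_ifs <;> simp

lemma kill_sgn (V : Set σ) (v : σ) (A : Finset σ) : kill K V (sgn K v A) = sgn K v A := by
  rw [sgn, map_pow, map_neg, map_one]

/-- The summands of `∂` at `v ∈ V` carry the factor `x_v`, which is sent to zero; so the restriction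
is a chain map. -/
lemma killChain_del (V : Set σ) (c : Chain K σ) : killChain V (del c) = del (killChain V c) := by
  funext A
  rw [del_apply]
  simp only [killChain]
  split_ifs with h
  · rw [del_apply, map_sum]
    refine Finset.sum_congr rfl fun v _ => ?_
    rw [map_mul, map_mul, kill_sgn]
    by_cases hv : v ∈ V
    · rw [kill_X_of_mem hv, if_neg (fun h' => h' v (by simp) hv), mul_zero, zero_mul, mul_zero]
    · rw [kill_X_of_notMem hv, if_pos]
      intro w hw
      rcases Finset.mem_insert.1 hw with rfl | hw
      exacts [hv, h w hw]
  · refine (Finset.sum_eq_zero fun v _ => ?_).symm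
    rw [if_neg (fun h' => h fun w hw => h' w (by simp [hw])), mul_zero]

lemma killChain_wedge {V : Set σ} {v : σ} (hv : v ∉ V) (c : Chain K σ) :
    killChain V (wedge v c) = wedge v (killChain V c) := by
  funext A
  simp only [killChain, wedge_apply]
  by_cases hvA : v ∈ A
  · simp only [if_pos hvA]
    by_cases h : ∀ w ∈ A, w ∉ V
    · rw [if_pos h, if_pos fun w hw => h w (Finset.mem_of_mem_erase hw), map_mul, kill_sgn]
    · rw [if_neg h, if_neg, mul_zero]
      intro h'
      refine h fun w hw => ?_
      by_cases hwv : w = v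
      · rwa [hwv]
      · exact h' w (Finset.mem_erase.2 ⟨hwv, hw⟩)
  · simp [hvA]

lemma killChain_unit (V : Set σ) : killChain V (unit : Chain K σ) = unit := by
  funext A
  simp only [killChain, unit, Pi.single_apply]
  by_cases hA : A = ∅
  · subst hA; simp
  · simp [hA]

lemma killChain_mem {V : Set σ} {A B : Ideal (MvPolynomial σ K)}
    (h : ∀ p ∈ A, kill K V p ∈ B) {c : Chain K σ} (hc : c ∈ chainsIn A) :
    killChain V c ∈ chainsIn B := by
  refine mem_chainsIn.2 fun T => ?_
  simp only [killChain]
  split_ifs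
  · exact h _ (mem_chainsIn.1 hc T)
  · exact zero_mem _

end TopClass

namespace PathVars

variable {σ : Type u} [LinearOrder σ] [Fintype σ] {n : ℕ} {P : PathVars σ n}
  {K : Type*} [Field K]

lemma notMem_pair {i k : ℕ} (hi : i < n) (hk : k < n) (hik : i ≠ k) :
    P.x i ∉ ({P.x k, P.y k} : Set σ) ∧ P.y i ∉ ({P.x k, P.y k} : Set σ) := by
  simp only [Set.mem_insert_iff, Set.mem_singleton_iff, not_or]
  exact ⟨⟨fun h => hik (P.x_inj _ hi _ hk h), P.x_ne_y _ hi _ hk⟩,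
    ⟨fun h => P.x_ne_y _ hk _ hi h.symm, fun h => hik (P.y_inj _ hi _ hk h)⟩⟩

lemma killChain_prodLift {k : ℕ} (hk : k < n) {l : List ℕ}
    (hl : ∀ e ∈ l, e + 1 < n ∧ e ≠ k ∧ e + 1 ≠ k) :
    killChain {P.x k, P.y k} (prodLift (fun e => P.lift K e (e + 1)) l) =
      prodLift (fun e => P.lift K e (e + 1)) l := by
  induction l with
  | nil => exact killChain_unit _
  | cons e l ih =>
    obtain ⟨h1, h2, h3⟩ := hl e (by simp)
    have he := notMem_pair (P := P) (show e < n by omega) hk h2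
    have he' := notMem_pair (P := P) h1 hk h3
    rw [prodLift, lift_apply, killChain_sub, killChain_smul, killChain_smul,
      killChain_wedge he.2, killChain_wedge he'.2, kill_X_of_notMem he.1,
      kill_X_of_notMem he'.1, ih fun i hi => hl i (by simp [hi])]

/-- A cycle modulo the powers of the binomial edge ideal of a path with one further edge that is
not a boundary. -/
theorem exists_cycle {a b : ℕ} (hab : a + 2 ≤ b) (hb : b < n) (k : ℕ) :
    ∃ (δ : ℕ) (c : Chain K σ), 2 * k + (n - 3) ≤ δ ∧ IsHomogChain δ c ∧
      del c ∈ chainsIn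
        ((P.edgeIdeal K (Finset.range (n - 1)) ⊔ Ideal.span {P.minor K a b}) ^ (k + 1)) ∧
      ∀ d, c - del d ∉ chainsIn
        ((P.edgeIdeal K (Finset.range (n - 1)) ⊔ Ideal.span {P.minor K a b}) ^ (k + 1)) := by
  have hE : IsEdgeSet n (Finset.range (n - 1)) := fun e he => by
    rw [Finset.mem_range] at he; omega
  have ha : a < n := by omega
  -- Dropping the vertex `a` removes the extra edge `ab` and at most two path edges, leaving a
  -- complete intersection of at least `n - 3` quadrics. The edge `a + 1` survives because `a + 2 ≤
  -- b < n`, and it carries the `k`-th power.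
  set E := away (Finset.range (n - 1)) a with hEdef
  have hEa : IsEdgeSet n E := hE.away a
  have ha1 : a + 1 ∈ E := by rw [hEdef, mem_away, Finset.mem_range]; omega
  set l := (a + 1) :: (E.erase (a + 1)).toList with hl
  have hlE : l.toFinset = E := by
    rw [hl, List.toFinset_cons, Finset.toList_toFinset, Finset.insert_erase ha1]
  have hnd : l.Nodup := by
    rw [hl, List.nodup_cons]
    exact ⟨by simp, Finset.nodup_toList _⟩
  have hlen : l.length = E.card := by rw [← hlE, List.toFinset_card_of_nodup hnd]
  have hmem : ∀ e ∈ l, e ∈ E := fun e he => by rwa [← hlE, List.mem_toFinset]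
  have hcard : n - 3 ≤ E.card := by
    have h1 : ((Finset.range (n - 1)).erase a).erase (a - 1) ⊆ E := by
      intro e he
      simp only [Finset.mem_erase, Finset.mem_range] at he
      rw [hEdef, mem_away, Finset.mem_range]
      omega
    have h2 := Finset.card_le_card h1
    have h3 := Finset.pred_card_le_card_erase (s := (Finset.range (n - 1)).erase a) (a := a - 1)
    have h4 := Finset.pred_card_le_card_erase (s := Finset.range (n - 1)) (a := a)
    rw [Finset.card_range] at h4
    omega
  have hz : ∀ e ∈ l, IsLift (P.minor K e (e + 1)) (P.lift K e (e + 1)) := fun e _ => P.isLift _ _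
  have hfam : IsRegularFamily (fun e => P.minor K e (e + 1)) l.toFinset := by
    refine ⟨fun e _ => P.isHomogeneous_minor _ _, ?_⟩
    rw [hlE]
    intro t ht e he het u hu
    refine P.mem_of_minor_mul_mem (fun i hi => hEa i (ht hi)) (Nat.lt_succ_self e) (hEa e he) het
      (fun i hi hie => het ?_) u hu
    rwa [← Nat.succ_injective hie]
  have hI : Ideal.span ((fun e => P.minor K e (e + 1)) '' (l.toFinset : Set ℕ)) =
      P.edgeIdeal K E := by rw [hlE, edgeIdeal]
  have hIJ : P.edgeIdeal K E ≤ P.edgeIdeal K (Finset.range (n - 1)) ⊔ Ideal.span {P.minor K a b} :=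
    (P.edgeIdeal_mono (away_subset _ _)).trans le_sup_left
  set J := P.edgeIdeal K (Finset.range (n - 1)) ⊔ Ideal.span {P.minor K a b} with hJ
  have hkill : ∀ p ∈ J ^ (k + 1), kill K {P.x a, P.y a} p ∈ P.edgeIdeal K E ^ (k + 1) := by
    have h1 : J ≤ (P.edgeIdeal K E).comap (kill K {P.x a, P.y a}) := by
      refine sup_le (fun p hp => P.kill_mem_away hE ha hp) ?_
      rw [Ideal.span_singleton_le_iff_mem, Ideal.mem_comap, kill_minor_left]
      exact zero_mem _
    intro p hp
    have h2 := Ideal.mem_map_of_mem (kill K {P.x a, P.y a}) hp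
    rw [Ideal.map_pow] at h2
    exact Ideal.pow_right_mono (Ideal.map_le_iff_le_comap.2 h1) _ h2
  have hfh : (P.minor K (a + 1) (a + 1 + 1) ^ k).IsHomogeneous (2 * k) :=
    (P.isHomogeneous_minor _ _).pow k
  refine ⟨l.length + 2 * k, P.minor K (a + 1) (a + 1 + 1) ^ k •
    prodLift (fun e => P.lift K e (e + 1)) l, by omega,
    (isHomogChain_prodLift hz).smul hfh, ?_, fun d hd => ?_⟩
  · rw [map_smul, pow_succ]
    refine smul_mem_chainsIn_mul (Ideal.pow_mem_pow (hIJ (P.minor_mem ha1)) k) ?_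
    have := del_prodLift_mem hz
    rw [hI] at this
    exact chainsIn_mono hIJ this
  -- A bounding chain would restrict to one for the smaller complete intersection, where none
  -- exists.
  · have h1 := killChain_mem hkill hd
    rw [killChain_sub, killChain_del, killChain_smul, map_pow,
      P.kill_minor_of_ne (by omega) (by omega) ha (by omega) (by omega) subset_rfl,
      killChain_prodLift ha fun e he => ⟨hEa e (hmem e he), (mem_away.1 (hmem e he)).2⟩] at h1
    refine hfam.smul_prodLift_sub_notMem hnd hz k (killChain {P.x a, P.y a} d) ?_
    rw [← hl, hI]
    exact h1

end PathVars

/-! ### From polynomial chains to graded Betti numbers. -/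

section Betti

variable {K : Type*} [Field K] {σ : Type*} [LinearOrder σ] [Fintype σ]

/-- The reduction of a chain modulo an ideal. -/
def reduce (B : Ideal (MvPolynomial σ K)) (c : Chain K σ) : Finset σ → MvPolynomial σ K ⧸ B :=
  fun A => Ideal.Quotient.mk B (c A)

variable {B : Ideal (MvPolynomial σ K)}

lemma reduce_eq_zero {c : Chain K σ} : reduce B c = 0 ↔ c ∈ chainsIn B := by
  rw [mem_chainsIn, funext_iff]
  exact forall_congr' fun A => Ideal.Quotient.eq_zero_iff_mem

lemma reduce_sub (c d : Chain K σ) : reduce B (c - d) = reduce B c - reduce B d :=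
  funext fun _ => map_sub _ _ _

lemma exists_reduce_eq (x : Finset σ → MvPolynomial σ K ⧸ B) : ∃ c, reduce B c = x := by
  choose c hc using fun A => Ideal.Quotient.mk_surjective (x A)
  exact ⟨c, funext hc⟩

lemma koszulDifferential_apply (x : Finset σ → MvPolynomial σ K ⧸ B) (A : Finset σ) :
    koszulDifferential K (MvPolynomial σ K ⧸ B) x A = ∑ v ∈ Finset.univ \ A,
      ((-1 : MvPolynomial σ K) ^ (A.filter (· < v)).card * X v) • x (insert v A) := rfl

lemma koszulDifferential_reduce (c : Chain K σ) :
    koszulDifferential K (MvPolynomial σ K ⧸ B) (reduce B c) = reduce B (del c) := by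
  funext A
  rw [koszulDifferential_apply, reduce, del_apply, map_sum]
  refine Finset.sum_congr rfl fun v _ => ?_
  rw [map_mul]
  rfl

/-- The part of homological degree `i`. -/
def cardPart {M : Type*} [Zero M] (i : ℕ) (x : Finset σ → M) : Finset σ → M :=
  fun A => if A.card = i then x A else 0

lemma koszulDifferential_cardPart (i : ℕ) (x : Finset σ → MvPolynomial σ K ⧸ B) :
    koszulDifferential K (MvPolynomial σ K ⧸ B) (cardPart (i + 1) x) =
      cardPart i (koszulDifferential K (MvPolynomial σ K ⧸ B) x) := by
  funext A
  rw [koszulDifferential_apply, cardPart]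
  split_ifs with h
  · rw [koszulDifferential_apply]
    refine Finset.sum_congr rfl fun v hv => ?_
    rw [cardPart, if_pos]
    rw [Finset.card_insert_of_notMem (by simpa using hv), h]
  · refine Finset.sum_eq_zero fun v hv => ?_
    rw [cardPart, if_neg, smul_zero]
    rw [Finset.card_insert_of_notMem (by simpa using hv)]
    omega

lemma koszulDifferential_cardPart_zero (x : Finset σ → MvPolynomial σ K ⧸ B) :
    koszulDifferential K (MvPolynomial σ K ⧸ B) (cardPart 0 x) = 0 := by
  funext A
  rw [koszulDifferential_apply]
  refine Finset.sum_eq_zero fun v hv => ?_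
  rw [cardPart, if_neg, smul_zero]
  rw [Finset.card_insert_of_notMem (by simpa using hv)]
  omega

lemma cardPart_eq_self {j : ℤ} {i : ℕ} {x : Finset σ → MvPolynomial σ K ⧸ B}
    {ℳ : ℤ → Submodule K (MvPolynomial σ K ⧸ B)} (hx : x ∈ koszulChains σ ℳ i j) :
    cardPart i x = x := by
  funext A
  rw [cardPart]
  split_ifs with h
  · rfl
  · exact ((hx A).2 h).symm

lemma mk_mem_quotientGrading {p : MvPolynomial σ K} {δ : ℕ} (hp : p.IsHomogeneous δ) :
    Ideal.Quotient.mk B p ∈ quotientGrading B δ := by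
  rw [quotientGrading, if_pos (Int.natCast_nonneg δ), Int.toNat_natCast]
  exact ⟨p, hp, rfl⟩

lemma exists_of_mem_quotientGrading {δ : ℕ} {x : MvPolynomial σ K ⧸ B}
    (hx : x ∈ quotientGrading B δ) :
    ∃ p : MvPolynomial σ K, p.IsHomogeneous δ ∧ Ideal.Quotient.mk B p = x := by
  rw [quotientGrading, if_pos (Int.natCast_nonneg δ), Int.toNat_natCast] at hx
  obtain ⟨p, hp, h⟩ := hx
  exact ⟨p, hp, h⟩

lemma cardPart_reduce_mem {c : Chain K σ} {δ : ℕ} (hc : IsHomogChain δ c) (i : ℕ) {j : ℤ}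
    (hj : j = i + δ) : cardPart i (reduce B c) ∈ koszulChains σ (quotientGrading B) i j := by
  intro A
  rw [cardPart]
  refine ⟨fun h => ?_, fun h => if_neg h⟩
  rw [if_pos h, hj, add_sub_cancel_left]
  exact mk_mem_quotientGrading (hc A)

/-- Without finite dimensionality, `finrank = 0` would not mean that the homology vanishes. -/
instance (i : ℕ) (j : ℤ) : Module.Finite K (koszulCycles σ (quotientGrading B) i j) := by
  have h0 : (quotientGrading B (j - i)).FG := by
    rw [quotientGrading]
    split_ifs
    · exact (homogeneousSubmodule_fg (σ := σ) (R := K) _).map _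
    · exact Submodule.fg_bot
  have : Module.Finite K (quotientGrading B (j - i)) := Module.Finite.iff_fg.2 h0
  have hmem : ∀ x ∈ koszulCycles σ (quotientGrading B) i j, ∀ A,
      x A ∈ quotientGrading B (j - i) := by
    intro x hx A
    by_cases h : A.card = i
    · exact (hx.1 A).1 h
    · rw [(hx.1 A).2 h]; exact zero_mem _
  let φ : koszulCycles σ (quotientGrading B) i j →ₗ[K] (Finset σ → quotientGrading B (j - i)) :=
    LinearMap.pi fun A => LinearMap.codRestrict _
      (LinearMap.proj A ∘ₗ (koszulCycles σ (quotientGrading B) i j).subtype)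
      fun x => hmem _ x.2 A
  refine Module.Finite.of_injective φ fun x y h => ?_
  ext A
  exact congrArg Subtype.val (congrFun h A)

lemma gradedBetti_eq_zero_iff (i : ℕ) (j : ℤ) : gradedBetti σ (quotientGrading B) i j = 0 ↔
    koszulCycles σ (quotientGrading B) i j ≤ koszulBoundaries σ (quotientGrading B) i j := by
  rw [gradedBetti, Module.finrank_zero_iff, Submodule.Quotient.subsingleton_iff,
    Submodule.submoduleOf_eq_top]

lemma RegLT.sub_lt {m : ℕ} (h : RegLT ⊤ B m) (hB : IsHomog B) {i : ℕ} {j : ℤ}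
    (hij : gradedBetti σ (quotientGrading B) i j ≠ 0) : j - i < m := by
  contrapose! hij
  rw [gradedBetti_eq_zero_iff]
  rintro x ⟨hx, hdx⟩
  obtain ⟨δ, hδ⟩ : ∃ δ : ℕ, j - i = δ := ⟨(j - i).toNat, by omega⟩
  have hp : ∀ A, ∃ p : MvPolynomial σ K, p.IsHomogeneous δ ∧ Ideal.Quotient.mk B p = x A := by
    intro A
    refine exists_of_mem_quotientGrading ?_
    by_cases hA : A.card = i
    · rw [← hδ]; exact (hx A).1 hA
    · rw [(hx A).2 hA]; exact zero_mem _
  choose c hc hcx using hp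
  have hcx' : reduce B c = x := funext hcx
  have hdc : del c ∈ chainsIn B := by
    rw [← reduce_eq_zero, ← koszulDifferential_reduce, hcx']
    exact hdx
  obtain ⟨d, -, hd⟩ := h δ (by omega) c (mem_chainsIn_top _) hc hdc
  -- In coefficient degree `0` boundaries have no component, so the cycle itself is zero modulo `B`.
  rcases δ with _ | e
  · have h' := comp_mem_chainsIn hB hd 0
    rw [comp_sub, comp_zero_del, sub_zero, IsHomogChain.comp_eq hc, ← reduce_eq_zero, hcx'] at h'
    rw [h']
    exact zero_mem _
  · have h' := comp_mem_chainsIn hB hd (e + 1)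
    rw [comp_sub, comp_succ_del, IsHomogChain.comp_eq hc, ← reduce_eq_zero, reduce_sub, hcx',
      ← koszulDifferential_reduce, sub_eq_zero] at h'
    refine ⟨cardPart (i + 1) (reduce B (comp e d)),
      cardPart_reduce_mem (isHomogChain_comp e d) _ (by push_cast at hδ ⊢; omega), ?_⟩
    rw [koszulDifferential_cardPart, ← h', cardPart_eq_self hx]

/-- A chain mixes all homological degrees. If each of its parts were a boundary, the sum of the
bounding chains would bound the chain. -/
lemma exists_gradedBetti_ne_zero {δ : ℕ} {c : Chain K σ} (hc : IsHomogChain δ c)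
    (hdc : del c ∈ chainsIn B) (hd : ∀ d, c - del d ∉ chainsIn B) :
    ∃ i : ℕ, gradedBetti σ (quotientGrading B) i (i + δ) ≠ 0 := by
  by_contra! hz
  rw [← reduce_eq_zero, ← koszulDifferential_reduce] at hdc
  have key : ∀ i, ∃ x, koszulDifferential K (MvPolynomial σ K ⧸ B) x =
      cardPart i (reduce B c) := by
    intro i
    have hi := (gradedBetti_eq_zero_iff i (i + δ)).1 (hz i)
    obtain ⟨x, -, hx⟩ := hi ⟨cardPart_reduce_mem hc i rfl, by
      rw [SetLike.mem_coe, LinearMap.mem_ker]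
      rcases i with _ | i
      · exact koszulDifferential_cardPart_zero _
      · rw [koszulDifferential_cardPart, hdc]
        funext A
        simp [cardPart]⟩
    exact ⟨x, hx⟩
  choose x hx using key
  obtain ⟨d, hd'⟩ := exists_reduce_eq (∑ i ∈ Finset.range (Fintype.card σ + 1), x i)
  refine hd d ?_
  rw [← reduce_eq_zero, reduce_sub, ← koszulDifferential_reduce, hd', map_sum, sub_eq_zero]
  funext A
  rw [Finset.sum_apply, Finset.sum_eq_single A.card]
  · rw [hx, cardPart, if_pos rfl]
  · intro i _ hi
    rw [hx, cardPart, if_neg hi.symm]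
  · intro h
    exact (h (Finset.mem_range.2 (Nat.lt_succ_of_le (Finset.card_le_univ A)))).elim

/-- Bounds for the regularity from vanishing above and one nonvanishing class. -/
theorem exists_hasRegularity {m δ : ℕ} (hB : IsHomog B) (h : RegLT ⊤ B m) {c : Chain K σ}
    (hc : IsHomogChain δ c) (hdc : del c ∈ chainsIn B) (hd : ∀ d, c - del d ∉ chainsIn B) :
    ∃ r : ℤ, HasRegularity σ (quotientGrading B) r ∧ δ ≤ r ∧ r < m := by
  obtain ⟨i, hi⟩ := exists_gradedBetti_ne_zero hc hdc hd
  have hlt : ∀ k : ℤ, (∃ (i : ℕ) (j : ℤ), gradedBetti σ (quotientGrading B) i j ≠ 0 ∧ k = j - i) →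
      k < m := by
    rintro _ ⟨i, j, hij, rfl⟩
    exact h.sub_lt hB hij
  have hδ : ∃ (i : ℕ) (j : ℤ), gradedBetti σ (quotientGrading B) i j ≠ 0 ∧ (δ : ℤ) = j - i :=
    ⟨i, i + δ, hi, by ring⟩
  obtain ⟨r, hr, hr'⟩ := Int.exists_greatest_of_bdd ⟨m, fun k hk => (hlt k hk).le⟩ ⟨_, hδ⟩
  exact ⟨r, ⟨hr, fun k hk => hr' k hk⟩, hr' _ hδ, hlt r hr⟩

end Betti

/-! ### Height and minimal generators of binomial edge ideals. -/

section EdgeIdeal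

variable (K : Type*) [Field K] {n : ℕ}

/-- The binomial `x_p y_q - x_q y_p`. -/
def binom (p q : Fin n) : MvPolynomial (EdgeVar n) K :=
  X (Sum.inlₗ p) * X (Sum.inrₗ q) - X (Sum.inlₗ q) * X (Sum.inrₗ p)

/-- The binomial of an edge, with the sign given by the order of the vertices. -/
def edgeBinom (e : Sym2 (Fin n)) : MvPolynomial (EdgeVar n) K := binom K e.inf e.sup

variable {K}

lemma binom_swap (p q : Fin n) : binom K q p = - binom K p q := by
  simp only [binom]; ring

lemma edgeBinom_mk (p q : Fin n) :
    edgeBinom K s(p, q) = binom K p q ∨ edgeBinom K s(p, q) = - binom K p q := by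
  rw [edgeBinom, Sym2.inf_mk, Sym2.sup_mk]
  rcases le_total p q with h | h
  · left; rw [inf_eq_left.2 h, sup_eq_right.2 h]
  · right; rw [inf_eq_right.2 h, sup_eq_left.2 h, binom_swap]

lemma edgeBinom_mem_iff {A : Ideal (MvPolynomial (EdgeVar n) K)} (p q : Fin n) :
    edgeBinom K s(p, q) ∈ A ↔ binom K p q ∈ A := by
  rcases edgeBinom_mk (K := K) p q with h | h <;> rw [h]
  exact neg_mem_iff

lemma isHomogeneous_edgeBinom (e : Sym2 (Fin n)) : (edgeBinom K e).IsHomogeneous 2 :=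
  ((isHomogeneous_X K _).mul (isHomogeneous_X K _)).sub
    ((isHomogeneous_X K _).mul (isHomogeneous_X K _))

lemma binomialEdgeIdeal_eq_span (G : SimpleGraph (Fin n)) :
    binomialEdgeIdeal K G = Ideal.span (edgeBinom K '' G.edgeSet) := by
  rw [binomialEdgeIdeal]
  congr 1
  ext f
  constructor
  · rintro ⟨i, j, hij, h, rfl⟩
    refine ⟨s(i, j), h, ?_⟩
    rw [edgeBinom, Sym2.inf_mk, Sym2.sup_mk, inf_eq_left.2 hij.le, sup_eq_right.2 hij.le, binom]
  · rintro ⟨e, he, rfl⟩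
    induction e with
    | _ i j =>
      have hij : G.Adj i j := he
      rw [edgeBinom, Sym2.inf_mk, Sym2.sup_mk]
      rcases lt_or_gt_of_ne hij.ne with h | h
      · rw [inf_eq_left.2 h.le, sup_eq_right.2 h.le]
        exact ⟨i, j, h, hij, rfl⟩
      · rw [inf_eq_right.2 h.le, sup_eq_left.2 h.le]
        exact ⟨j, i, h, hij.symm, rfl⟩

lemma binomialEdgeIdeal_le_iff {G : SimpleGraph (Fin n)}
    {A : Ideal (MvPolynomial (EdgeVar n) K)} :
    binomialEdgeIdeal K G ≤ A ↔ ∀ p q, G.Adj p q → binom K p q ∈ A := by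
  rw [binomialEdgeIdeal_eq_span, Ideal.span_le, Set.image_subset_iff]
  constructor
  · intro h p q hpq
    exact (edgeBinom_mem_iff p q).1 (h (show s(p, q) ∈ G.edgeSet from hpq))
  · intro h e he
    induction e with
    | _ p q => exact (edgeBinom_mem_iff p q).2 (h p q he)

section Height

open Classical in
/-- A point with coordinates one outside `T` and zero on `T`. -/
def indicatorPoint (K : Type*) [Field K] (T : Finset (Fin n)) (v : EdgeVar n) : K :=
  Sum.elim (fun i => if i ∈ T then 0 else 1) (fun i => if i ∈ T then 0 else 1) (ofLex v)

lemma indicatorPoint_inl (T : Finset (Fin n)) (i : Fin n) :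
    indicatorPoint K T (Sum.inlₗ i) = if i ∈ T then 0 else 1 := rfl

lemma indicatorPoint_inr (T : Finset (Fin n)) (i : Fin n) :
    indicatorPoint K T (Sum.inrₗ i) = if i ∈ T then 0 else 1 := rfl

lemma eval_edgeBinom (T : Finset (Fin n)) (e : Sym2 (Fin n)) :
    eval (indicatorPoint K T) (edgeBinom K e) = 0 := by
  simp only [edgeBinom, binom, map_sub, map_mul, eval_X, indicatorPoint_inl, indicatorPoint_inr]
  split_ifs <;> simp

/-- Along a walk, `x_v f_uw = x_u f_vw + x_w f_uv`, and `x_v` may be cancelled because it lies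
outside the prime. -/
lemma binom_mem_of_reachable {A : Ideal (MvPolynomial (EdgeVar n) K)} [A.IsPrime]
    {F : SimpleGraph (Fin n)} (hF : ∀ p q, F.Adj p q → binom K p q ∈ A)
    (hx : ∀ p q, F.Adj p q → (X (Sum.inlₗ p) : MvPolynomial (EdgeVar n) K) ∉ A) {p q : Fin n}
    (h : F.Reachable p q) : binom K p q ∈ A := by
  obtain ⟨w⟩ := h
  induction w with
  | nil => simp [binom]
  | cons hadj w ih =>
    rename_i u v w'
    refine (Ideal.IsPrime.mem_or_mem ‹A.IsPrime› (x := X (Sum.inlₗ v)) ?_).resolve_left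
      (hx _ _ hadj.symm)
    have e1 : X (Sum.inlₗ v) * binom K u w' =
        X (Sum.inlₗ u) * binom K v w' + X (Sum.inlₗ w') * binom K u v := by
      simp only [binom]; ring
    rw [e1]
    exact add_mem (Ideal.mul_mem_left _ _ ih) (Ideal.mul_mem_left _ _ (hF _ _ hadj))

/-- An upper bound for the height of a binomial edge ideal. -/
theorem height_binomialEdgeIdeal_le (G : SimpleGraph (Fin n)) (T : Finset (Fin n))
    (F : Finset (Sym2 (Fin n))) (hF : ∀ e ∈ F, ∀ t ∈ T, t ∉ e)
    (hG : ∀ p q, G.Adj p q → p ∉ T → q ∉ T →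
      (SimpleGraph.fromEdgeSet (F : Set (Sym2 (Fin n)))).Reachable p q) :
    (binomialEdgeIdeal K G).height ≤ (2 * T.card + F.card : ℕ) := by
  classical
  let g : Finset (MvPolynomial (EdgeVar n) K) :=
    T.image (fun t => X (Sum.inlₗ t)) ∪ T.image (fun t => X (Sum.inrₗ t)) ∪ F.image (edgeBinom K)
  have hg : g.card ≤ 2 * T.card + F.card := by
    refine (Finset.card_union_le _ _).trans (add_le_add ?_ Finset.card_image_le)
    refine (Finset.card_union_le _ _).trans ?_
    rw [two_mul]
    exact add_le_add Finset.card_image_le Finset.card_image_le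
  have hprime : (RingHom.ker (eval (indicatorPoint K T))).IsPrime := RingHom.ker_isPrime _
  have hle : Ideal.span (g : Set _) ≤ RingHom.ker (eval (indicatorPoint K T)) := by
    rw [Ideal.span_le]
    intro f hf
    rw [SetLike.mem_coe, RingHom.mem_ker]
    rw [Finset.mem_coe, Finset.mem_union, Finset.mem_union] at hf
    rcases hf with (hf | hf) | hf
    · obtain ⟨t, ht, rfl⟩ := Finset.mem_image.1 hf
      rw [eval_X, indicatorPoint_inl, if_pos ht]
    · obtain ⟨t, ht, rfl⟩ := Finset.mem_image.1 hf
      rw [eval_X, indicatorPoint_inr, if_pos ht]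
    · obtain ⟨e, he, rfl⟩ := Finset.mem_image.1 hf
      exact eval_edgeBinom T e
  -- A minimal prime below the ideal of this point avoids `x_p` for `p ∉ T`, as needed to propagate
  -- binomials along `F`; Krull's theorem bounds its height.
  obtain ⟨P, hP, hPle⟩ := Ideal.exists_minimalPrimes_le hle
  have : P.IsPrime := hP.1.1
  have hgP : ∀ f ∈ g, f ∈ P := fun f hf => hP.1.2 (Ideal.subset_span hf)
  have hxT : ∀ t ∈ T, (X (Sum.inlₗ t) : MvPolynomial (EdgeVar n) K) ∈ P := fun t ht =>
    hgP _ (Finset.mem_union_left _ (Finset.mem_union_left _ (Finset.mem_image_of_mem _ ht)))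
  have hyT : ∀ t ∈ T, (X (Sum.inrₗ t) : MvPolynomial (EdgeVar n) K) ∈ P := fun t ht =>
    hgP _ (Finset.mem_union_left _ (Finset.mem_union_right _ (Finset.mem_image_of_mem _ ht)))
  have hJ : binomialEdgeIdeal K G ≤ P := by
    rw [binomialEdgeIdeal_le_iff]
    intro p q hpq
    by_cases hp : p ∈ T
    · exact sub_mem (Ideal.mul_mem_right _ _ (hxT p hp)) (Ideal.mul_mem_left _ _ (hyT p hp))
    by_cases hq : q ∈ T
    · exact sub_mem (Ideal.mul_mem_left _ _ (hyT q hq)) (Ideal.mul_mem_right _ _ (hxT q hq))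
    refine binom_mem_of_reachable (fun u v huv => ?_) (fun u v huv hu => ?_) (hG p q hpq hp hq)
    · rw [SimpleGraph.fromEdgeSet_adj] at huv
      rw [← edgeBinom_mem_iff]
      exact hgP _ (Finset.mem_union_right _ (Finset.mem_image_of_mem _ huv.1))
    · rw [SimpleGraph.fromEdgeSet_adj] at huv
      have h1 := hPle hu
      rw [RingHom.mem_ker, eval_X, indicatorPoint_inl, if_neg] at h1
      · exact one_ne_zero h1
      · exact fun ht => hF _ huv.1 u ht (Sym2.mem_mk_left u v)
  calc (binomialEdgeIdeal K G).height ≤ P.height := Ideal.height_mono hJ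
    _ ≤ g.card := Ideal.height_le_card_of_mem_minimalPrimes_span_finset hP
    _ ≤ (2 * T.card + F.card : ℕ) := by exact_mod_cast hg

end Height

section Generators

/-- `J_G` starts in degree two, so only the constant term of the multiplier counts there. -/
lemma homogeneousComponent_two_mul {G : SimpleGraph (Fin n)} {p : MvPolynomial (EdgeVar n) K}
    (hp : p ∈ binomialEdgeIdeal K G) (a : MvPolynomial (EdgeVar n) K) :
    homogeneousComponent 2 (a * p) = coeff 0 a • homogeneousComponent 2 p := by
  rw [binomialEdgeIdeal_eq_span] at hp
  induction hp using Submodule.span_induction generalizing a with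
  | mem f hf =>
    obtain ⟨e, -, rfl⟩ := hf
    rw [mul_comm, homogeneousComponent_mul_of_isHomogeneous (isHomogeneous_edgeBinom e) 0,
      homogeneousComponent_eq_self (isHomogeneous_edgeBinom e), homogeneousComponent_zero,
      mul_comm, ← smul_eq_C_mul]
  | zero => simp
  | add x y _ _ hx hy => rw [mul_add, map_add, hx, hy, map_add, smul_add]
  | smul b x _ hx =>
    rw [smul_eq_mul, ← mul_assoc, hx, hx, smul_smul, ← constantCoeff_eq, map_mul]

/-- The monomial `x_p y_q`, for `p ≤ q` the vertices of an edge. -/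
def edgeMonomial (e : Sym2 (Fin n)) : EdgeVar n →₀ ℕ :=
  Finsupp.single (Sum.inlₗ e.inf) 1 + Finsupp.single (Sum.inrₗ e.sup) 1

/-- The monomial `x_p y_q` with `p < q` occurs only in the binomial of its own edge; linear
independence follows. -/
lemma coeff_edgeBinom {e e' : Sym2 (Fin n)} (he : ¬ e.IsDiag) (he' : ¬ e'.IsDiag) :
    coeff (edgeMonomial e') (edgeBinom K e) = if e = e' then 1 else 0 := by
  have key : ∀ p q : Fin n, coeff (edgeMonomial e')
      (X (Sum.inlₗ p) * X (Sum.inrₗ q) : MvPolynomial (EdgeVar n) K) =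
        if p = e'.inf ∧ q = e'.sup then 1 else 0 := by
    intro p q
    have h1 : (X (Sum.inlₗ p) * X (Sum.inrₗ q) : MvPolynomial (EdgeVar n) K) =
        monomial (Finsupp.single (Sum.inlₗ p) 1 + Finsupp.single (Sum.inrₗ q) 1) 1 := by
      rw [X, X, monomial_mul, one_mul]
    rw [h1, coeff_monomial]
    congr 1
    rw [edgeMonomial, eq_iff_iff]
    constructor
    · intro h
      have h2 := DFunLike.congr_fun h (Sum.inlₗ p)
      have h3 := DFunLike.congr_fun h (Sum.inrₗ q)
      simp [Finsupp.single_apply, Sum.inlₗ, Sum.inrₗ] at h2 h3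
      exact ⟨h2.symm, h3.symm⟩
    · rintro ⟨rfl, rfl⟩; rfl
  have hlt : ∀ e : Sym2 (Fin n), ¬ e.IsDiag → e.inf < e.sup := by
    intro e h
    induction e with
    | _ p q =>
      rw [Sym2.mk_isDiag_iff] at h
      rw [Sym2.inf_mk, Sym2.sup_mk]
      exact inf_lt_sup.2 h
  rw [edgeBinom, binom, coeff_sub, key, key]
  have h1 := hlt e he
  have h2 := hlt e' he'
  rw [if_neg (c := e.sup = e'.inf ∧ _), sub_zero]
  · simp only [Sym2.inf_eq_inf_and_sup_eq_sup]
  · rintro ⟨h3, h4⟩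
    rw [h3, h4] at h1
    exact lt_asymm h1 h2

/-- The edge binomials minimally generate the binomial edge ideal. -/
theorem card_edgeFinset_le_spanFinrank (G : SimpleGraph (Fin n)) [Fintype G.edgeSet] :
    G.edgeFinset.card ≤ Submodule.spanFinrank (binomialEdgeIdeal K G) := by
  classical
  obtain ⟨s, hs, hspan⟩ := Submodule.FG.exists_span_finset_card_eq_spanFinrank
    (IsNoetherian.noetherian (binomialEdgeIdeal K G))
  rw [← hs]
  -- The degree-two parts of any generating set span over `K` all degree-two parts of the ideal,
  -- among them the independent edge binomials.
  let V : Submodule K (MvPolynomial (EdgeVar n) K) :=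
    Submodule.span K (s.image (homogeneousComponent 2) : Finset (MvPolynomial (EdgeVar n) K))
  have hV : ∀ p ∈ binomialEdgeIdeal K G, homogeneousComponent 2 p ∈ V := by
    intro p hp
    rw [← hspan] at hp
    obtain ⟨a, ha⟩ := (Submodule.mem_span_finset).1 hp
    rw [← ha.2, map_sum]
    refine sum_mem fun x hx => ?_
    have hxJ : x ∈ binomialEdgeIdeal K G := by rw [← hspan]; exact Submodule.subset_span hx
    rw [smul_eq_mul, homogeneousComponent_two_mul hxJ]
    exact Submodule.smul_mem _ _
      (Submodule.subset_span (Finset.mem_coe.2 (Finset.mem_image_of_mem _ hx)))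
  have hmem : ∀ e : G.edgeSet, edgeBinom K e.1 ∈ V := by
    intro e
    rw [← homogeneousComponent_eq_self (isHomogeneous_edgeBinom (K := K) e.1)]
    refine hV _ ?_
    rw [binomialEdgeIdeal_eq_span]
    exact Ideal.subset_span ⟨e.1, e.2, rfl⟩
  have hli : LinearIndependent K fun e : G.edgeSet => (⟨edgeBinom K e.1, hmem e⟩ : V) := by
    rw [Fintype.linearIndependent_iff]
    intro a ha e
    have h1 := congrArg (fun v : V => coeff (edgeMonomial e.1) v.1) ha
    simp only [Submodule.coe_sum, Submodule.coe_smul, coeff_sum, coeff_smul,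
      ZeroMemClass.coe_zero, coeff_zero] at h1
    rw [Finset.sum_eq_single e] at h1
    · rwa [coeff_edgeBinom (G.not_isDiag_of_mem_edgeSet e.2) (G.not_isDiag_of_mem_edgeSet e.2),
        if_pos rfl, smul_eq_mul, mul_one] at h1
    · intro e' _ hne
      rw [coeff_edgeBinom (G.not_isDiag_of_mem_edgeSet e'.2) (G.not_isDiag_of_mem_edgeSet e.2),
        if_neg (fun h => hne (Subtype.ext h)), smul_zero]
    · simp
  have : Module.Finite K V := Module.Finite.span_finset K _
  calc G.edgeFinset.card = Fintype.card G.edgeSet := Set.toFinset_card _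
    _ ≤ Module.finrank K V := hli.fintype_card_le_finrank
    _ ≤ (s.image (homogeneousComponent 2)).card := finrank_span_finset_le_card _
    _ ≤ s.card := Finset.card_image_le

end Generators

end EdgeIdeal

end Koszul

/-! ### Graphs that are a path with one further edge. -/

namespace SimpleGraph

variable {V : Type*} [Fintype V] {G : SimpleGraph V}

/-- The first `m` values of `f` are distinct and form a path. -/
def IsPathSeq (G : SimpleGraph V) (f : ℕ → V) (m : ℕ) : Prop :=
  (∀ i < m, ∀ j < m, f i = f j → i = j) ∧ ∀ i, i + 1 < m → G.Adj (f i) (f (i + 1))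

lemma IsPathSeq.le_card {f : ℕ → V} {m : ℕ} (h : G.IsPathSeq f m) : m ≤ Fintype.card V := by
  have := Fintype.card_le_of_injective (fun i : Fin m => f i)
    fun i j hij => Fin.ext (h.1 i i.2 j j.2 hij)
  rwa [Fintype.card_fin] at this

lemma IsPathSeq.cons {f : ℕ → V} {m : ℕ} (h : G.IsPathSeq f m) {z : V}
    (hz : ∀ i < m, f i ≠ z) (hadj : G.Adj z (f 0)) :
    G.IsPathSeq (fun i => if i = 0 then z else f (i - 1)) (m + 1) := by
  refine ⟨fun i hi j hj hij => ?_, fun i hi => ?_⟩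
  · rcases i with _ | i <;> rcases j with _ | j
    · rfl
    · exact (hz j (by omega) (by simpa using hij.symm)).elim
    · exact (hz i (by omega) (by simpa using hij)).elim
    · rw [h.1 i (by omega) j (by omega) (by simpa using hij)]
  · rcases i with _ | i
    · simpa using hadj
    · simpa using h.2 i (by omega)

lemma IsPathSeq.snoc {f : ℕ → V} {m : ℕ} (h : G.IsPathSeq f (m + 1)) {z : V}
    (hz : ∀ i < m + 1, f i ≠ z) (hadj : G.Adj (f m) z) :
    G.IsPathSeq (fun i => if i = m + 1 then z else f i) (m + 2) := by
  refine ⟨fun i hi j hj hij => ?_, fun i hi => ?_⟩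
  · by_cases h1 : i = m + 1 <;> by_cases h2 : j = m + 1
    · rw [h1, h2]
    · simp only [h1, h2, if_true, if_false] at hij
      exact (hz j (by omega) hij.symm).elim
    · simp only [h1, h2, if_true, if_false] at hij
      exact (hz i (by omega) hij).elim
    · simp only [h1, h2, if_false] at hij
      exact h.1 i (by omega) j (by omega) hij
  · simp only [if_neg (show i ≠ m + 1 by omega)]
    split_ifs with h1
    · obtain rfl : i = m := by omega
      exact hadj
    · exact h.2 i (by omega)

/-- A connected graph of maximum degree at most two has a Hamiltonian path. -/
theorem Connected.exists_isPathSeq [DecidableRel G.Adj] (hG : G.Connected)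
    (hdeg : ∀ v, G.degree v ≤ 2) :
    ∃ f : ℕ → V, G.IsPathSeq f (Fintype.card V) := by
  classical
  obtain ⟨v₀⟩ := hG.nonempty
  have h1 : ∃ f, G.IsPathSeq f 1 := ⟨fun _ => v₀, fun i hi j hj _ => by omega,
    fun i hi => by omega⟩
  have hpos : 1 ≤ Fintype.card V := Fintype.card_pos_iff.2 ⟨v₀⟩
  -- A longest path missing a vertex is left by some edge. Leaving at an end extends the path;
  -- leaving at an inner vertex gives that vertex a third neighbour.
  set m := Nat.findGreatest (fun m => ∃ f, G.IsPathSeq f m) (Fintype.card V) with hm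
  obtain ⟨f, hf⟩ : ∃ f, G.IsPathSeq f m :=
    Nat.findGreatest_spec (P := fun m => ∃ f, G.IsPathSeq f m) hpos h1
  have hm1 : 1 ≤ m := Nat.le_findGreatest hpos h1
  have hmax : ¬ ∃ f, G.IsPathSeq f (m + 1) := by
    intro h
    have := Nat.le_findGreatest (P := fun m => ∃ f, G.IsPathSeq f m) h.choose_spec.le_card h
    omega
  rcases hf.le_card.eq_or_lt with h | h
  · exact ⟨f, h ▸ hf⟩
  exfalso
  obtain ⟨z₀, hz₀⟩ : ∃ z, z ∉ f '' Set.Iio m := by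
    by_contra! hall
    have : (Finset.univ : Finset V) ⊆ (Finset.range m).image f := by
      intro z _
      obtain ⟨i, hi, rfl⟩ := hall z
      exact Finset.mem_image_of_mem f (Finset.mem_range.2 hi)
    have := (Finset.card_le_card this).trans Finset.card_image_le
    rw [Finset.card_univ, Finset.card_range] at this
    omega
  obtain ⟨p⟩ := hG.preconnected (f 0) z₀
  obtain ⟨⟨⟨w, z⟩, hwz⟩, -, ⟨k, hk, rfl⟩, hz⟩ :=
    p.exists_boundary_dart (f '' Set.Iio m) ⟨0, hm1, rfl⟩ hz₀
  have hz' : ∀ i < m, f i ≠ z := fun i hi hiz => hz ⟨i, hi, hiz⟩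
  rw [Set.mem_Iio] at hk
  rcases Nat.eq_zero_or_pos k with rfl | hk0
  · exact hmax ⟨_, hf.cons hz' hwz.symm⟩
  rcases (Nat.succ_le_of_lt hk).eq_or_lt with hkm | hkm
  · have hf' := hf
    rw [← hkm] at hf' hz' hmax
    exact hmax ⟨_, hf'.snoc hz' hwz⟩
  have h3 : ({f (k - 1), f (k + 1), z} : Finset V).card = 3 := by
    rw [Finset.card_eq_three]
    refine ⟨_, _, _, fun h => ?_, hz' _ (by omega), hz' _ hkm, rfl⟩
    have := hf.1 _ (by omega) _ hkm h
    omega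
  have h4 : ({f (k - 1), f (k + 1), z} : Finset V) ⊆ G.neighborFinset (f k) := by
    intro x hx
    rw [mem_neighborFinset]
    simp only [Finset.mem_insert, Finset.mem_singleton] at hx
    rcases hx with rfl | rfl | rfl
    · have := hf.2 (k - 1) (by omega)
      rw [Nat.sub_add_cancel hk0] at this
      exact this.symm
    · exact hf.2 k hkm
    · exact hwz
  have h5 := Finset.card_le_card h4
  rw [h3, card_neighborFinset_eq_degree] at h5
  exact absurd (hdeg (f k)) (by omega)

lemma IsPathSeq.adj_iff {f : ℕ → V} [Fintype G.edgeSet] (h : G.IsPathSeq f (Fintype.card V))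
    (hcard : G.edgeFinset.card ≤ Fintype.card V - 1) {i j : ℕ} (hij : i < j)
    (hj : j < Fintype.card V) : G.Adj (f i) (f j) ↔ j = i + 1 := by
  classical
  have hinj : Set.InjOn (fun k => s(f k, f (k + 1))) (Finset.range (Fintype.card V - 1)) := by
    intro k hk l hl hkl
    rw [Finset.mem_coe, Finset.mem_range] at hk hl
    rcases Sym2.eq_iff.1 hkl with ⟨h1, -⟩ | ⟨h1, h2⟩
    · exact h.1 _ (by omega) _ (by omega) h1
    · have := h.1 _ (by omega) _ (by omega) h1
      have := h.1 _ (by omega) _ (by omega) h2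
      omega
  have hsub : (Finset.range (Fintype.card V - 1)).image (fun k => s(f k, f (k + 1))) ⊆
      G.edgeFinset := by
    intro e he
    obtain ⟨k, hk, rfl⟩ := Finset.mem_image.1 he
    rw [Finset.mem_range] at hk
    rw [mem_edgeFinset]
    exact h.2 k (by omega)
  have heq := Finset.eq_of_subset_of_card_le hsub
    (by rw [Finset.card_image_of_injOn hinj, Finset.card_range]; exact hcard)
  constructor
  · intro hadj
    have h1 : s(f i, f j) ∈ G.edgeFinset := by rw [mem_edgeFinset]; exact hadj
    rw [← heq] at h1
    obtain ⟨k, hk, he⟩ := Finset.mem_image.1 h1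
    rw [Finset.mem_range] at hk
    rcases Sym2.eq_iff.1 he with ⟨h2, h3⟩ | ⟨h2, h3⟩
    · have := h.1 _ (by omega) _ (by omega) h2
      have := h.1 _ (by omega) _ (by omega) h3
      omega
    · have := h.1 _ (by omega) _ (by omega) h2
      have := h.1 _ (by omega) _ (by omega) h3
      omega
  · rintro rfl
    exact h.2 i hj

/-- If `uv` is an edge of the cycle, the rest of the cycle joins its ends; otherwise the cycle does
not use it. -/
lemma Subgraph.IsCycleSubgraph.reachable_deleteEdges {H : G.Subgraph} (hH : H.IsCycleSubgraph)
    {u v : V} (hu : u ∈ H.verts) (hv : v ∈ H.verts) :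
    (H.spanningCoe.deleteEdges {s(u, v)}).Reachable u v := by
  by_cases h : H.Adj u v
  · have hc : H.spanningCoe.IsCycles := fun w hw => by
      obtain ⟨x, hx⟩ := hw
      exact hH.2 w (H.edge_vert hx)
    exact hc.reachable_deleteEdges (v := u) (w := v) h
  · have hr := hH.1.coe.preconnected ⟨u, hu⟩ ⟨v, hv⟩
    let φ : H.coe →g H.spanningCoe.deleteEdges {s(u, v)} :=
      ⟨Subtype.val, fun {a b} hab => by
        have hab' : H.Adj a b := hab
        rw [SimpleGraph.deleteEdges_adj]
        refine ⟨hab', fun hs => h ?_⟩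
        rcases Sym2.eq_iff.1 hs with ⟨h1, h2⟩ | ⟨h1, h2⟩
        · rwa [h1, h2] at hab'
        · rw [h1, h2] at hab'; exact hab'.symm⟩
    exact hr.map φ

lemma Subgraph.IsCycleSubgraph.exists_adj {H : G.Subgraph} (hH : H.IsCycleSubgraph)
    {u : V} (hu : u ∈ H.verts) : ∃ v, H.Adj u v := by
  have h := hH.2 u hu
  obtain ⟨v, hv⟩ : (H.neighborSet u).Nonempty := by
    rw [Set.nonempty_iff_ne_empty]
    intro h0
    rw [h0, Set.ncard_empty] at h
    omega
  exact ⟨v, hv⟩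

lemma degree_deleteEdges_le [DecidableEq V] [DecidableRel G.Adj] {u v : V} (huv : G.Adj u v)
    (hon : ∀ w, G.degree w ≤ 3) (hall : ∀ w, 3 ≤ G.degree w → w = u ∨ w = v) (w : V) :
    (G.deleteEdges {s(u, v)}).degree w ≤ 2 := by
  have hsub : ∀ w x, x ∈ (G.deleteEdges {s(u, v)}).neighborFinset w →
      x ∈ G.neighborFinset w ∧ s(w, x) ≠ s(u, v) := by
    intro w x hx
    rw [mem_neighborFinset, deleteEdges_adj] at hx
    rw [mem_neighborFinset]
    exact ⟨hx.1, fun h => hx.2 (Set.mem_singleton_iff.2 h)⟩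
  have hdrop : ∀ w x, G.Adj w x → s(w, x) = s(u, v) → (G.deleteEdges {s(u, v)}).degree w ≤ 2 := by
    intro w x hwx hs
    have h1 : (G.deleteEdges {s(u, v)}).neighborFinset w ⊆ (G.neighborFinset w).erase x := by
      intro y hy
      refine Finset.mem_erase.2 ⟨?_, (hsub w y hy).1⟩
      rintro rfl
      exact (hsub w y hy).2 hs
    have h2 := Finset.card_le_card h1
    rw [Finset.card_erase_of_mem (by rwa [mem_neighborFinset]), card_neighborFinset_eq_degree,
      card_neighborFinset_eq_degree] at h2
    have := hon w
    omega
  by_cases hw : 3 ≤ G.degree w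
  · rcases hall w hw with rfl | rfl
    · exact hdrop _ v huv rfl
    · exact hdrop _ u huv.symm Sym2.eq_swap
  · have h2 := Finset.card_le_card (show (G.deleteEdges {s(u, v)}).neighborFinset w ⊆
      G.neighborFinset w from fun x hx => (hsub w x hx).1)
    rw [card_neighborFinset_eq_degree, card_neighborFinset_eq_degree] at h2
    omega

/-- Vertices of degree at least three lie on the cycle and are pairwise adjacent by `hnonadj`;
without triangles there are at most two. The edge joining the two works, or else a cycle edge at the
single one (or anywhere). -/
lemma Subgraph.IsCycleSubgraph.exists_edge [DecidableRel G.Adj] {H : G.Subgraph}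
    (hH : H.IsCycleSubgraph) (htri : ∀ u v w, G.Adj u v → G.Adj v w → ¬ G.Adj w u)
    (hoff : ∀ v, v ∉ H.verts → G.degree v ≤ 2)
    (hnonadj : ∀ u v, u ≠ v → ¬ G.Adj u v → G.degree u + G.degree v ≤ 5) :
    ∃ u v, G.Adj u v ∧ (G.deleteEdges {s(u, v)}).Reachable u v ∧
      ∀ w, 3 ≤ G.degree w → w = u ∨ w = v := by
  have hmemH : ∀ v, 3 ≤ G.degree v → v ∈ H.verts := by
    intro v hv
    by_contra h
    have := hoff v h
    omega
  have hreach : ∀ u v, u ∈ H.verts → v ∈ H.verts →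
      (G.deleteEdges {s(u, v)}).Reachable u v := fun u v hu hv =>
    (hH.reachable_deleteEdges hu hv).mono (by
      intro a b hab
      rw [SimpleGraph.deleteEdges_adj] at hab ⊢
      exact ⟨H.adj_sub hab.1, hab.2⟩)
  by_cases h2 : ∃ u v, u ≠ v ∧ 3 ≤ G.degree u ∧ 3 ≤ G.degree v
  · obtain ⟨u, v, hne, hu, hv⟩ := h2
    have hadj : ∀ u v, u ≠ v → 3 ≤ G.degree u → 3 ≤ G.degree v → G.Adj u v := by
      intro u v hne hu hv
      by_contra h
      have := hnonadj u v hne h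
      omega
    refine ⟨u, v, hadj u v hne hu hv, hreach u v (hmemH u hu) (hmemH v hv), fun w hw => ?_⟩
    by_contra! h
    exact htri u v w (hadj u v hne hu hv) (hadj v w h.2.symm hv hw) (hadj w u h.1 hw hu)
  · push Not at h2
    obtain ⟨u, hu, hu'⟩ : ∃ u ∈ H.verts, ∀ w, 3 ≤ G.degree w → w = u := by
      by_cases h1 : ∃ u, 3 ≤ G.degree u
      · obtain ⟨u, hu⟩ := h1
        refine ⟨u, hmemH u hu, fun w hw => ?_⟩
        by_contra hne
        have := h2 w u hne hw
        omega
      · push Not at h1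
        obtain ⟨u, hu⟩ := hH.1.nonempty
        exact ⟨u, hu, fun w hw => absurd (h1 w) (by omega)⟩
    obtain ⟨v, hv⟩ := hH.exists_adj hu
    exact ⟨u, v, H.adj_sub hv, hreach u v hu (H.edge_vert hv.symm), fun w hw => Or.inl (hu' w hw)⟩

/-- A connected graph with a cycle and at most as many edges as vertices, with suitable bounds on
the degrees, is obtained from a path by adding an edge. -/
theorem Connected.exists_path_add_edge [DecidableEq V] [DecidableRel G.Adj]
    (hG : G.Connected) {H : G.Subgraph}
    (hH : H.IsCycleSubgraph) (hcard : G.edgeFinset.card ≤ Fintype.card V)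
    (htri : ∀ u v w, G.Adj u v → G.Adj v w → ¬ G.Adj w u)
    (hon : ∀ v, G.degree v ≤ 3) (hoff : ∀ v, v ∉ H.verts → G.degree v ≤ 2)
    (hnonadj : ∀ u v, u ≠ v → ¬ G.Adj u v → G.degree u + G.degree v ≤ 5) :
    ∃ (f : ℕ → V) (a b : ℕ), (∀ i < Fintype.card V, ∀ j < Fintype.card V, f i = f j → i = j) ∧
      a + 2 ≤ b ∧ b < Fintype.card V ∧ ∀ i j, i < j → j < Fintype.card V →
        (G.Adj (f i) (f j) ↔ j = i + 1 ∨ (i = a ∧ j = b)) := by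
  obtain ⟨u, v, huv, hr, hall⟩ := hH.exists_edge htri hoff hnonadj
  have hdeg := degree_deleteEdges_le huv hon hall
  set G' := G.deleteEdges {s(u, v)} with hG'
  have hconn : G'.Connected :=
    hG.connected_delete_edge_of_not_isBridge (by rw [isBridge_iff, not_not]; exact hr)
  obtain ⟨f, hf⟩ := hconn.exists_isPathSeq hdeg
  have hcard' : G'.edgeFinset.card ≤ Fintype.card V - 1 := by
    have h1 : G'.edgeFinset ⊆ G.edgeFinset.erase s(u, v) := by
      intro e he
      rw [mem_edgeFinset, hG', edgeSet_deleteEdges] at he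
      refine Finset.mem_erase.2 ⟨fun h => he.2 (Set.mem_singleton_iff.2 h), ?_⟩
      rw [mem_edgeFinset]
      exact he.1
    have h2 := Finset.card_le_card h1
    rw [Finset.card_erase_of_mem (by rw [mem_edgeFinset]; exact huv)] at h2
    omega
  have hsurj : ∀ w, ∃ i < Fintype.card V, f i = w := by
    intro w
    have hbij := (Fintype.bijective_iff_injective_and_card
      (fun i : Fin (Fintype.card V) => f i)).2
      ⟨fun i j hij => Fin.ext (hf.1 i i.2 j j.2 hij), by rw [Fintype.card_fin]⟩
    obtain ⟨i, hi⟩ := hbij.2 w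
    exact ⟨i, i.2, hi⟩
  obtain ⟨a, b, hab, hb, hs⟩ : ∃ a b, a < b ∧ b < Fintype.card V ∧ s(f a, f b) = s(u, v) := by
    obtain ⟨a, ha, rfl⟩ := hsurj u
    obtain ⟨b, hb, rfl⟩ := hsurj v
    rcases lt_trichotomy a b with h | h | h
    · exact ⟨a, b, h, hb, rfl⟩
    · rw [h] at huv; exact (G.irrefl huv).elim
    · exact ⟨b, a, h, ha, Sym2.eq_swap⟩
  have hadj' : ∀ i j, G'.Adj (f i) (f j) ↔ G.Adj (f i) (f j) ∧ s(f i, f j) ≠ s(f a, f b) := by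
    intro i j
    rw [hG', deleteEdges_adj, hs]
    rfl
  have hGab : G.Adj (f a) (f b) := by
    rw [← mem_edgeSet, hs]; exact huv
  refine ⟨f, a, b, hf.1, ?_, hb, fun i j hij hj => ?_⟩
  · by_contra h
    obtain rfl : b = a + 1 := by omega
    exact ((hadj' a (a + 1)).1 (hf.2 a hb)).2 rfl
  · rw [← hf.adj_iff hcard' hij hj, hadj']
    constructor
    · intro h
      by_cases he : s(f i, f j) = s(f a, f b)
      · right
        rcases Sym2.eq_iff.1 he with ⟨h1, h2⟩ | ⟨h1, h2⟩
        · exact ⟨hf.1 _ (by omega) _ (by omega) h1, hf.1 _ (by omega) _ (by omega) h2⟩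
        · have := hf.1 _ (by omega) _ (by omega) h1
          have := hf.1 _ (by omega) _ (by omega) h2
          omega
      · exact Or.inl ⟨h, he⟩
    · rintro (h | ⟨rfl, rfl⟩)
      · exact h.1
      · exact hGab

end SimpleGraph

/-! ### Classification of the graphs. -/

namespace Koszul

section Classification

variable {K : Type*} [Field K] {n : ℕ} {G : SimpleGraph (Fin n)}

/-- Sets the number of generators against the height bound; the restrictions on edges and degrees
below are instances for suitable `T` and `F`. -/
lemma card_edgeFinset_le [Fintype G.edgeSet]
    (haci : (binomialEdgeIdeal K G).IsAlmostCompleteIntersection)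
    (T : Finset (Fin n)) (F : Finset (Sym2 (Fin n))) (hF : ∀ e ∈ F, ∀ t ∈ T, t ∉ e)
    (hG : ∀ p q, G.Adj p q → p ∉ T → q ∉ T →
      (SimpleGraph.fromEdgeSet (F : Set (Sym2 (Fin n)))).Reachable p q) :
    G.edgeFinset.card ≤ 2 * T.card + F.card + 1 := by
  have h1 := card_edgeFinset_le_spanFinrank (K := K) G
  have h2 := height_binomialEdgeIdeal_le (K := K) G T F hF hG
  rw [Ideal.IsAlmostCompleteIntersection] at haci
  have h3 : (Submodule.spanFinrank (binomialEdgeIdeal K G) : ℕ∞) ≤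
      (2 * T.card + F.card + 1 : ℕ) := by
    rw [haci, Nat.cast_add _ 1, Nat.cast_one]
    gcongr
  exact h1.trans (by exact_mod_cast h3)

lemma reachable_fromEdgeSet {F : Set (Sym2 (Fin n))} {p q : Fin n} (h : G.Adj p q)
    (hF : s(p, q) ∈ F) : (SimpleGraph.fromEdgeSet F).Reachable p q :=
  SimpleGraph.Adj.reachable (by rw [SimpleGraph.fromEdgeSet_adj]; exact ⟨hF, h.ne⟩)

/-- `T` empty and `F` a spanning tree. -/
lemma card_edgeFinset_le_card [Fintype G.edgeSet]
    (haci : (binomialEdgeIdeal K G).IsAlmostCompleteIntersection) (hG : G.Connected) :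
    G.edgeFinset.card ≤ n := by
  classical
  obtain ⟨T, hT, htree⟩ := hG.exists_isTree_le
  have h := card_edgeFinset_le haci ∅ T.edgeFinset (by simp) fun p q _ _ _ => by
    rw [SimpleGraph.coe_edgeFinset, SimpleGraph.fromEdgeSet_edgeSet]
    exact htree.connected.preconnected p q
  have h2 := htree.card_edgeFinset
  rw [Fintype.card_fin] at h2
  simpa [h2] using h

variable [DecidableRel G.Adj]

lemma card_sdiff_incidenceFinset (v : Fin n) :
    (G.edgeFinset \ G.incidenceFinset v).card + G.degree v = G.edgeFinset.card := by
  rw [← G.card_incidenceFinset_eq_degree v]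
  exact Finset.card_sdiff_add_card_eq_card (G.incidenceFinset_subset v)

lemma notMem_of_mem_sdiff {v : Fin n} {e : Sym2 (Fin n)}
    (he : e ∈ G.edgeFinset \ G.incidenceFinset v) : v ∉ e := by
  rw [Finset.mem_sdiff, SimpleGraph.mem_edgeFinset, SimpleGraph.mem_incidenceFinset] at he
  exact fun h => he.2 ⟨he.1, h⟩

lemma mem_sdiff_of_adj {v p q : Fin n} (h : G.Adj p q) (hp : p ≠ v) (hq : q ≠ v) :
    s(p, q) ∈ G.edgeFinset \ G.incidenceFinset v := by
  rw [Finset.mem_sdiff, SimpleGraph.mem_edgeFinset, SimpleGraph.mem_incidenceFinset]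
  refine ⟨h, fun h' => ?_⟩
  rcases Sym2.mem_iff.1 h'.2 with h1 | h1
  · exact hp h1.symm
  · exact hq h1.symm

/-- `T = {v}` and `F` all edges avoiding `v`. -/
lemma degree_le_three (haci : (binomialEdgeIdeal K G).IsAlmostCompleteIntersection) (v : Fin n) :
    G.degree v ≤ 3 := by
  have h := card_edgeFinset_le haci {v} (G.edgeFinset \ G.incidenceFinset v)
    (fun e he t ht => by rw [Finset.mem_singleton.1 ht]; exact notMem_of_mem_sdiff he)
    fun p q hpq hp hq => reachable_fromEdgeSet hpq (Finset.mem_coe.2 (mem_sdiff_of_adj hpq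
      (by simpa using hp) (by simpa using hq)))
  have h2 := card_sdiff_incidenceFinset (G := G) v
  rw [Finset.card_singleton] at h
  omega

/-- As in `degree_le_three`, but the cycle avoids `v`, so one of its edges can be dropped from `F`
without losing connectivity. -/
lemma degree_le_two (haci : (binomialEdgeIdeal K G).IsAlmostCompleteIntersection)
    {H : G.Subgraph} (hH : H.IsCycleSubgraph) {v : Fin n} (hv : v ∉ H.verts) :
    G.degree v ≤ 2 := by
  obtain ⟨u, hu⟩ := hH.1.nonempty
  obtain ⟨w, huw⟩ := hH.exists_adj hu
  have hw : w ∈ H.verts := H.edge_vert huw.symm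
  have hne : ∀ x ∈ H.verts, x ≠ v := fun x hx hxv => hv (hxv ▸ hx)
  set F := (G.edgeFinset \ G.incidenceFinset v).erase s(u, w) with hF
  have hle : H.spanningCoe.deleteEdges {s(u, w)} ≤
      SimpleGraph.fromEdgeSet (F : Set (Sym2 (Fin n))) := by
    intro a b hab
    rw [SimpleGraph.deleteEdges_adj] at hab
    have hab' : H.Adj a b := hab.1
    rw [SimpleGraph.fromEdgeSet_adj]
    exact ⟨Finset.mem_coe.2 (Finset.mem_erase.2 ⟨fun h => hab.2 (Set.mem_singleton_iff.2 h),
      mem_sdiff_of_adj (H.adj_sub hab') (hne a (H.edge_vert hab'))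
        (hne b (H.edge_vert hab'.symm))⟩), hab'.adj_sub.ne⟩
  have hr := (hH.reachable_deleteEdges hu hw).mono hle
  have h := card_edgeFinset_le haci {v} F
    (fun e he t ht => by
      rw [Finset.mem_singleton.1 ht]; exact notMem_of_mem_sdiff (Finset.mem_of_mem_erase he))
    fun p q hpq hp hq => by
      by_cases hs : s(p, q) = s(u, w)
      · rcases Sym2.eq_iff.1 hs with ⟨rfl, rfl⟩ | ⟨rfl, rfl⟩
        · exact hr
        · exact hr.symm
      · exact reachable_fromEdgeSet hpq (Finset.mem_coe.2 (Finset.mem_erase.2 ⟨hs,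
          mem_sdiff_of_adj hpq (by simpa using hp) (by simpa using hq)⟩))
  have h2 := card_sdiff_incidenceFinset (G := G) v
  have h3 := Finset.card_erase_add_one
    (mem_sdiff_of_adj (H.adj_sub huw) (hne u hu) (hne w hw))
  rw [← hF] at h3
  rw [Finset.card_singleton] at h
  omega

/-- `T = {u, v}`: no edge is incident to both, so the edges outside `F` number exactly the sum of
the degrees, which is at most `2 · 2 + 1`. -/
lemma degree_add_degree_le (haci : (binomialEdgeIdeal K G).IsAlmostCompleteIntersection)
    {u v : Fin n} (huv : u ≠ v) (hadj : ¬ G.Adj u v) : G.degree u + G.degree v ≤ 5 := by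
  have hmem : ∀ e, e ∈ (G.edgeFinset \ G.incidenceFinset u) \ G.incidenceFinset v ↔
      e ∈ G.edgeFinset \ G.incidenceFinset u ∧ e ∈ G.edgeFinset \ G.incidenceFinset v := by
    intro e
    simp only [Finset.mem_sdiff]
    tauto
  have h := card_edgeFinset_le haci {u, v}
    ((G.edgeFinset \ G.incidenceFinset u) \ G.incidenceFinset v)
    (fun e he t ht => by
      rw [hmem] at he
      rcases Finset.mem_insert.1 ht with rfl | ht
      · exact notMem_of_mem_sdiff he.1
      · rw [Finset.mem_singleton.1 ht]; exact notMem_of_mem_sdiff he.2)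
    fun p q hpq hp hq => by
      simp only [Finset.mem_insert, Finset.mem_singleton, not_or] at hp hq
      exact reachable_fromEdgeSet hpq (Finset.mem_coe.2 ((hmem _).2
        ⟨mem_sdiff_of_adj hpq hp.1 hq.1, mem_sdiff_of_adj hpq hp.2 hq.2⟩))
  have h1 := card_sdiff_incidenceFinset (G := G) u
  have hsub : G.incidenceFinset v ⊆ G.edgeFinset \ G.incidenceFinset u := by
    intro e he
    refine Finset.mem_sdiff.2 ⟨G.incidenceFinset_subset v he, fun he' => hadj ?_⟩
    rw [SimpleGraph.mem_incidenceFinset] at he he'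
    have := (Sym2.mem_and_mem_iff huv).1 ⟨he'.2, he.2⟩
    rw [← SimpleGraph.mem_edgeSet, ← this]
    exact he.1
  have h2 := Finset.card_sdiff_add_card_eq_card hsub
  rw [G.card_incidenceFinset_eq_degree v] at h2
  rw [Finset.card_pair huv] at h
  omega

lemma not_adj_of_girth (hgirth : 4 ≤ G.girth) (u v w : Fin n) (huv : G.Adj u v)
    (hvw : G.Adj v w) : ¬ G.Adj w u := by
  intro hwu
  have h3 : G.IsNClique 3 {u, v, w} := SimpleGraph.is3Clique_triple_iff.2 ⟨huv, hwu.symm, hvw⟩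
  obtain ⟨x, p, hp, hlen⟩ := SimpleGraph.is3Clique_iff_exists_cycle_length_three.1 ⟨_, h3⟩
  have := SimpleGraph.girth_le_length hp
  omega

/-- The unicyclic graphs of girth at least four whose binomial edge ideal is an almost complete
intersection are obtained from a path by adding an edge. -/
theorem exists_pathVars (hG : G.IsUnicyclic) (hgirth : 4 ≤ G.girth)
    (haci : (binomialEdgeIdeal K G).IsAlmostCompleteIntersection) :
    ∃ (P : PathVars (EdgeVar n) n) (a b : ℕ), a + 2 ≤ b ∧ b < n ∧
      binomialEdgeIdeal K G =
        P.edgeIdeal K (Finset.range (n - 1)) ⊔ Ideal.span {P.minor K a b} := by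
  obtain ⟨hconn, H, hH, -⟩ := hG
  obtain ⟨f, a, b, hinj, hab, hb, hadj⟩ := hconn.exists_path_add_edge hH
    (by rw [Fintype.card_fin]; exact card_edgeFinset_le_card haci hconn)
    (not_adj_of_girth hgirth) (degree_le_three haci) (fun v hv => degree_le_two haci hH hv)
    fun u v huv h => degree_add_degree_le haci huv h
  have hcard := Fintype.card_fin n
  have hsurj : ∀ p, ∃ i < n, f i = p := by
    intro p
    have hbij := (Fintype.bijective_iff_injective_and_card (fun i : Fin n => f i)).2
      ⟨fun i j hij => Fin.ext (hinj i (by omega) j (by omega) hij), rfl⟩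
    obtain ⟨i, hi⟩ := hbij.2 p
    exact ⟨i, i.2, hi⟩
  rw [hcard] at hinj hb hadj
  let P : PathVars (EdgeVar n) n :=
    { x := fun i => Sum.inlₗ (f i)
      y := fun i => Sum.inrₗ (f i)
      x_inj := fun i hi j hj h => hinj i hi j hj (Sum.inl_injective (toLex.injective h))
      y_inj := fun i hi j hj h => hinj i hi j hj (Sum.inr_injective (toLex.injective h))
      x_ne_y := fun i _ j _ h => Sum.inl_ne_inr (toLex.injective h) }
  have hminor : ∀ i j, P.minor K i j = binom K (f i) (f j) := fun _ _ => rfl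
  have hmem : ∀ i j, i < j → j < n → G.Adj (f i) (f j) →
      P.minor K i j ∈ binomialEdgeIdeal K G := by
    intro i j _ _ h
    rw [hminor, ← edgeBinom_mem_iff, binomialEdgeIdeal_eq_span]
    exact Ideal.subset_span ⟨_, h, rfl⟩
  refine ⟨P, a, b, hab, hb, le_antisymm ?_ (sup_le ?_ ?_)⟩
  · have key : ∀ i j, i < j → j < n → G.Adj (f i) (f j) → binom K (f i) (f j) ∈
        P.edgeIdeal K (Finset.range (n - 1)) ⊔ Ideal.span {P.minor K a b} := by
      intro i j hij hj h
      rcases (hadj i j hij hj).1 h with rfl | ⟨rfl, rfl⟩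
      · exact Ideal.mem_sup_left (P.minor_mem (Finset.mem_range.2 (by omega)))
      · exact Ideal.mem_sup_right (Ideal.mem_span_singleton_self _)
    rw [binomialEdgeIdeal_le_iff]
    intro p q hpq
    obtain ⟨i, hi, rfl⟩ := hsurj p
    obtain ⟨j, hj, rfl⟩ := hsurj q
    rcases lt_trichotomy i j with h | h | h
    · exact key i j h hj hpq
    · rw [h] at hpq; exact (G.irrefl hpq).elim
    · rw [binom_swap]
      exact neg_mem (key j i h hi hpq.symm)
  · rw [PathVars.edgeIdeal_le_iff]
    intro e he
    rw [Finset.mem_range] at he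
    exact hmem e (e + 1) (Nat.lt_succ_self e) (by omega)
      ((hadj e (e + 1) (Nat.lt_succ_self e) (by omega)).2 (Or.inl rfl))
  · rw [Ideal.span_singleton_le_iff_mem]
    exact hmem a b (by omega) hb ((hadj a b (by omega) hb).2 (Or.inr ⟨rfl, rfl⟩))

end Classification

end Koszul

end

theorem mainTheorem10 (K : Type*) [Field K] (n : ℕ) (G : SimpleGraph (Fin n))
    (hG : G.IsUnicyclic) (hgirth : 4 ≤ G.girth)
    (haci : (binomialEdgeIdeal K G).IsAlmostCompleteIntersection)
    (s : ℕ) (hs : 1 ≤ s) :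
    ∃ r : ℤ, HasRegularity (EdgeVar n) (quotientGrading (binomialEdgeIdeal K G ^ s)) r ∧
      2 * (s : ℤ) + (n : ℤ) - 5 ≤ r ∧ r ≤ 2 * (s : ℤ) + (n : ℤ) - 4 := by
  classical
  obtain ⟨P, a, b, hab, hb, hJ⟩ := Koszul.exists_pathVars hG hgirth haci
  obtain ⟨k, rfl⟩ : ∃ k, s = k + 1 := ⟨s - 1, by omega⟩
  obtain ⟨δ, c, hδ, hc, hdc, hd⟩ := Koszul.PathVars.exists_cycle (P := P) (K := K) hab hb k
  have hreg := Koszul.PathVars.regLT_pow (P := P) (K := K) hab hb hs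
  rw [hJ]
  obtain ⟨r, hr, h1, h2⟩ := Koszul.exists_hasRegularity
    (((P.isHomog_edgeIdeal _).sup (Koszul.isHomog_span
      (by simpa using ⟨2, P.isHomogeneous_minor a b⟩))).pow (k + 1)) hreg hc hdc hd
  -- With `s = k + 1`, the nonzero class has degree at least `2k + n - 3 = 2s + n - 5`; the
  -- vanishing bound is strict, `r < 2s + n - 3`.
  exact ⟨r, hr, by omega, by omega⟩
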